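/- Let $\mathbb T^2=\mathbb R^2/\mathbb Z^2$. Consider the Navier–Stokes system $$u_t-\Delta u+u\cdot\nabla u+\nabla\pi=f,\qquad \nabla\cdot u=0\qquad\text{on }\mathbb T^2\times[0,\infty),\qquad u(\cdot,0)=u_0,$$ where $u_0\in L^2(\mathbb T^2)$ is divergence-free with $\int_{\mathbb T^2}u_0=0$, and $f$ is measurable with $\int_{\mathbb T^2}f(\cdot,t)=0$ for almost every $t\ge 0$. Here $u$ is a weak solution in $L^\infty_{\rm loc}([0,\infty);L^2)\cap L^2_{\rm loc}([0,\infty);H^1)$, taken as its $L^2$-weakly continuous representative, and $\omega=\nabla\times u=\partial_1u_2-\partial_2u_1$ in the sense of distributions. Suppose that for some $\lambda\ge 0$ and $M\ge 1$ $$\|f\|_{L^\infty([0,\infty);L^p(\mathbb T^2))}\le p^{\lambda}M\qquad\text{for all }2\le p<\infty.$$ (i) There is a time $t_0>0$, depending only on $\|u_0\|_{L^2}$, such that $$\|\omega(\cdot,t)\|_{L^p}\le C\,M\qquad\text{for all }t\ge t_0\text{ and all }2\le p\le\infty,$$ where the constant $C>0$ depends only on $\lambda$ (not on $u_0$, $f$,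 $u$, $M$, $p$, $t$). (ii) For every prescribed $t_0>0$ the same bound holds for all $t\ge t_0$ and all $2\le p\le\infty$, with a constant $C>0$ depending only on $\lambda$, $\|u_0\|_{L^2}$ and $t_0$. -/

import Mathlib

open MeasureTheory Set
open scoped ENNReal NNReal ContDiff

namespace NSTorus

/-- The flat torus `𝕋² = ℝ²/ℤ²`; its `volume` is the normalized Lebesgue measure. -/
abbrev T2 : Type := UnitAddTorus (Fin 2)

/-- `ℝ²` with the Euclidean norm, where the velocity and the force take their values. -/
abbrev V2 : Type := EuclideanSpace ℝ (Fin 2)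

/-- The covering map `ℝ² → 𝕋²`. -/
def proj (y : Fin 2 → ℝ) : T2 := fun i => (y i : UnitAddCircle)

/-- A scalar function on the torus is smooth if its 1-periodic lift to `ℝ²` is `C^∞`. -/
def SmoothScalar (ψ : T2 → ℝ) : Prop :=
  ContDiff ℝ ∞ (fun y : Fin 2 → ℝ => ψ (proj y))

/-- The classical partial derivative `∂_j ψ` on the torus. -/
noncomputable def pd (j : Fin 2) (ψ : T2 → ℝ) (x : T2) : ℝ :=
  deriv (fun h : ℝ => ψ (x + proj (Pi.single j h))) 0

/-- The classical Laplacian on the torus. -/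
noncomputable def lap (ψ : T2 → ℝ) (x : T2) : ℝ :=
  ∑ j : Fin 2, pd j (pd j ψ) x

/-- Smooth divergence-free vector fields on the torus (the test fields). -/
structure IsTestField (φ : T2 → V2) : Prop where
  smooth : ∀ i : Fin 2, SmoothScalar (fun x => φ x i)
  div_free : ∀ x : T2, ∑ i : Fin 2, pd i (fun y => φ y i) x = 0

/-- `∇ · v = 0` in the sense of distributions. -/
def WeakDivFree (v : T2 → V2) : Prop :=
  ∀ ψ : T2 → ℝ, SmoothScalar ψ → ∫ x, ∑ i : Fin 2, v x i * pd i ψ x = 0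

/-- `h = ∂_j g` in the sense of distributions. -/
def IsWeakPartial (j : Fin 2) (g h : T2 → ℝ) : Prop :=
  ∀ ψ : T2 → ℝ, SmoothScalar ψ → ∫ x, g x * pd j ψ x = -∫ x, h x * ψ x

/-- The integrable function `w` is the vorticity `∇ × v = ∂₁ v₂ - ∂₂ v₁` of `v`
in the sense of distributions (the two coordinates are numbered `0` and `1`). -/
def IsVorticity (v : T2 → V2) (w : T2 → ℝ) : Prop :=
  Integrable w volume ∧
    ∀ ψ : T2 → ℝ, SmoothScalar ψ →
      ∫ x, w x * ψ x = ∫ x, (v x 0 * pd 1 ψ x - v x 1 * pd 0 ψ x)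

/-- `u` is a weak solution on `[0, ∞)`, with initial value `u₀`, of the Navier-Stokes system
`u_t - Δu + u·∇u + ∇π = f`, `∇·u = 0` on the torus, in the Leray class
`L^∞_loc([0,∞); L²) ∩ L²_loc([0,∞); H¹)`.  The pressure is eliminated by testing with
divergence-free fields.  Requiring the integrated equation at every `t ≥ 0` selects the weakly
continuous representative `t ↦ u(·,t)` and contains the initial condition. -/
structure IsWeakSolution (u₀ : T2 → V2) (f u : ℝ → T2 → V2) : Prop where
  measurable : AEStronglyMeasurable (fun z : ℝ × T2 => u z.1 z.2)
    ((volume.restrict (Ici (0 : ℝ))).prod (volume : Measure T2))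
  memLp : ∀ t : ℝ, 0 ≤ t → MemLp (u t) 2 volume
  bounded : ∀ T : ℝ, ∃ K : ℝ≥0, ∀ t ∈ Icc (0 : ℝ) T, eLpNorm (u t) 2 volume ≤ K
  /-- `D i j` is the weak derivative `∂_j u_i`. -/
  sobolev : ∃ D : Fin 2 → Fin 2 → ℝ → T2 → ℝ,
    (∀ i j : Fin 2, ∀ T : ℝ, MemLp (fun z : ℝ × T2 => D i j z.1 z.2) 2
      ((volume.restrict (Icc (0 : ℝ) T)).prod (volume : Measure T2))) ∧
    ∀ i j : Fin 2, ∀ᵐ t ∂(volume.restrict (Ici (0 : ℝ))),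
      IsWeakPartial j (fun x => u t x i) (D i j t)
  div_free : ∀ t : ℝ, 0 ≤ t → WeakDivFree (u t)
  momentum : ∀ φ : T2 → V2, IsTestField φ → ∀ t : ℝ, 0 ≤ t →
    ∫ x, ∑ i : Fin 2, u t x i * φ x i =
      (∫ x, ∑ i : Fin 2, u₀ x i * φ x i) +
      ∫ s in (0 : ℝ)..t, ∫ x,
        ((∑ i : Fin 2, u s x i * lap (fun y => φ y i) x) +
          (∑ i : Fin 2, ∑ j : Fin 2, u s x j * u s x i * pd j (fun y => φ y i) x) +
          ∑ i : Fin 2, f s x i * φ x i)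

/-- Admissible initial data: divergence-free and mean-zero in `L²(𝕋²)`. -/
structure IsInitialDatum (u₀ : T2 → V2) : Prop where
  memLp : MemLp u₀ 2 volume
  div_free : WeakDivFree u₀
  mean_zero : ∫ x, u₀ x = 0

/-- Admissible forces: measurable, mean-zero in space, and
`‖f‖_{L^∞([0,∞), L^p)} ≤ p^lam * M` for all `2 ≤ p < ∞`. -/
structure IsForce (lam M : ℝ) (f : ℝ → T2 → V2) : Prop where
  measurable : AEStronglyMeasurable (fun z : ℝ × T2 => f z.1 z.2)
    ((volume.restrict (Ici (0 : ℝ))).prod (volume : Measure T2))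
  mean_zero : ∀ᵐ t ∂(volume.restrict (Ici (0 : ℝ))), ∫ x, f t x = 0
  bound : ∀ p : ℝ, 2 ≤ p →
    essSup (fun t => eLpNorm (f t) (ENNReal.ofReal p) volume) (volume.restrict (Ici (0 : ℝ))) ≤
      ENNReal.ofReal (p ^ lam * M)

/-- The vorticity of `v` is a function with `‖ω‖_{L^p} ≤ B` for all `2 ≤ p ≤ ∞`. -/
def VorticityBound (v : T2 → V2) (B : ℝ) : Prop :=
  ∃ w : T2 → ℝ, IsVorticity v w ∧
    ∀ p : ℝ≥0∞, 2 ≤ p → eLpNorm w p volume ≤ ENNReal.ofReal B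

end NSTorus

/-!
The vorticity `ω` of a planar flow satisfies `∂ₜω - Δω + u·∇ω = ∇ × f`, without stretching. A weak
solution is not smooth enough to test this equation with nonlinear functions of `ω`, so everything
rests on two steps: renormalizing the equation, and a local maximum principle for it whose constants
do not depend on `u`.

**Renormalization.** Mollify with the kernel `ker m`, a normalized power of `cos² πx₀ cos² πx₁`. It
is a trigonometric polynomial, so the mollified velocity `mol m u` and vorticity `molVort m u` are
combinations of finitely many pairings of `u` with divergence-free modes. The weak equation makes
these pairings Lipschitz in time, and the chain rule in time needs nothing beyond finite dimension
(`integral_comp_sub_eq`). In space the only loss is the commutator of mollification and transport.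
It is an integral of products of increments of `ω` (or `u`) and of `u` against `∇(ker m)`
(`IsSobolevDivFree.integral_commutator`); since `‖u(· + z) - u‖ ≤ C |z| ‖∇u‖`, it tends to zero for
`u ∈ H¹` and `ω ∈ L²`, as in the theory of DiPerna and Lions (`abs_commutator_le`,
`tendsto_modulus`). This gives

* the energy inequality (`energy_inequality`) and, by Poincaré's inequality, exponential decay of the
  energy up to a multiple of `F²`, where `F` bounds the force (`energy_le`); hence `∫∫ ω²` over a
  time interval of length at most one is bounded by the decayed initial energy and `F²`;
* the inequality for `∫ β(ω)` with `β` convex with bounded derivatives (`gen_curl_mol_le`), where the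
  force appears only through `∫ β''(ω) |f|²`. Combined with Ladyzhenskaya's inequality it bounds
  `∫∫ β'(ω)⁴` by `∫ β(ω)` at the initial time and the force (`integral_vort_pow_four_le`); letting
  `β` increase to `(s - k)₊² / 2`, one obtains `level_estimate` for the excess of `ω` over `k`.

**The local maximum principle.** De Giorgi's iteration of `level_estimate` over increasing levels and
shrinking time intervals bounds `|ω|` almost everywhere on the second half of an interval of length
`τ ≤ 1` by `C_τ (‖ω‖_{L²} + F)` (`vort_le`). The iteration converges because on the set where `ω`
exceeds a level the force gains a power of the measure of this set; for this the force in `L^∞(L⁸)`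
suffices, so that `F = 8 ^ lam * M` and all exponents `p`, including `p = ∞`, are reached at once.

The bound at almost every time reads `|∫ u · ∇^⊥ψ| ≤ K ∫ |ψ|` in weak form, which persists at every
time by weak continuity (`abs_pair_curl_le`) and is turned back into a bounded function `ω` by duality
(`exists_bounded_vorticity`). In `vorticityBound_of_energy` the interval is `[s, s + τ]`. For the first
part, `τ = 1` and `s` is so large that the decayed initial energy is at most one, so the constant
depends on `lam` alone; for the second, `τ = min 1 t₀`.
-/

namespace NSTorus

/-! ### Calculus of smooth functions on the torus -/

instance : IsProbabilityMeasure (volume : Measure T2) := by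
  have : IsProbabilityMeasure (volume : Measure UnitAddCircle) :=
    ⟨UnitAddCircle.measure_univ⟩
  exact inferInstanceAs
    (IsProbabilityMeasure (Measure.pi fun _ : Fin 2 => (volume : Measure UnitAddCircle)))

instance : (volume : Measure T2).IsNegInvariant := by
  exact Measure.IsAddHaarMeasure.isNegInvariant_of_regular (G := T2) volume

lemma proj_add (y z : Fin 2 → ℝ) : proj (y + z) = proj y + proj z := by
  ext i; simp [proj]

lemma proj_zero : proj 0 = 0 := by
  ext i; simp [proj]

lemma proj_neg (y : Fin 2 → ℝ) : proj (-y) = -proj y := by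
  ext i; simp [proj]

lemma proj_surjective : Function.Surjective proj := by
  intro x
  choose y hy using fun i => QuotientAddGroup.mk_surjective (x i)
  exact ⟨y, funext hy⟩

lemma isOpenQuotientMap_proj : IsOpenQuotientMap proj :=
  IsOpenQuotientMap.piMap fun _ : Fin 2 =>
    (QuotientAddGroup.isOpenQuotientMap_mk : IsOpenQuotientMap ((↑) : ℝ → UnitAddCircle))

lemma continuous_proj : Continuous proj := isOpenQuotientMap_proj.continuous

lemma proj_single_zero (j : Fin 2) : proj (Pi.single j (0 : ℝ)) = 0 := by
  rw [Pi.single_zero, proj_zero]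

namespace SmoothScalar

variable {ψ φ : T2 → ℝ}

lemma continuous (hψ : SmoothScalar ψ) : Continuous ψ :=
  isOpenQuotientMap_proj.isQuotientMap.continuous_iff.2 (ContDiff.continuous hψ)

lemma const (c : ℝ) : SmoothScalar fun _ => c := by
  unfold SmoothScalar; exact contDiff_const

lemma add (hψ : SmoothScalar ψ) (hφ : SmoothScalar φ) : SmoothScalar fun x => ψ x + φ x :=
  ContDiff.add hψ hφ

lemma sub (hψ : SmoothScalar ψ) (hφ : SmoothScalar φ) : SmoothScalar fun x => ψ x - φ x :=
  ContDiff.sub hψ hφ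

lemma neg (hψ : SmoothScalar ψ) : SmoothScalar fun x => -ψ x :=
  ContDiff.neg hψ

lemma mul (hψ : SmoothScalar ψ) (hφ : SmoothScalar φ) : SmoothScalar fun x => ψ x * φ x :=
  ContDiff.mul hψ hφ

lemma pow (hψ : SmoothScalar ψ) (n : ℕ) : SmoothScalar fun x => ψ x ^ n :=
  ContDiff.pow hψ n

lemma comp (hψ : SmoothScalar ψ) {β : ℝ → ℝ} (hβ : ContDiff ℝ ∞ β) :
    SmoothScalar fun x => β (ψ x) :=
  ContDiff.comp hβ hψ

lemma sum {ι : Type*} {s : Finset ι} {F : ι → T2 → ℝ} (hF : ∀ a ∈ s, SmoothScalar (F a)) :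
    SmoothScalar fun x => ∑ a ∈ s, F a x :=
  ContDiff.sum (f := fun a (y : Fin 2 → ℝ) => F a (proj y)) hF

lemma translate (hψ : SmoothScalar ψ) (a : T2) : SmoothScalar fun x => ψ (x + a) := by
  obtain ⟨b, rfl⟩ := proj_surjective a
  unfold SmoothScalar
  simp_rw [← proj_add]
  exact ContDiff.comp (g := fun y => ψ (proj y)) hψ (contDiff_id.add contDiff_const)

lemma reflect (hψ : SmoothScalar ψ) : SmoothScalar fun x => ψ (-x) := by
  unfold SmoothScalar
  simp_rw [← proj_neg]
  exact ContDiff.comp (g := fun y => ψ (proj y)) hψ contDiff_neg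

lemma bounded (hψ : SmoothScalar ψ) : ∃ K : ℝ, 0 ≤ K ∧ ∀ x, |ψ x| ≤ K := by
  obtain ⟨K, hK⟩ := isCompact_univ.exists_bound_of_continuousOn hψ.continuous.continuousOn
  exact ⟨max K 0, le_max_right _ _, fun x => (hK x (mem_univ x)).trans (le_max_left _ _)⟩

lemma hasDerivAt_fderiv (hψ : SmoothScalar ψ) (j : Fin 2) (y : Fin 2 → ℝ) (h : ℝ) :
    HasDerivAt (fun h : ℝ => ψ (proj y + proj (Pi.single j h)))
      (fderiv ℝ (fun y => ψ (proj y)) (y + Pi.single j h) (Pi.single j 1)) h := by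
  simp_rw [← proj_add]
  have h1 : HasFDerivAt (fun y => ψ (proj y))
      (fderiv ℝ (fun y => ψ (proj y)) (y + Pi.single j h)) (y + Pi.single j h) :=
    (ContDiff.differentiable hψ (by simp)).differentiableAt.hasFDerivAt
  have h2 : HasDerivAt (fun h : ℝ => y + Pi.single j h) (Pi.single j (1 : ℝ)) h :=
    (hasDerivAt_single j h).const_add y
  exact h1.comp_hasDerivAt h h2

lemma pd_proj (hψ : SmoothScalar ψ) (j : Fin 2) (y : Fin 2 → ℝ) :
    pd j ψ (proj y) = fderiv ℝ (fun y => ψ (proj y)) y (Pi.single j 1) := by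
  have := (hψ.hasDerivAt_fderiv j y 0).deriv
  simpa [pd] using this

lemma hasDerivAt (hψ : SmoothScalar ψ) (j : Fin 2) (x : T2) (h : ℝ) :
    HasDerivAt (fun h : ℝ => ψ (x + proj (Pi.single j h)))
      (pd j ψ (x + proj (Pi.single j h))) h := by
  obtain ⟨y, rfl⟩ := proj_surjective x
  rw [← proj_add, hψ.pd_proj]
  exact hψ.hasDerivAt_fderiv j y h

lemma hasDerivAt_zero (hψ : SmoothScalar ψ) (j : Fin 2) (x : T2) :
    HasDerivAt (fun h : ℝ => ψ (x + proj (Pi.single j h))) (pd j ψ x) 0 := by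
  simpa [proj_zero] using hψ.hasDerivAt j x 0

lemma pd (hψ : SmoothScalar ψ) (j : Fin 2) : SmoothScalar (pd j ψ) := by
  unfold SmoothScalar
  simp_rw [hψ.pd_proj]
  exact (ContDiff.fderiv_right hψ (m := ∞) (by simp)).clm_apply contDiff_const

lemma lap (hψ : SmoothScalar ψ) : SmoothScalar (lap ψ) :=
  SmoothScalar.sum fun j _ => (hψ.pd j).pd j

lemma integrable (hψ : SmoothScalar ψ) : Integrable ψ volume :=
  hψ.continuous.integrable_of_hasCompactSupport (HasCompactSupport.of_compactSpace _)

lemma memLp (hψ : SmoothScalar ψ) (p : ℝ≥0∞) : MemLp ψ p volume := by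
  obtain ⟨K, -, hK⟩ := hψ.bounded
  exact MemLp.of_bound hψ.continuous.aestronglyMeasurable K (.of_forall hK)

end SmoothScalar

variable {ψ φ : T2 → ℝ}

lemma pd_eq {j : Fin 2} {x : T2} {d : ℝ}
    (h : HasDerivAt (fun h : ℝ => ψ (x + proj (Pi.single j h))) d 0) : pd j ψ x = d := h.deriv

lemma pd_const (j : Fin 2) (c : ℝ) (x : T2) : pd j (fun _ => c) x = 0 := by simp [pd]

lemma pd_add (hψ : SmoothScalar ψ) (hφ : SmoothScalar φ) (j : Fin 2) (x : T2) :
    pd j (fun x => ψ x + φ x) x = pd j ψ x + pd j φ x :=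
  pd_eq ((hψ.hasDerivAt_zero j x).add (hφ.hasDerivAt_zero j x))

lemma pd_sub (hψ : SmoothScalar ψ) (hφ : SmoothScalar φ) (j : Fin 2) (x : T2) :
    pd j (fun x => ψ x - φ x) x = pd j ψ x - pd j φ x :=
  pd_eq ((hψ.hasDerivAt_zero j x).sub (hφ.hasDerivAt_zero j x))

lemma pd_neg (hψ : SmoothScalar ψ) (j : Fin 2) (x : T2) :
    pd j (fun x => -ψ x) x = -pd j ψ x :=
  pd_eq (hψ.hasDerivAt_zero j x).neg

lemma pd_mul (hψ : SmoothScalar ψ) (hφ : SmoothScalar φ) (j : Fin 2) (x : T2) :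
    pd j (fun x => ψ x * φ x) x = pd j ψ x * φ x + ψ x * pd j φ x := by
  refine pd_eq ?_
  have := (hψ.hasDerivAt_zero j x).fun_mul (hφ.hasDerivAt_zero j x)
  simpa only [proj_single_zero, add_zero] using this

lemma pd_const_mul (hψ : SmoothScalar ψ) (c : ℝ) (j : Fin 2) (x : T2) :
    pd j (fun x => c * ψ x) x = c * pd j ψ x :=
  pd_eq ((hψ.hasDerivAt_zero j x).const_mul c)

lemma pd_sum {ι : Type*} {s : Finset ι} {F : ι → T2 → ℝ} (hF : ∀ a ∈ s, SmoothScalar (F a))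
    (j : Fin 2) (x : T2) :
    pd j (fun x => ∑ a ∈ s, F a x) x = ∑ a ∈ s, pd j (F a) x :=
  pd_eq (HasDerivAt.fun_sum fun a ha => (hF a ha).hasDerivAt_zero j x)

lemma pd_comp (hψ : SmoothScalar ψ) {β : ℝ → ℝ} (hβ : Differentiable ℝ β) (j : Fin 2) (x : T2) :
    pd j (fun x => β (ψ x)) x = deriv β (ψ x) * pd j ψ x := by
  refine pd_eq ?_
  have h1 : HasDerivAt β (deriv β (ψ x)) (ψ (x + proj (Pi.single j 0))) := by
    rw [proj_single_zero, add_zero]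
    exact (hβ (ψ x)).hasDerivAt
  exact h1.comp (0 : ℝ) (hψ.hasDerivAt_zero j x)

lemma pd_translate (ψ : T2 → ℝ) (a : T2) (j : Fin 2) (x : T2) :
    pd j (fun x => ψ (x + a)) x = pd j ψ (x + a) := by
  simp only [pd, add_right_comm]

lemma pd_reflect (hψ : SmoothScalar ψ) (j : Fin 2) (x : T2) :
    pd j (fun x => ψ (-x)) x = -pd j ψ (-x) := by
  refine pd_eq ?_
  have h0 : HasDerivAt (fun h : ℝ => ψ (-x + proj (Pi.single j h))) (pd j ψ (-x)) (-0) := by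
    simpa using hψ.hasDerivAt_zero j (-x)
  have := h0.comp (0 : ℝ) (hasDerivAt_neg (0 : ℝ))
  have e : (fun h : ℝ => ψ (-(x + proj (Pi.single j h)))) =
      (fun h : ℝ => ψ (-x + proj (Pi.single j h))) ∘ Neg.neg := by
    ext h
    simp only [Function.comp, Pi.single_neg, proj_neg, neg_add]
  rw [e]; simpa using this

/-- Symmetry of second derivatives. -/
lemma pd_comm (hψ : SmoothScalar ψ) (i j : Fin 2) (x : T2) :
    pd i (pd j ψ) x = pd j (pd i ψ) x := by
  obtain ⟨y, rfl⟩ := proj_surjective x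
  have key : ∀ i j : Fin 2, pd i (pd j ψ) (proj y) =
      fderiv ℝ (fderiv ℝ (fun y => ψ (proj y))) y (Pi.single i 1) (Pi.single j 1) := by
    intro i j
    rw [(hψ.pd j).pd_proj]
    simp_rw [hψ.pd_proj]
    have hd : DifferentiableAt ℝ (fderiv ℝ (fun y => ψ (proj y))) y :=
      ((ContDiff.fderiv_right hψ (m := ∞) (by simp)).differentiable (by simp)).differentiableAt
    rw [fderiv_clm_apply hd (differentiableAt_const _)]
    simp
  rw [key, key]
  exact (ContDiffAt.isSymmSndFDerivAt (ContDiff.contDiffAt hψ)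
    (by simp; norm_cast)).eq _ _

/-- The integral of a derivative vanishes, by translation invariance. -/
lemma integral_pd (hψ : SmoothScalar ψ) (j : Fin 2) : ∫ x, pd j ψ x = 0 := by
  obtain ⟨K, -, hK⟩ := (hψ.pd j).bounded
  have h := (hasDerivAt_integral_of_dominated_loc_of_deriv_le
    (F := fun (h : ℝ) (x : T2) => ψ (x + proj (Pi.single j h)))
    (F' := fun (h : ℝ) (x : T2) => pd j ψ (x + proj (Pi.single j h)))
    (μ := (volume : Measure T2)) (x₀ := 0) (bound := fun _ => K) (s := univ) Filter.univ_mem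
    (.of_forall fun h => (hψ.translate _).continuous.aestronglyMeasurable)
    (hψ.translate _).integrable ((hψ.pd j).translate _).continuous.aestronglyMeasurable
    (.of_forall fun x h _ => hK _) (integrable_const _)
    (.of_forall fun x h _ => hψ.hasDerivAt j x h)).2
  simp only [integral_add_right_eq_self, proj_single_zero, add_zero] at h
  exact h.unique (hasDerivAt_const _ _)

lemma integral_pd_mul (hψ : SmoothScalar ψ) (hφ : SmoothScalar φ) (j : Fin 2) :
    ∫ x, pd j ψ x * φ x = -∫ x, ψ x * pd j φ x := by
  have h := integral_pd (hψ.mul hφ) j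
  simp_rw [pd_mul hψ hφ] at h
  rw [integral_add ((hψ.pd j).mul hφ).integrable (hψ.mul (hφ.pd j)).integrable] at h
  linarith

/-! ### The `L²` norm and translations -/

/-- The `L²` norm of a real function on the torus; it is only used for functions in `L²`. -/
noncomputable def nrm (g : T2 → ℝ) : ℝ := √(∫ x, g x ^ 2)

lemma nrm_nonneg (g : T2 → ℝ) : 0 ≤ nrm g := Real.sqrt_nonneg _

lemma sq_nrm (g : T2 → ℝ) : nrm g ^ 2 = ∫ x, g x ^ 2 :=
  Real.sq_sqrt (integral_nonneg fun _ => sq_nonneg _)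

lemma integral_abs_mul_le_sqrt {α : Type*} [MeasurableSpace α] {μ : Measure α} {f g : α → ℝ}
    (hf : MemLp f 2 μ) (hg : MemLp g 2 μ) :
    ∫ x, |f x * g x| ∂μ ≤ √(∫ x, f x ^ 2 ∂μ) * √(∫ x, g x ^ 2 ∂μ) := by
  have h := integral_mul_norm_le_Lp_mul_Lq (μ := μ) (f := f) (g := g) (p := 2) (q := 2)
    (by rw [Real.holderConjugate_iff]; norm_num) (by simpa using hf) (by simpa using hg)
  simpa [Real.sqrt_eq_rpow, abs_mul] using h

lemma integral_abs_mul_le {f g : T2 → ℝ} (hf : MemLp f 2 volume) (hg : MemLp g 2 volume) :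
    ∫ x, |f x * g x| ≤ nrm f * nrm g :=
  integral_abs_mul_le_sqrt hf hg

lemma abs_integral_mul_le {f g : T2 → ℝ} (hf : MemLp f 2 volume) (hg : MemLp g 2 volume) :
    |∫ x, f x * g x| ≤ nrm f * nrm g :=
  abs_integral_le_integral_abs.trans (integral_abs_mul_le hf hg)

lemma integral_abs_le_nrm {f : T2 → ℝ} (hf : MemLp f 2 volume) : ∫ x, |f x| ≤ nrm f := by
  simpa [nrm] using integral_abs_mul_le hf (memLp_const (1 : ℝ))

lemma nrm_add_le {f g : T2 → ℝ} (hf : MemLp f 2 volume) (hg : MemLp g 2 volume) :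
    nrm (fun x => f x + g x) ≤ nrm f + nrm g := by
  refine Real.sqrt_le_iff.2 ⟨add_nonneg (nrm_nonneg _) (nrm_nonneg _), ?_⟩
  have h1 := (le_abs_self _).trans (abs_integral_mul_le hf hg)
  have h2 : ∫ x, (f x + g x) ^ 2 = (∫ x, f x ^ 2) + 2 * (∫ x, f x * g x) + ∫ x, g x ^ 2 := by
    have e : (fun x => (f x + g x) ^ 2) = fun x => f x ^ 2 + 2 * (f x * g x) + g x ^ 2 := by
      ext x; ring
    have i1 : Integrable (fun x => 2 * (f x * g x)) (volume : Measure T2) :=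
      (hf.integrable_mul hg).const_mul 2
    rw [e, integral_add (f := fun x => f x ^ 2 + 2 * (f x * g x)) (hf.integrable_sq.add i1)
      hg.integrable_sq, integral_add hf.integrable_sq i1, integral_const_mul]
  rw [h2, ← sq_nrm, ← sq_nrm]
  nlinarith

lemma nrm_neg (f : T2 → ℝ) : nrm (fun x => -f x) = nrm f := by simp [nrm]

lemma nrm_sub_le {f g : T2 → ℝ} (hf : MemLp f 2 volume) (hg : MemLp g 2 volume) :
    nrm (fun x => f x - g x) ≤ nrm f + nrm g := by
  have := nrm_add_le hf hg.neg
  simp only [Pi.neg_apply, ← sub_eq_add_neg] at this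
  rwa [show nrm (-g) = nrm g from nrm_neg g] at this

lemma nrm_sub_comm (f g : T2 → ℝ) : nrm (fun x => f x - g x) = nrm (fun x => g x - f x) := by
  rw [← nrm_neg]; simp

lemma abs_nrm_sub_nrm_le {f g : T2 → ℝ} (hf : MemLp f 2 volume) (hg : MemLp g 2 volume) :
    |nrm f - nrm g| ≤ nrm (fun x => f x - g x) := by
  have h1 := nrm_add_le (hf.sub hg) hg
  have h2 := nrm_add_le (hg.sub hf) hf
  simp only [Pi.sub_apply, sub_add_cancel] at h1 h2
  have h3 := nrm_sub_comm f g
  rw [abs_le]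
  constructor
  · have : nrm g ≤ nrm (fun x => g x - f x) + nrm f := h2
    linarith
  · have : nrm f ≤ nrm (fun x => f x - g x) + nrm g := h1
    linarith

lemma nrm_mono {f g : T2 → ℝ} (hg : MemLp g 2 volume) (h : ∀ᵐ x, |f x| ≤ |g x|) :
    nrm f ≤ nrm g := by
  refine Real.sqrt_le_sqrt (integral_mono_of_nonneg (.of_forall fun _ => sq_nonneg _)
    hg.integrable_sq (h.mono fun x hx => sq_le_sq.2 hx))

lemma nrm_le_of_bound {f : T2 → ℝ} {K : ℝ} (hK : 0 ≤ K) (h : ∀ x, |f x| ≤ K) : nrm f ≤ K := by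
  have := nrm_mono (f := f) (memLp_const K)
    (.of_forall fun x => (h x).trans (le_abs_self K))
  refine this.trans (le_of_eq ?_)
  simp [nrm, Real.sqrt_sq hK]

lemma memLp_translate {g : T2 → ℝ} {p : ℝ≥0∞} (hg : MemLp g p volume) (z : T2) :
    MemLp (fun x => g (x + z)) p volume :=
  hg.comp_measurePreserving (measurePreserving_add_right volume z)

/-- The increment `g(· + z) - g`. -/
def dl (z : T2) (g : T2 → ℝ) (x : T2) : ℝ := g (x + z) - g x

lemma memLp_dl {g : T2 → ℝ} {p : ℝ≥0∞} (hg : MemLp g p volume) (z : T2) : MemLp (dl z g) p volume :=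
  (memLp_translate hg z).sub hg

lemma nrm_translate (g : T2 → ℝ) (z : T2) : nrm (fun x => g (x + z)) = nrm g := by
  unfold nrm
  rw [integral_add_right_eq_self (fun x => g x ^ 2)]

lemma nrm_dl_le {g : T2 → ℝ} (hg : MemLp g 2 volume) (z : T2) : nrm (dl z g) ≤ 2 * nrm g := by
  have := nrm_sub_le (memLp_translate hg z) hg
  rw [nrm_translate] at this
  rw [two_mul]
  exact this

lemma nrm_dl_add_le {g : T2 → ℝ} (hg : MemLp g 2 volume) (y z : T2) :
    nrm (dl (y + z) g) ≤ nrm (dl y g) + nrm (dl z g) := by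
  have := nrm_add_le (memLp_translate (memLp_dl hg y) z) (memLp_dl hg z)
  rw [nrm_translate] at this
  refine le_trans (le_of_eq ?_) this
  congr 1
  ext x
  simp only [dl]
  rw [add_right_comm x z y, add_assoc]
  ring

lemma nrm_dl_add_fun_le {f g : T2 → ℝ} (hf : MemLp f 2 volume) (hg : MemLp g 2 volume) (z : T2) :
    nrm (dl z (fun x => f x + g x)) ≤ nrm (dl z f) + nrm (dl z g) := by
  refine le_trans (le_of_eq ?_) (nrm_add_le (memLp_dl hf z) (memLp_dl hg z))
  congr 1
  ext x
  simp only [dl]; ring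

/-- Translations are continuous in `L²`. -/
lemma tendsto_nrm_dl {g : T2 → ℝ} (hg : MemLp g 2 volume) :
    Filter.Tendsto (fun z => nrm (dl z g)) (nhds 0) (nhds 0) := by
  refine Metric.tendsto_nhds.2 fun ε hε => ?_
  obtain ⟨c, hc, hcm⟩ := hg.exists_boundedContinuous_eLpNorm_sub_le (by simp)
    (ε := ENNReal.ofReal (ε / 4)) (by simpa using hε)
  have hcm' : nrm (fun x => g x - c x) ≤ ε / 4 := by
    have h1 := (MemLp.sub hg hcm).eLpNorm_eq_integral_rpow_norm (by simp) (by simp)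
    have h2 : eLpNorm (g - ⇑c) 2 volume = ENNReal.ofReal (nrm (fun x => g x - c x)) := by
      rw [h1]; simp [nrm, Real.sqrt_eq_rpow]
    rw [h2] at hc
    exact (ENNReal.ofReal_le_ofReal_iff (by positivity)).1 hc
  have huc := CompactSpace.uniformContinuous_of_continuous c.continuous
  rw [Metric.uniformContinuous_iff] at huc
  obtain ⟨δ, hδ, hd⟩ := huc (ε / 4) (by positivity)
  filter_upwards [Metric.ball_mem_nhds (0 : T2) hδ] with z hz
  have h1 : nrm (dl z c) ≤ ε / 4 := by
    refine nrm_le_of_bound (by positivity) fun x => ?_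
    have := hd (a := x + z) (b := x) (by simpa using hz)
    exact this.le
  have h2 := nrm_dl_add_fun_le (hg.sub hcm) hcm z
  have h3 := nrm_dl_le (hg.sub hcm) z
  have e : (fun x => (g - ⇑c) x + c x) = g := by ext x; simp
  rw [e] at h2
  have h4 : nrm (g - ⇑c) ≤ ε / 4 := hcm'
  rw [Real.dist_eq, sub_zero, abs_of_nonneg (nrm_nonneg _)]
  linarith

lemma continuous_nrm_dl {g : T2 → ℝ} (hg : MemLp g 2 volume) :
    Continuous fun z => nrm (dl z g) := by
  refine continuous_iff_continuousAt.2 fun z => ?_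
  have h0 : Filter.Tendsto (fun y => nrm (dl (y - z) g)) (nhds z) (nhds 0) := by
    refine (tendsto_nrm_dl hg).comp ?_
    exact tendsto_sub_nhds_zero_iff.2 Filter.tendsto_id
  refine tendsto_iff_dist_tendsto_zero.2
    (squeeze_zero (fun _ => dist_nonneg) (fun y => ?_) h0)
  rw [Real.dist_eq]
  refine (abs_nrm_sub_nrm_le (memLp_dl hg y) (memLp_dl hg z)).trans (le_of_eq ?_)
  rw [← nrm_translate (dl (y - z) g) z]
  congr 1
  ext x
  simp only [dl]
  rw [add_assoc x z, add_sub_cancel]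
  ring

/-! ### Real Fourier modes -/

/-- The mode `cos (2π k·x)`. -/
noncomputable def mc (k : Fin 2 → ℤ) (x : T2) : ℝ := (UnitAddTorus.mFourier k x).re

/-- The mode `sin (2π k·x)`. -/
noncomputable def ms (k : Fin 2 → ℤ) (x : T2) : ℝ := (UnitAddTorus.mFourier k x).im

lemma mFourier_proj (k : Fin 2 → ℤ) (y : Fin 2 → ℝ) :
    UnitAddTorus.mFourier k (proj y) =
      Complex.exp ((2 * Real.pi * (k 0 * y 0 + k 1 * y 1) : ℝ) * Complex.I) := by
  have : UnitAddTorus.mFourier k (proj y) = ∏ i, fourier (k i) (proj y i) := rfl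
  rw [this, Fin.prod_univ_two]
  simp only [proj, fourier_coe_apply, ← Complex.exp_add]
  congr 1
  push_cast
  ring

lemma mc_proj (k : Fin 2 → ℤ) (y : Fin 2 → ℝ) :
    mc k (proj y) = Real.cos (2 * Real.pi * (k 0 * y 0 + k 1 * y 1)) := by
  rw [mc, mFourier_proj, Complex.exp_ofReal_mul_I_re]

lemma ms_proj (k : Fin 2 → ℤ) (y : Fin 2 → ℝ) :
    ms k (proj y) = Real.sin (2 * Real.pi * (k 0 * y 0 + k 1 * y 1)) := by
  rw [ms, mFourier_proj, Complex.exp_ofReal_mul_I_im]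

lemma smooth_mc (k : Fin 2 → ℤ) : SmoothScalar (mc k) := by
  unfold SmoothScalar
  simp_rw [mc_proj]
  fun_prop

lemma smooth_ms (k : Fin 2 → ℤ) : SmoothScalar (ms k) := by
  unfold SmoothScalar
  simp_rw [ms_proj]
  fun_prop

lemma hasDerivAt_phase (k : Fin 2 → ℤ) (j : Fin 2) (y : Fin 2 → ℝ) :
    HasDerivAt (fun h : ℝ => 2 * Real.pi * (k 0 * (y + Pi.single j h : Fin 2 → ℝ) 0 +
      k 1 * (y + Pi.single j h : Fin 2 → ℝ) 1)) (2 * Real.pi * k j) 0 := by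
  fin_cases j
  · have := (((hasDerivAt_id (0 : ℝ)).const_add (y 0)).const_mul (k 0 : ℝ)).add_const
      (k 1 * y 1 : ℝ) |>.const_mul (2 * Real.pi)
    simpa using this
  · have := (((hasDerivAt_id (0 : ℝ)).const_add (y 1)).const_mul (k 1 : ℝ)).const_add
      (k 0 * y 0 : ℝ) |>.const_mul (2 * Real.pi)
    simpa using this

lemma pd_mc (k : Fin 2 → ℤ) (j : Fin 2) (x : T2) :
    pd j (mc k) x = -(2 * Real.pi * k j) * ms k x := by
  obtain ⟨y, rfl⟩ := proj_surjective x
  refine pd_eq ?_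
  simp_rw [← proj_add, mc_proj, ms_proj]
  have := (hasDerivAt_phase k j y).cos
  simp only [Pi.single_zero, add_zero] at this
  convert this using 1
  ring

lemma pd_ms (k : Fin 2 → ℤ) (j : Fin 2) (x : T2) :
    pd j (ms k) x = 2 * Real.pi * k j * mc k x := by
  obtain ⟨y, rfl⟩ := proj_surjective x
  refine pd_eq ?_
  simp_rw [← proj_add, ms_proj, mc_proj]
  have := (hasDerivAt_phase k j y).sin
  simp only [Pi.single_zero, add_zero] at this
  convert this using 1
  ring

lemma mc_sub_apply (k : Fin 2 → ℤ) (x y : T2) :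
    mc k (x - y) = mc k x * mc k y + ms k x * ms k y := by
  obtain ⟨x, rfl⟩ := proj_surjective x
  obtain ⟨y, rfl⟩ := proj_surjective y
  rw [sub_eq_add_neg, ← proj_neg, ← proj_add, mc_proj, mc_proj, mc_proj, ms_proj, ms_proj,
    ← Real.cos_sub]
  congr 1
  simp only [Pi.add_apply, Pi.neg_apply]
  ring

lemma mc_mul_mc (k l : Fin 2 → ℤ) (x : T2) :
    mc k x * mc l x = (1 / 2) * mc (k + l) x + (1 / 2) * mc (k - l) x := by
  obtain ⟨x, rfl⟩ := proj_surjective x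
  simp only [mc_proj, Pi.add_apply, Pi.sub_apply]
  push_cast
  rw [show 2 * Real.pi * ((k 0 + l 0) * x 0 + (k 1 + l 1) * x 1) =
    2 * Real.pi * (k 0 * x 0 + k 1 * x 1) + 2 * Real.pi * (l 0 * x 0 + l 1 * x 1) by ring,
    show 2 * Real.pi * ((k 0 - l 0) * x 0 + (k 1 - l 1) * x 1) =
    2 * Real.pi * (k 0 * x 0 + k 1 * x 1) - 2 * Real.pi * (l 0 * x 0 + l 1 * x 1) by ring,
    Real.cos_add, Real.cos_sub]
  ring

lemma mc_zero (x : T2) : mc 0 x = 1 := by simp [mc, UnitAddTorus.mFourier_zero]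

lemma mc_neg_apply (k : Fin 2 → ℤ) (x : T2) : mc k (-x) = mc k x := by
  have h0 : ms k 0 = 0 := by rw [← proj_zero, ms_proj]; simp
  have h1 : mc k 0 = 1 := by rw [← proj_zero, mc_proj]; simp
  rw [← zero_sub, mc_sub_apply, h0, h1]
  ring

lemma mc_sq_add_ms_sq (k : Fin 2 → ℤ) (x : T2) : mc k x ^ 2 + ms k x ^ 2 = 1 := by
  obtain ⟨x, rfl⟩ := proj_surjective x
  rw [mc_proj, ms_proj, Real.cos_sq_add_sin_sq]

/-- The real Fourier modes, cosines and sines together. -/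
noncomputable def md (a : (Fin 2 → ℤ) × Bool) : T2 → ℝ := if a.2 then ms a.1 else mc a.1

lemma smooth_md (a : (Fin 2 → ℤ) × Bool) : SmoothScalar (md a) := by
  unfold md; split
  · exact smooth_ms _
  · exact smooth_mc _

/-- The span of the cosines; its elements `κ` have the finite-rank kernels `κ (x - y)`. -/
noncomputable def cosSpan : Submodule ℝ (T2 → ℝ) := Submodule.span ℝ (range mc)

lemma cosSpan_mul {f g : T2 → ℝ} (hf : f ∈ cosSpan) (hg : g ∈ cosSpan) : f * g ∈ cosSpan := by
  unfold cosSpan at *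
  induction hf, hg using Submodule.span_induction₂ with
  | mem_mem x y hx hy =>
    obtain ⟨k, rfl⟩ := hx
    obtain ⟨l, rfl⟩ := hy
    have : mc k * mc l = (1 / 2 : ℝ) • mc (k + l) + (1 / 2 : ℝ) • mc (k - l) := by
      ext x; simpa using mc_mul_mc k l x
    rw [this]
    exact add_mem (Submodule.smul_mem _ _ (Submodule.subset_span ⟨_, rfl⟩))
      (Submodule.smul_mem _ _ (Submodule.subset_span ⟨_, rfl⟩))
  | zero_left y hy => rw [zero_mul]; exact zero_mem _
  | zero_right x hx => rw [mul_zero]; exact zero_mem _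
  | add_left x y z _ _ _ h1 h2 => rw [add_mul]; exact add_mem h1 h2
  | add_right x y z _ _ _ h1 h2 => rw [mul_add]; exact add_mem h1 h2
  | smul_left r x y _ _ h => rw [smul_mul_assoc]; exact Submodule.smul_mem _ _ h
  | smul_right r x y _ _ h => rw [mul_smul_comm]; exact Submodule.smul_mem _ _ h

lemma one_mem_cosSpan : (1 : T2 → ℝ) ∈ cosSpan :=
  Submodule.subset_span ⟨0, by ext x; simp [mc_zero]⟩

lemma cosSpan_pow {f : T2 → ℝ} (hf : f ∈ cosSpan) (n : ℕ) : f ^ n ∈ cosSpan := by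
  induction n with
  | zero => simpa using one_mem_cosSpan
  | succ n ih => rw [pow_succ]; exact cosSpan_mul ih hf

lemma cosSpan_finite_rank {κ : T2 → ℝ} (hκ : κ ∈ cosSpan) :
    ∃ (S : Finset ((Fin 2 → ℤ) × Bool)) (c : (Fin 2 → ℤ) × Bool → ℝ),
      ∀ x y, κ (x - y) = ∑ a ∈ S, c a * md a x * md a y := by
  obtain ⟨c, rfl⟩ := Finsupp.mem_span_range_iff_exists_finsupp.1 hκ
  refine ⟨c.support ×ˢ Finset.univ, fun a => c a.1, fun x y => ?_⟩
  rw [Finset.sum_product, Finsupp.sum, Finset.sum_apply]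
  refine Finset.sum_congr rfl fun k _ => ?_
  simp only [Pi.smul_apply, smul_eq_mul, mc_sub_apply, md, Fintype.sum_bool]
  simp only [if_true, Bool.false_eq_true, if_false]
  ring

/-! ### The smoothing kernel -/

/-- `cos² (π x_j)`. -/
noncomputable def av (j : Fin 2) (x : T2) : ℝ := (1 + mc (Pi.single j 1) x) / 2

/-- `sin² (π x_j)`. -/
noncomputable def bv (j : Fin 2) (x : T2) : ℝ := 1 - av j x

lemma smooth_av (j : Fin 2) : SmoothScalar (av j) :=
  ((SmoothScalar.const 1).add (smooth_mc _)).comp (β := fun s => s / 2) (by fun_prop)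

lemma smooth_bv (j : Fin 2) : SmoothScalar (bv j) := (SmoothScalar.const 1).sub (smooth_av j)

lemma av_mem (j : Fin 2) : av j ∈ cosSpan := by
  have : av j = (1 / 2 : ℝ) • 1 + (1 / 2 : ℝ) • mc (Pi.single j 1) := by
    ext x; simp only [av, Pi.add_apply, Pi.smul_apply, Pi.one_apply, smul_eq_mul]; ring
  rw [this]
  exact add_mem (Submodule.smul_mem _ _ one_mem_cosSpan)
    (Submodule.smul_mem _ _ (Submodule.subset_span ⟨_, rfl⟩))

lemma av_nonneg (j : Fin 2) (x : T2) : 0 ≤ av j x := by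
  have := mc_sq_add_ms_sq (Pi.single j 1) x
  unfold av
  nlinarith [sq_nonneg (ms (Pi.single j 1) x), sq_nonneg (mc (Pi.single j 1) x + 1)]

lemma av_le_one (j : Fin 2) (x : T2) : av j x ≤ 1 := by
  have := mc_sq_add_ms_sq (Pi.single j 1) x
  unfold av
  nlinarith [sq_nonneg (ms (Pi.single j 1) x), sq_nonneg (mc (Pi.single j 1) x - 1)]

lemma bv_nonneg (j : Fin 2) (x : T2) : 0 ≤ bv j x := by
  unfold bv; linarith [av_le_one j x]

lemma bv_le_one (j : Fin 2) (x : T2) : bv j x ≤ 1 := by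
  unfold bv; linarith [av_nonneg j x]

lemma ms_sq (j : Fin 2) (x : T2) : ms (Pi.single j 1) x ^ 2 = 4 * (av j x * bv j x) := by
  have := mc_sq_add_ms_sq (Pi.single j 1) x
  unfold bv av
  linarith

lemma pd_av_self (j : Fin 2) (x : T2) : pd j (av j) x = -Real.pi * ms (Pi.single j 1) x := by
  have h := pd_const_mul ((SmoothScalar.const 1).add (smooth_mc (Pi.single j 1))) (1 / 2) j x
  rw [pd_add (SmoothScalar.const 1) (smooth_mc _), pd_const, pd_mc] at h
  have e : av j = fun x => 1 / 2 * (1 + mc (Pi.single j 1) x) := by ext x; simp only [av]; ring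
  rw [e, h]
  simp
  ring

lemma pd_av_of_ne {i j : Fin 2} (hij : i ≠ j) (x : T2) : pd i (av j) x = 0 := by
  have h := pd_const_mul ((SmoothScalar.const 1).add (smooth_mc (Pi.single j 1))) (1 / 2) i x
  rw [pd_add (SmoothScalar.const 1) (smooth_mc _), pd_const, pd_mc] at h
  have e : av j = fun x => 1 / 2 * (1 + mc (Pi.single j 1) x) := by ext x; simp only [av]; ring
  rw [e, h]
  simp [hij]

lemma pd_pow {ψ : T2 → ℝ} (hψ : SmoothScalar ψ) (n : ℕ) (j : Fin 2) (x : T2) :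
    pd j (fun x => ψ x ^ n) x = n * ψ x ^ (n - 1) * pd j ψ x := by
  have := pd_comp hψ (β := fun s => s ^ n) (by fun_prop) j x
  simpa using this

/-- Integration by parts gives the recursion `(2m+2) ∫ cos^{2m+2} = (2m+1) ∫ cos^{2m}`. -/
lemma integral_av_pow_succ {w : T2 → ℝ} (hw : SmoothScalar w) {j : Fin 2}
    (hwj : ∀ x, pd j w x = 0) (m : ℕ) :
    (2 * m + 2) * ∫ x, av j x ^ (m + 1) * w x = (2 * m + 1) * ∫ x, av j x ^ m * w x := by
  have hs := ((smooth_ms (Pi.single j 1)).mul ((smooth_av j).pow m)).mul hw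
  have h := integral_pd hs j
  have e : ∀ x, pd j (fun x => ms (Pi.single j 1) x * av j x ^ m * w x) x =
      2 * Real.pi * ((2 * m + 2) * (av j x ^ (m + 1) * w x) -
        (2 * m + 1) * (av j x ^ m * w x)) := by
    intro x
    rw [pd_mul ((smooth_ms (Pi.single j 1)).mul ((smooth_av j).pow m)) hw,
      pd_mul (smooth_ms _) ((smooth_av j).pow m), pd_pow (smooth_av j), pd_ms, pd_av_self, hwj]
    have hc : mc (Pi.single j 1) x = 2 * av j x - 1 := by unfold av; ring
    have hm := ms_sq j x
    rw [hc]
    rcases m with _ | m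
    · simp; ring
    · simp only [Nat.add_sub_cancel, Pi.single_eq_same]
      push_cast
      have hb : bv j x = 1 - av j x := rfl
      rw [hb] at hm
      linear_combination (-(m + 1) * Real.pi * av j x ^ m * w x) * hm
  simp_rw [e] at h
  have i1 := (((smooth_av j).pow (m + 1)).mul hw).integrable
  have i2 := (((smooth_av j).pow m).mul hw).integrable
  rw [integral_const_mul, integral_sub (i1.const_mul _) (i2.const_mul _),
    integral_const_mul, integral_const_mul] at h
  have := Real.pi_pos
  have h' := (mul_eq_zero.1 h).resolve_left (by positivity)
  linarith

lemma pd_av_pow_of_ne {i j : Fin 2} (hij : i ≠ j) (n : ℕ) (x : T2) :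
    pd i (fun x => av j x ^ n) x = 0 := by
  rw [pd_pow (smooth_av j), pd_av_of_ne hij, mul_zero]

/-- The normalizing constant of the kernel of exponent `n`. -/
noncomputable def kz (n : ℕ) : ℝ := ∫ x, av 0 x ^ n * av 1 x ^ n

lemma other_ne (j : Fin 2) : j ≠ 1 - j := by fin_cases j <;> decide

lemma kz_eq (n : ℕ) (j : Fin 2) : kz n = ∫ x, av j x ^ n * av (1 - j) x ^ n := by
  fin_cases j
  · rfl
  · simp only [kz]
    congr 1; ext x; rw [mul_comm]; rfl

lemma smooth_av_pow_mul (j : Fin 2) (m n : ℕ) :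
    SmoothScalar fun x => av j x ^ m * av (1 - j) x ^ n :=
  ((smooth_av j).pow m).mul ((smooth_av (1 - j)).pow n)

lemma moment_succ (j : Fin 2) (m n : ℕ) :
    (2 * m + 2) * ∫ x, av j x ^ (m + 1) * av (1 - j) x ^ n =
      (2 * m + 1) * ∫ x, av j x ^ m * av (1 - j) x ^ n :=
  integral_av_pow_succ ((smooth_av (1 - j)).pow n) (pd_av_pow_of_ne (other_ne j) n) m

lemma kz_succ (n : ℕ) : (2 * n + 2) ^ 2 * kz (n + 1) = (2 * n + 1) ^ 2 * kz n := by
  have h1 := moment_succ 0 n (n + 1)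
  have h2 := moment_succ 1 n n
  simp only [show (1 : Fin 2) - 0 = 1 from rfl, show (1 : Fin 2) - 1 = 0 from rfl] at h1 h2
  have e1 : ∫ x, av 1 x ^ (n + 1) * av 0 x ^ n = ∫ x, av 0 x ^ n * av 1 x ^ (n + 1) := by
    congr 1; ext x; ring
  have e2 : ∫ x, av 1 x ^ n * av 0 x ^ n = kz n := by
    unfold kz; congr 1; ext x; ring
  rw [e1, e2] at h2
  rw [show kz (n + 1) = ∫ x, av 0 x ^ (n + 1) * av 1 x ^ (n + 1) from rfl]
  linear_combination (2 * (n : ℝ) + 2) * h1 + (2 * (n : ℝ) + 1) * h2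

lemma kz_lower (n : ℕ) : 1 ≤ 4 * (n + 1) * kz (n + 1) := by
  have h0 : kz 0 = 1 := by simp [kz]
  induction n with
  | zero =>
    have := kz_succ 0
    rw [h0] at this
    norm_num at this ⊢
    linarith
  | succ n ih =>
    have h := kz_succ (n + 1)
    push_cast at h ⊢
    have hz : 0 ≤ kz (n + 1) := by
      have : (0 : ℝ) < 4 * (n + 1) := by positivity
      by_contra hneg
      push Not at hneg
      nlinarith
    have hn : (0 : ℝ) ≤ n := by positivity
    have h2 : 4 * ((n : ℝ) + 1 + 1) * (4 * (n + 1 + 1) * kz (n + 1 + 1)) =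
        4 * ((2 * (n + 1) + 1) ^ 2 * kz (n + 1)) := by linear_combination 4 * h
    nlinarith

lemma kz_pos (n : ℕ) : 0 < kz n := by
  rcases n with _ | n
  · simp [kz]
  · have := kz_lower n
    by_contra hneg
    push Not at hneg
    have : (0 : ℝ) < 4 * (n + 1) := by positivity
    nlinarith

/-- The smoothing kernel `c (cos² πx₀ cos² πx₁)^{2(m+1)}`, an approximate identity as `m → ∞`. The
exponent is even so that the square root of the kernel is again a trigonometric polynomial. -/
noncomputable def ker (m : ℕ) (x : T2) : ℝ :=
  (av 0 x ^ (2 * (m + 1)) * av 1 x ^ (2 * (m + 1))) / kz (2 * (m + 1))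

/-- A substitute for the distance to `0` on the torus. -/
noncomputable def sz (x : T2) : ℝ := √(bv 0 x + bv 1 x)

lemma ker_eq (m : ℕ) (j : Fin 2) (x : T2) :
    ker m x = (kz (2 * (m + 1)))⁻¹ * (av j x ^ (2 * (m + 1)) * av (1 - j) x ^ (2 * (m + 1))) := by
  unfold ker
  rw [div_eq_inv_mul]
  fin_cases j
  · rfl
  · rw [mul_comm (av 0 x ^ _)]; rfl

lemma smooth_ker (m : ℕ) : SmoothScalar (ker m) := by
  have := (SmoothScalar.const (kz (2 * (m + 1)))⁻¹).mul
    (smooth_av_pow_mul 0 (2 * (m + 1)) (2 * (m + 1)))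
  simp_rw [← ker_eq] at this
  exact this

lemma ker_nonneg (m : ℕ) (x : T2) : 0 ≤ ker m x :=
  div_nonneg (mul_nonneg (pow_nonneg (av_nonneg _ _) _) (pow_nonneg (av_nonneg _ _) _)) (kz_pos _).le

lemma integral_ker (m : ℕ) : ∫ x, ker m x = 1 := by
  unfold ker
  rw [integral_div]
  exact div_self (kz_pos _).ne'

lemma ker_neg (m : ℕ) (x : T2) : ker m (-x) = ker m x := by
  simp only [ker, av, mc_neg_apply]

lemma ker_le (m : ℕ) (x : T2) : ker m x ≤ 8 * (m + 1) := by
  unfold ker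
  rw [div_le_iff₀ (kz_pos _)]
  have h := kz_lower (2 * m + 1)
  rw [show 2 * m + 1 + 1 = 2 * (m + 1) by ring] at h
  push_cast at h
  have h1 := pow_le_one₀ (n := 2 * (m + 1)) (av_nonneg 0 x) (av_le_one 0 x)
  have h2 := pow_le_one₀ (n := 2 * (m + 1)) (av_nonneg 1 x) (av_le_one 1 x)
  have h3 := mul_le_one₀ h1 (pow_nonneg (av_nonneg 1 x) _) h2
  nlinarith

lemma ker_mem (m : ℕ) : ker m ∈ cosSpan := by
  have : ker m = (kz (2 * (m + 1)))⁻¹ • (av 0 ^ (2 * (m + 1)) * av 1 ^ (2 * (m + 1))) := by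
    ext x; simp [ker, div_eq_inv_mul]
  rw [this]
  exact Submodule.smul_mem _ _ (cosSpan_mul (cosSpan_pow (av_mem 0) _) (cosSpan_pow (av_mem 1) _))

lemma sz_nonneg (x : T2) : 0 ≤ sz x := Real.sqrt_nonneg _

lemma sq_sz (x : T2) : sz x ^ 2 = bv 0 x + bv 1 x :=
  Real.sq_sqrt (add_nonneg (bv_nonneg _ _) (bv_nonneg _ _))

lemma continuous_sz : Continuous sz :=
  ((smooth_bv 0).continuous.add (smooth_bv 1).continuous).sqrt

lemma sqrt_bv_le_sz (j : Fin 2) (x : T2) : √(bv j x) ≤ sz x := by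
  refine Real.sqrt_le_sqrt ?_
  fin_cases j
  · simpa using bv_nonneg 1 x
  · simpa using bv_nonneg 0 x

lemma integral_ker_mul_bv (m : ℕ) (j : Fin 2) : ∫ x, ker m x * bv j x = 1 / (4 * (m + 1) + 2) := by
  have h := moment_succ j (2 * (m + 1)) (2 * (m + 1))
  have hz := kz_pos (2 * (m + 1))
  rw [← kz_eq] at h
  have e : ∀ x, ker m x * bv j x = (kz (2 * (m + 1)))⁻¹ *
      (av j x ^ (2 * (m + 1)) * av (1 - j) x ^ (2 * (m + 1)) -
        av j x ^ (2 * (m + 1) + 1) * av (1 - j) x ^ (2 * (m + 1))) := by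
    intro x; rw [ker_eq m j, bv]; ring
  simp_rw [e]
  rw [integral_const_mul, integral_sub (smooth_av_pow_mul _ _ _).integrable
    (smooth_av_pow_mul _ _ _).integrable, ← kz_eq]
  push_cast at h
  field_simp
  linear_combination -h

lemma integral_ker_mul_bv_sq (m : ℕ) (j : Fin 2) :
    ∫ x, ker m x * bv j x ^ 2 ≤ 1 / (m + 1) ^ 2 := by
  have h := moment_succ j (2 * (m + 1)) (2 * (m + 1))
  have h' := moment_succ j (2 * (m + 1) + 1) (2 * (m + 1))
  have hz := kz_pos (2 * (m + 1))
  rw [← kz_eq] at h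
  have e : ∀ x, ker m x * bv j x ^ 2 = (kz (2 * (m + 1)))⁻¹ *
      (av j x ^ (2 * (m + 1)) * av (1 - j) x ^ (2 * (m + 1)) -
        2 * (av j x ^ (2 * (m + 1) + 1) * av (1 - j) x ^ (2 * (m + 1))) +
        av j x ^ (2 * (m + 1) + 1 + 1) * av (1 - j) x ^ (2 * (m + 1))) := by
    intro x; rw [ker_eq m j, bv]; ring
  simp_rw [e]
  have i := fun a => (smooth_av_pow_mul j a (2 * (m + 1))).integrable
  rw [integral_const_mul, integral_add (f := fun x => av j x ^ (2 * (m + 1)) *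
      av (1 - j) x ^ (2 * (m + 1)) - 2 * (av j x ^ (2 * (m + 1) + 1) *
      av (1 - j) x ^ (2 * (m + 1)))) (((i _).sub ((i _).const_mul 2))) (i _),
    integral_sub (i _) ((i _).const_mul 2), integral_const_mul, ← kz_eq]
  set I1 := ∫ x, av j x ^ (2 * (m + 1) + 1) * av (1 - j) x ^ (2 * (m + 1))
  set I2 := ∫ x, av j x ^ (2 * (m + 1) + 1 + 1) * av (1 - j) x ^ (2 * (m + 1))
  set Z := kz (2 * (m + 1))
  push_cast at h h'
  have q : (0 : ℝ) ≤ m := by positivity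
  have e1 : I1 = (4 * (m + 1) + 1) / (4 * (m + 1) + 2) * Z := by
    field_simp; linear_combination h
  have e2 : I2 = (4 * (m + 1) + 3) / (4 * (m + 1) + 4) * I1 := by
    field_simp; linear_combination h'
  rw [e2, e1]
  have : Z⁻¹ * (Z - 2 * ((4 * ((m : ℝ) + 1) + 1) / (4 * (m + 1) + 2) * Z) +
      (4 * (m + 1) + 3) / (4 * (m + 1) + 4) * ((4 * (m + 1) + 1) / (4 * (m + 1) + 2) * Z)) =
      3 / ((4 * (m + 1) + 2) * (4 * (m + 1) + 4)) := by
    field_simp; ring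
  rw [this, div_le_div_iff₀ (by positivity) (by positivity)]
  nlinarith

lemma integral_ker_mul_sz_sq (m : ℕ) : ∫ x, ker m x * sz x ^ 2 ≤ 1 / (m + 1) := by
  simp_rw [sq_sz, mul_add]
  rw [integral_add ((smooth_ker m).mul (smooth_bv 0)).integrable
    ((smooth_ker m).mul (smooth_bv 1)).integrable, integral_ker_mul_bv, integral_ker_mul_bv,
    ← add_div, div_le_div_iff₀ (by positivity) (by positivity)]
  have q : (0 : ℝ) ≤ m := by positivity
  nlinarith

lemma integral_ker_mul_sz_four (m : ℕ) : ∫ x, ker m x * (sz x ^ 2) ^ 2 ≤ 4 / (m + 1) ^ 2 := by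
  have h0 := integral_ker_mul_bv_sq m 0
  have h1 := integral_ker_mul_bv_sq m 1
  have i := fun j => ((smooth_ker m).mul ((smooth_bv j).pow 2)).integrable
  have : ∫ x, ker m x * (sz x ^ 2) ^ 2 ≤
      ∫ x, (2 * (ker m x * bv 0 x ^ 2) + 2 * (ker m x * bv 1 x ^ 2)) := by
    refine integral_mono_of_nonneg (.of_forall fun x => mul_nonneg (ker_nonneg m x) (sq_nonneg _))
      (((i 0).const_mul 2).add ((i 1).const_mul 2)) (.of_forall fun x => ?_)
    simp only [sq_sz]
    nlinarith [ker_nonneg m x, mul_nonneg (ker_nonneg m x) (sq_nonneg (bv 0 x - bv 1 x))]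
  rw [integral_add ((i 0).const_mul 2) ((i 1).const_mul 2), integral_const_mul,
    integral_const_mul] at this
  have e : (4 : ℝ) / (m + 1) ^ 2 = 2 * (1 / (m + 1) ^ 2) + 2 * (1 / (m + 1) ^ 2) := by ring
  rw [e]
  linarith

/-- The two moment bounds for the gradient of the kernel come from one application of the
Cauchy-Schwarz inequality, with a continuous weight `w`. -/
lemma integral_abs_pd_ker_mul_le (m : ℕ) (j : Fin 2) {w : T2 → ℝ} (hw : Continuous w)
    (hw0 : ∀ x, 0 ≤ w x) :
    ∫ x, |pd j (ker m) x| * w x ≤ 4 * Real.pi * √(m + 1) * √(∫ x, ker m x * w x ^ 2) := by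
  set Z := kz (2 * (m + 1)) with hZ
  have hz : 0 < Z := kz_pos _
  have hpi := Real.pi_pos
  let F : T2 → ℝ := fun x => ms (Pi.single j 1) x * (av j x ^ m * av (1 - j) x ^ (m + 1))
  let G : T2 → ℝ := fun x => av j x ^ (m + 1) * av (1 - j) x ^ (m + 1) * w x
  have sF : SmoothScalar F := (smooth_ms _).mul (smooth_av_pow_mul _ _ _)
  have hG : MemLp G 2 volume := by
    have hc : Continuous G := (smooth_av_pow_mul j (m + 1) (m + 1)).continuous.mul hw
    exact hc.memLp_of_hasCompactSupport (HasCompactSupport.of_compactSpace _)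
  have hpd : ∀ x, |pd j (ker m) x| * w x = (2 * (m + 1) * Real.pi * Z⁻¹) * |F x * G x| := by
    intro x
    have e : ker m = fun x => Z⁻¹ * (av j x ^ (2 * (m + 1)) * av (1 - j) x ^ (2 * (m + 1))) := by
      ext x; exact ker_eq m j x
    rw [e, pd_const_mul (smooth_av_pow_mul _ _ _), pd_mul ((smooth_av j).pow _)
      ((smooth_av (1 - j)).pow _), pd_av_pow_of_ne (other_ne j), pd_pow (smooth_av j), pd_av_self,
      mul_zero, add_zero]
    rw [← abs_of_nonneg (show 0 ≤ 2 * (m + 1) * Real.pi * Z⁻¹ by positivity), ← abs_mul, ← abs_neg]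
    rw [← abs_of_nonneg (hw0 x), ← abs_mul]
    congr 1
    simp only [F, G]
    rw [show 2 * (m + 1) - 1 = m + (m + 1) by omega]
    push_cast
    ring
  have hF2 : ∫ x, F x ^ 2 = 4 * Z / (4 * (m + 1) - 1) := by
    have h := moment_succ j (2 * m + 1) (2 * (m + 1))
    have e : ∀ x, F x ^ 2 = 4 * (av j x ^ (2 * m + 1) * av (1 - j) x ^ (2 * (m + 1)) -
        av j x ^ (2 * (m + 1)) * av (1 - j) x ^ (2 * (m + 1))) := by
      intro x; simp only [F, mul_pow, ms_sq, bv]; ring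
    simp_rw [e]
    have i := fun a => (smooth_av_pow_mul j a (2 * (m + 1))).integrable
    rw [integral_const_mul, integral_sub (i _) (i _), ← kz_eq, ← hZ]
    rw [show 2 * m + 1 + 1 = 2 * (m + 1) by ring, ← kz_eq, ← hZ] at h
    push_cast at h
    have q : (0 : ℝ) ≤ m := by positivity
    have q' : (4 * ((m : ℝ) + 1) - 1) ≠ 0 := by linarith
    field_simp
    linear_combination -h
  have hG2 : ∫ x, G x ^ 2 = Z * ∫ x, ker m x * w x ^ 2 := by
    rw [← integral_const_mul]
    congr 1; ext x
    rw [ker_eq m j, ← hZ]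
    simp only [G]
    field_simp
    ring
  have hCS := integral_abs_mul_le_sqrt (sF.memLp 2) hG
  rw [hF2, hG2, Real.sqrt_mul hz.le] at hCS
  simp_rw [hpd]
  rw [integral_const_mul]
  have hm : (0 : ℝ) ≤ m := by positivity
  have hle : √(4 * Z / (4 * (m + 1) - 1)) ≤ 2 * √Z / √(m + 1) := by
    have e2 : 2 * √Z / √((m : ℝ) + 1) = √(4 * Z / (m + 1)) := by
      rw [Real.sqrt_div (by positivity), Real.sqrt_mul (by norm_num),
        show (4 : ℝ) = 2 ^ 2 by norm_num, Real.sqrt_sq (by norm_num)]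
    rw [e2]
    refine Real.sqrt_le_sqrt (div_le_div_of_nonneg_left (by positivity) (by positivity) ?_)
    linarith
  have hs : √((m : ℝ) + 1) * √((m : ℝ) + 1) = m + 1 := Real.mul_self_sqrt (by positivity)
  have hsz : √Z * √Z = Z := Real.mul_self_sqrt hz.le
  have hs0 : 0 < √((m : ℝ) + 1) := Real.sqrt_pos.2 (by positivity)
  calc 2 * (m + 1) * Real.pi * Z⁻¹ * ∫ x, |F x * G x|
      ≤ 2 * (m + 1) * Real.pi * Z⁻¹ * (2 * √Z / √(m + 1) * (√Z * √(∫ x, ker m x * w x ^ 2))) := by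
        refine mul_le_mul_of_nonneg_left (hCS.trans ?_) (by positivity)
        exact mul_le_mul_of_nonneg_right hle (by positivity)
    _ = 4 * Real.pi * ((m + 1) / √(m + 1)) * (Z⁻¹ * (√Z * √Z)) * √(∫ x, ker m x * w x ^ 2) := by
        ring
    _ = _ := by
        rw [hsz, inv_mul_cancel₀ hz.ne', mul_one, Real.div_sqrt]

lemma integral_abs_pd_ker_mul_sz (m : ℕ) (j : Fin 2) :
    ∫ x, |pd j (ker m) x| * sz x ≤ 4 * Real.pi := by
  refine (integral_abs_pd_ker_mul_le m j continuous_sz sz_nonneg).trans ?_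
  have h := Real.sqrt_le_sqrt (integral_ker_mul_sz_sq m)
  have hs0 : 0 < √((m : ℝ) + 1) := Real.sqrt_pos.2 (by positivity)
  rw [Real.sqrt_div zero_le_one, Real.sqrt_one] at h
  calc _ ≤ 4 * Real.pi * √(m + 1) * (1 / √(m + 1)) :=
        mul_le_mul_of_nonneg_left h (by have := Real.pi_pos; positivity)
    _ = _ := by field_simp

lemma integral_abs_pd_ker_mul_sz_sq (m : ℕ) (j : Fin 2) :
    ∫ x, |pd j (ker m) x| * sz x ^ 2 ≤ 8 * Real.pi / √(m + 1) := by
  refine (integral_abs_pd_ker_mul_le m j (continuous_sz.pow 2) (fun x => sq_nonneg _)).trans ?_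
  have h := Real.sqrt_le_sqrt (integral_ker_mul_sz_four m)
  have hs0 : 0 < √((m : ℝ) + 1) := Real.sqrt_pos.2 (by positivity)
  have hs : √((m : ℝ) + 1) * √((m : ℝ) + 1) = m + 1 := Real.mul_self_sqrt (by positivity)
  have e : √((4 : ℝ) / (m + 1) ^ 2) = 2 / (m + 1) := by
    rw [show (4 : ℝ) / (m + 1) ^ 2 = (2 / (m + 1)) ^ 2 by rw [div_pow]; norm_num, Real.sqrt_sq (by positivity)]
  rw [e] at h
  calc _ ≤ 4 * Real.pi * √(m + 1) * (2 / (m + 1)) :=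
        mul_le_mul_of_nonneg_left h (by have := Real.pi_pos; positivity)
    _ = 8 * Real.pi * √(m + 1) / (√(m + 1) * √(m + 1)) := by rw [hs]; ring
    _ = _ := by field_simp

/-! ### Mollification -/

/-- Convolution with the kernel `ker m`. -/
noncomputable def mol (m : ℕ) (g : T2 → ℝ) (x : T2) : ℝ := ∫ y, ker m (x - y) * g y

lemma mol_eq (m : ℕ) (g : T2 → ℝ) (x : T2) : mol m g x = ∫ z, ker m z * g (x + z) := by
  have h1 := integral_sub_left_eq_self (fun y => ker m y * g (x - y)) (volume : Measure T2) x
  have h2 := integral_neg_eq_self (fun z => ker m z * g (x + z)) (volume : Measure T2)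
  simp only [sub_sub_cancel] at h1
  rw [mol, h1, ← h2]
  simp only [ker_neg, ← sub_eq_add_neg]

lemma smooth_ker_sub (m : ℕ) (x : T2) : SmoothScalar fun y => ker m (x - y) := by
  have := ((smooth_ker m).translate x).reflect
  simpa [neg_add_eq_sub] using this

lemma pd_ker_sub (m : ℕ) (j : Fin 2) (x y : T2) :
    pd j (fun y => ker m (x - y)) y = -pd j (ker m) (x - y) := by
  have := pd_reflect ((smooth_ker m).translate x) j y
  rw [pd_translate] at this
  simpa [neg_add_eq_sub] using this

lemma pd_ker_neg (m : ℕ) (j : Fin 2) (x : T2) : pd j (ker m) (-x) = -pd j (ker m) x := by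
  have := pd_reflect (smooth_ker m) j x
  simp only [ker_neg] at this
  rw [show (fun x => ker m x) = ker m from rfl] at this
  linarith

lemma integrable_smooth_mul {ψ g : T2 → ℝ} (hψ : SmoothScalar ψ) (hg : Integrable g volume) :
    Integrable (fun x => ψ x * g x) volume := by
  obtain ⟨K, -, hK⟩ := hψ.bounded
  exact hg.bdd_mul hψ.continuous.aestronglyMeasurable (.of_forall hK)

lemma integrable_mul_smooth {ψ g : T2 → ℝ} (hψ : SmoothScalar ψ) (hg : Integrable g volume) :
    Integrable (fun x => g x * ψ x) volume := by
  simpa only [mul_comm] using integrable_smooth_mul hψ hg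

/-- The frequencies of the kernel `ker m`. -/
noncomputable def freq (m : ℕ) : Finset ((Fin 2 → ℤ) × Bool) :=
  (cosSpan_finite_rank (ker_mem m)).choose

/-- The Fourier coefficients of the kernel `ker m`. -/
noncomputable def fcoef (m : ℕ) : (Fin 2 → ℤ) × Bool → ℝ :=
  (cosSpan_finite_rank (ker_mem m)).choose_spec.choose

lemma ker_sub_eq (m : ℕ) (x y : T2) :
    ker m (x - y) = ∑ a ∈ freq m, fcoef m a * md a x * md a y :=
  (cosSpan_finite_rank (ker_mem m)).choose_spec.choose_spec x y

lemma mol_eq_sum (m : ℕ) {g : T2 → ℝ} (hg : Integrable g volume) (x : T2) :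
    mol m g x = ∑ a ∈ freq m, fcoef m a * (∫ y, md a y * g y) * md a x := by
  unfold mol
  simp_rw [ker_sub_eq, Finset.sum_mul]
  rw [integral_finsetSum _ fun a _ => by
    simp only [mul_assoc]
    exact ((integrable_smooth_mul (smooth_md a) hg).const_mul _).const_mul _]
  refine Finset.sum_congr rfl fun a _ => ?_
  simp_rw [mul_assoc]
  rw [integral_const_mul, integral_const_mul]
  ring

lemma smooth_mol (m : ℕ) {g : T2 → ℝ} (hg : Integrable g volume) : SmoothScalar (mol m g) := by
  rw [show mol m g = _ from funext (mol_eq_sum m hg)]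
  exact SmoothScalar.sum fun a _ => (SmoothScalar.const _).mul (smooth_md a)

lemma pd_ker_sub_eq (m : ℕ) (j : Fin 2) (x y : T2) :
    pd j (ker m) (x - y) = ∑ a ∈ freq m, fcoef m a * pd j (md a) x * md a y := by
  have h1 : pd j (fun x => ker m (x - y)) x = pd j (ker m) (x - y) := by
    simpa [sub_eq_add_neg] using pd_translate (ker m) (-y) j x
  rw [← h1]
  simp_rw [ker_sub_eq]
  rw [pd_sum fun a _ => ((SmoothScalar.const _).mul (smooth_md a)).mul (SmoothScalar.const _)]
  refine Finset.sum_congr rfl fun a _ => ?_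
  rw [pd_mul ((SmoothScalar.const _).mul (smooth_md a)) (SmoothScalar.const _), pd_const,
    pd_const_mul (smooth_md a)]
  ring

lemma pd_mol_eq_integral (m : ℕ) {g : T2 → ℝ} (hg : Integrable g volume) (j : Fin 2) (x : T2) :
    pd j (mol m g) x = ∫ y, pd j (ker m) (x - y) * g y := by
  rw [show mol m g = _ from funext (mol_eq_sum m hg)]
  rw [pd_sum fun a _ => (SmoothScalar.const _).mul (smooth_md a)]
  simp_rw [pd_const_mul (smooth_md _), pd_ker_sub_eq, Finset.sum_mul]
  rw [integral_finsetSum _ fun a _ => by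
    simp only [mul_assoc]
    exact ((integrable_smooth_mul (smooth_md a) hg).const_mul _).const_mul _]
  refine Finset.sum_congr rfl fun a _ => ?_
  simp_rw [mul_assoc]
  rw [integral_const_mul, integral_const_mul]
  ring

/-- Mollification commutes with weak derivatives. -/
lemma pd_mol_of_weak (m : ℕ) {j : Fin 2} {g h : T2 → ℝ} (hg : Integrable g volume)
    (hgh : IsWeakPartial j g h) (x : T2) : pd j (mol m g) x = mol m h x := by
  rw [pd_mol_eq_integral m hg]
  have := hgh _ (smooth_ker_sub m x)
  simp_rw [pd_ker_sub, mul_neg] at this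
  rw [integral_neg, neg_inj] at this
  simp_rw [mol, mul_comm _ (g _), mul_comm _ (h _)]
  exact this

lemma isWeakPartial_of_smooth {ψ : T2 → ℝ} (hψ : SmoothScalar ψ) (j : Fin 2) :
    IsWeakPartial j ψ (pd j ψ) := fun φ hφ => by
  have := integral_pd_mul hψ hφ j
  linarith

lemma pd_mol (m : ℕ) {ψ : T2 → ℝ} (hψ : SmoothScalar ψ) (j : Fin 2) :
    pd j (mol m ψ) = mol m (pd j ψ) :=
  funext (pd_mol_of_weak m hψ.integrable (isWeakPartial_of_smooth hψ j))

lemma lap_mol (m : ℕ) {ψ : T2 → ℝ} (hψ : SmoothScalar ψ) (x : T2) :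
    lap (mol m ψ) x = mol m (lap ψ) x := by
  unfold lap
  simp_rw [pd_mol m hψ, pd_mol m (hψ.pd _)]
  unfold mol
  rw [← integral_finsetSum _ fun j _ =>
    ((smooth_ker_sub m x).mul ((hψ.pd j).pd j)).integrable]
  simp_rw [Finset.mul_sum]

lemma integral_mol_mul (m : ℕ) {f g : T2 → ℝ} (hf : Integrable f volume)
    (hg : Integrable g volume) : ∫ x, mol m f x * g x = ∫ x, f x * mol m g x := by
  simp_rw [mol_eq_sum m hf, mol_eq_sum m hg, Finset.sum_mul, Finset.mul_sum]
  rw [integral_finsetSum _ fun a _ => by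
      simp only [mul_assoc]
      exact ((integrable_smooth_mul (smooth_md a) hg).const_mul _).const_mul _,
    integral_finsetSum _ fun a _ => by
      have := (integrable_smooth_mul (smooth_md a) hf).const_mul
        (fcoef m a * ∫ y, md a y * g y)
      refine this.congr (.of_forall fun x => ?_)
      simp only; ring]
  refine Finset.sum_congr rfl fun a _ => ?_
  have e1 : ∀ x, fcoef m a * (∫ y, md a y * f y) * md a x * g x =
    (fcoef m a * (∫ y, md a y * f y)) * (md a x * g x) := fun x => by ring
  have e2 : ∀ x, f x * (fcoef m a * (∫ y, md a y * g y) * md a x) =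
    (fcoef m a * (∫ y, md a y * g y)) * (md a x * f x) := fun x => by ring
  simp_rw [e1, e2]
  rw [integral_const_mul, integral_const_mul]
  ring

lemma _root_.MeasureTheory.MemLp.integrable_two {g : T2 → ℝ} (hg : MemLp g 2 volume) :
    Integrable g volume := hg.integrable (by norm_num)

lemma nrm_ker_sub_le (m : ℕ) (x : T2) : nrm (fun y => ker m (x - y)) ≤ √(8 * (m + 1)) := by
  refine Real.sqrt_le_sqrt ?_
  have h := integral_sub_left_eq_self (fun y => ker m y ^ 2) (volume : Measure T2) x
  rw [h]
  calc ∫ y, ker m y ^ 2 ≤ ∫ y, 8 * (m + 1) * ker m y := by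
        refine integral_mono ((smooth_ker m).pow 2).integrable
          ((smooth_ker m).integrable.const_mul _) fun y => ?_
        simp only [sq]
        exact mul_le_mul_of_nonneg_right (ker_le m y) (ker_nonneg m y)
    _ = _ := by rw [integral_const_mul, integral_ker, mul_one]

lemma abs_mol_le_nrm (m : ℕ) {g : T2 → ℝ} (hg : MemLp g 2 volume) (x : T2) :
    |mol m g x| ≤ √(8 * (m + 1)) * nrm g :=
  (abs_integral_mul_le ((smooth_ker_sub m x).memLp 2) hg).trans
    (mul_le_mul_of_nonneg_right (nrm_ker_sub_le m x) (nrm_nonneg g))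

lemma abs_mol_le_of_bound (m : ℕ) {g : T2 → ℝ} {K : ℝ}
    (hK : ∀ x, |g x| ≤ K) (x : T2) : |mol m g x| ≤ K := by
  rw [mol_eq]
  calc |∫ z, ker m z * g (x + z)| ≤ ∫ z, |ker m z * g (x + z)| := abs_integral_le_integral_abs
    _ ≤ ∫ z, K * ker m z := by
        refine integral_mono_of_nonneg (.of_forall fun _ => abs_nonneg _)
          ((smooth_ker m).integrable.const_mul K) (.of_forall fun z => ?_)
        simp only [abs_mul, abs_of_nonneg (ker_nonneg m z)]
        rw [mul_comm]
        exact mul_le_mul_of_nonneg_right (hK _) (ker_nonneg m z)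
    _ = K := by rw [integral_const_mul, integral_ker, mul_one]

lemma measurePreserving_shear :
    MeasurePreserving (fun p : T2 × T2 => (p.1, p.1 + p.2))
      ((volume : Measure T2).prod volume) ((volume : Measure T2).prod volume) :=
  measurePreserving_prod_add volume volume

lemma integrable_shear {f g : T2 → ℝ} (hf : Integrable f volume) (hg : Integrable g volume) :
    Integrable (fun p : T2 × T2 => f p.1 * g (p.1 + p.2)) (volume.prod volume) :=
  measurePreserving_shear.integrable_comp_of_integrable (hf.mul_prod hg)

/-- Fubini for kernels depending on the increment. -/
lemma integrable_shear_ker {f g k : T2 → ℝ} (hf : Integrable f volume) (hg : Integrable g volume)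
    (hk : Continuous k) :
    Integrable (fun p : T2 × T2 => k p.2 * (f p.1 * g (p.1 + p.2))) (volume.prod volume) := by
  obtain ⟨K, hK⟩ := isCompact_univ.exists_bound_of_continuousOn hk.continuousOn
  exact (integrable_shear hf hg).bdd_mul (hk.comp continuous_snd).aestronglyMeasurable
    (.of_forall fun p => hK _ (mem_univ _))

lemma integral_mul_mol (m : ℕ) {f g : T2 → ℝ} (hf : Integrable f volume)
    (hg : Integrable g volume) :
    ∫ x, f x * mol m g x = ∫ z, ker m z * ∫ x, f x * g (x + z) := by
  have h := integral_integral_swap (f := fun x z => ker m z * (f x * g (x + z)))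
    (integrable_shear_ker hf hg (smooth_ker m).continuous)
  simp_rw [mol_eq, ← integral_const_mul]
  rw [← h]
  refine integral_congr_ae (.of_forall fun x => integral_congr_ae (.of_forall fun z => ?_))
  simp only; ring

lemma integrable_continuous {k : T2 → ℝ} (hk : Continuous k) : Integrable k volume :=
  hk.integrable_of_hasCompactSupport (HasCompactSupport.of_compactSpace _)

/-- Minkowski's inequality `‖κ * g - g‖ ≤ ∫ κ(z) ‖g(· + z) - g‖ dz`, proved by duality. -/
lemma nrm_mol_sub_le (m : ℕ) {g : T2 → ℝ} (hg : MemLp g 2 volume) :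
    nrm (fun x => mol m g x - g x) ≤ ∫ z, ker m z * nrm (dl z g) := by
  set h : T2 → ℝ := fun x => mol m g x - g x with hh
  have hm : MemLp h 2 volume := ((smooth_mol m hg.integrable_two).memLp 2).sub hg
  have i1 : Integrable (fun x => h x * mol m g x) volume :=
    hm.integrable_mul ((smooth_mol m hg.integrable_two).memLp 2)
  have i2 : Integrable (fun x => h x * g x) volume := hm.integrable_mul hg
  have e : nrm h ^ 2 = ∫ z, ker m z * ∫ x, h x * dl z g x := by
    have e1 : ∀ x, h x ^ 2 = h x * mol m g x - h x * g x := fun x => by simp only [hh]; ring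
    rw [sq_nrm]
    simp_rw [e1]
    rw [integral_sub i1 i2, integral_mul_mol m hm.integrable_two hg.integrable_two]
    have e2 : ∫ x, h x * g x = ∫ z, ker m z * ∫ x, h x * g x := by
      rw [integral_mul_const, integral_ker, one_mul]
    have hc := ((integrable_shear_ker hm.integrable_two hg.integrable_two
      (smooth_ker m).continuous).integral_prod_right)
    simp only [integral_const_mul] at hc
    rw [e2, ← integral_sub hc ((smooth_ker m).integrable.mul_const _)]
    refine integral_congr_ae (.of_forall fun z => ?_)
    have i3 : Integrable (fun x => h x * g (x + z)) volume :=
      hm.integrable_mul (memLp_translate hg z)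
    simp only [dl, mul_sub]
    rw [integral_sub i3 i2]
    ring
  have hcont : Integrable (fun z => ker m z * nrm (dl z g)) volume :=
    integrable_continuous ((smooth_ker m).continuous.mul (continuous_nrm_dl hg))
  have hle : nrm h ^ 2 ≤ nrm h * ∫ z, ker m z * nrm (dl z g) := by
    rw [e, ← integral_const_mul]
    refine integral_mono_ae ?_ (hcont.const_mul _) (.of_forall fun z => ?_)
    · have hc := ((integrable_shear_ker hm.integrable_two hg.integrable_two
        (smooth_ker m).continuous).integral_prod_right)
      simp only [integral_const_mul] at hc
      refine (hc.sub ((smooth_ker m).integrable.mul_const (∫ x, h x * g x))).congr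
        (.of_forall fun z => ?_)
      have i3 : Integrable (fun x => h x * g (x + z)) volume :=
        hm.integrable_mul (memLp_translate hg z)
      simp only [dl, mul_sub, Pi.sub_apply]
      rw [integral_sub i3 i2]
      ring
    · have := (le_abs_self _).trans (abs_integral_mul_le hm (memLp_dl hg z))
      calc _ ≤ ker m z * (nrm h * nrm (dl z g)) :=
            mul_le_mul_of_nonneg_left this (ker_nonneg m z)
        _ = _ := by ring
  rcases (nrm_nonneg h).eq_or_lt with h0 | h0
  · rw [← h0]
    exact integral_nonneg fun z => mul_nonneg (ker_nonneg m z) (nrm_nonneg _)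
  · rw [sq] at hle
    exact le_of_mul_le_mul_left hle h0

lemma nrm_mol_le (m : ℕ) {g : T2 → ℝ} (hg : MemLp g 2 volume) : nrm (mol m g) ≤ nrm g := by
  have hm := (smooth_mol m hg.integrable_two).memLp 2
  have hle : nrm (mol m g) ^ 2 ≤ nrm (mol m g) * nrm g := by
    rw [sq_nrm]
    simp_rw [sq]
    rw [integral_mul_mol m hm.integrable_two hg.integrable_two]
    have hc := ((integrable_shear_ker hm.integrable_two hg.integrable_two
      (smooth_ker m).continuous).integral_prod_right)
    simp only [integral_const_mul] at hc
    calc _ ≤ ∫ z, ker m z * (nrm (mol m g) * nrm g) := by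
          refine integral_mono hc ((smooth_ker m).integrable.mul_const _) fun z => ?_
          refine mul_le_mul_of_nonneg_left ?_ (ker_nonneg m z)
          refine (le_abs_self _).trans ((abs_integral_mul_le hm (memLp_translate hg z)).trans ?_)
          rw [nrm_translate]
      _ = _ := by rw [integral_mul_const, integral_ker, one_mul]
  rcases (nrm_nonneg (mol m g)).eq_or_lt with h0 | h0
  · rw [← h0]; exact nrm_nonneg g
  · rw [sq] at hle
    exact le_of_mul_le_mul_left hle h0

lemma mc_single_eq_one {j : Fin 2} {x : T2} (h : mc (Pi.single j 1) x = 1) : x j = 0 := by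
  obtain ⟨y, rfl⟩ := proj_surjective x
  rw [mc_proj] at h
  have e : ((Pi.single j 1 : Fin 2 → ℤ) 0 : ℝ) * y 0 + ((Pi.single j 1 : Fin 2 → ℤ) 1 : ℝ) * y 1
      = y j := by fin_cases j <;> simp
  rw [e, Real.cos_eq_one_iff] at h
  obtain ⟨n, hn⟩ := h
  have : y j = n := by
    have := Real.pi_pos
    have h2 : (2 * Real.pi) * (y j - n) = 0 := by linarith
    rcases mul_eq_zero.1 h2 with h3 | h3
    · linarith
    · linarith
  simp only [proj, this]
  exact AddCircle.coe_eq_zero_iff _ |>.2 ⟨n, by simp⟩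

lemma sz_pos {x : T2} (hx : x ≠ 0) : 0 < sz x := by
  refine Real.sqrt_pos.2 ?_
  by_contra hneg
  have h0 := bv_nonneg 0 x
  have h1 := bv_nonneg 1 x
  apply hx
  ext j
  refine mc_single_eq_one ?_
  have : bv j x = 0 := by
    fin_cases j
    · simp only [Fin.zero_eta]; linarith
    · simp only [Fin.mk_one]; linarith
  unfold bv av at this
  linarith

lemma exists_le_add_mul_sz {φ : T2 → ℝ} (hφ : Continuous φ) (h0 : φ 0 = 0) {η : ℝ} (hη : 0 < η) :
    ∃ C : ℝ, 0 ≤ C ∧ ∀ z, φ z ≤ η + C * sz z ∧ φ z ≤ η + C * sz z ^ 2 := by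
  have hK : IsCompact {z | η ≤ φ z} := (isClosed_le continuous_const hφ).isCompact
  obtain ⟨B, hB⟩ := isCompact_univ.exists_bound_of_continuousOn hφ.continuousOn
  rcases {z | η ≤ φ z}.eq_empty_or_nonempty with hE | hE
  · refine ⟨0, le_rfl, fun z => ?_⟩
    have : z ∉ {z | η ≤ φ z} := by rw [hE]; simp
    simp only [mem_ofPred_eq, not_le] at this
    constructor <;> linarith
  · obtain ⟨w, hw, hmin⟩ := hK.exists_isMinOn hE continuous_sz.continuousOn
    have hw0 : 0 < sz w := by
      refine sz_pos ?_
      rintro rfl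
      simp only [mem_ofPred_eq, h0] at hw
      linarith
    have hB0 : 0 ≤ B := (norm_nonneg _).trans (hB 0 (mem_univ _))
    refine ⟨max (B / sz w) (B / sz w ^ 2), le_max_of_le_left (by positivity), fun z => ?_⟩
    by_cases hz : η ≤ φ z
    · have hsz : sz w ≤ sz z := hmin hz
      have hle : φ z ≤ B := (le_abs_self _).trans (hB z (mem_univ _))
      constructor
      · have : B ≤ max (B / sz w) (B / sz w ^ 2) * sz z := by
          calc B = B / sz w * sz w := by field_simp
            _ ≤ _ := mul_le_mul (le_max_left _ _) hsz hw0.le (le_max_of_le_left (by positivity))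
        linarith
      · have : B ≤ max (B / sz w) (B / sz w ^ 2) * sz z ^ 2 := by
          calc B = B / sz w ^ 2 * sz w ^ 2 := by field_simp
            _ ≤ _ := mul_le_mul (le_max_right _ _) (pow_le_pow_left₀ hw0.le hsz 2)
                (by positivity) (le_max_of_le_left (by positivity))
        linarith
    · push Not at hz
      have h1 : 0 ≤ max (B / sz w) (B / sz w ^ 2) := le_max_of_le_left (by positivity)
      constructor
      · have := mul_nonneg h1 (sz_nonneg z); linarith
      · have := mul_nonneg h1 (sq_nonneg (sz z)); linarith

lemma nrm_dl_zero (g : T2 → ℝ) : nrm (dl 0 g) = 0 := by simp [nrm, dl]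

lemma tendsto_nrm_mol_sub {g : T2 → ℝ} (hg : MemLp g 2 volume) :
    Filter.Tendsto (fun m => nrm (fun x => mol m g x - g x)) Filter.atTop (nhds 0) := by
  refine squeeze_zero (fun _ => nrm_nonneg _) (fun m => nrm_mol_sub_le m hg) ?_
  refine Metric.tendsto_nhds.2 fun ε hε => ?_
  obtain ⟨C, hC, h⟩ := exists_le_add_mul_sz (continuous_nrm_dl hg) (nrm_dl_zero g) (half_pos hε)
  have hlim : Filter.Tendsto (fun m : ℕ => C * (1 / ((m : ℝ) + 1))) Filter.atTop (nhds (C * 0)) :=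
    tendsto_one_div_add_atTop_nhds_zero_nat.const_mul C
  rw [mul_zero] at hlim
  filter_upwards [hlim.eventually (gt_mem_nhds (half_pos hε))] with m hm
  rw [Real.dist_eq, sub_zero, abs_of_nonneg
    (integral_nonneg fun z => mul_nonneg (ker_nonneg m z) (nrm_nonneg _))]
  have hs : Integrable (fun z => ker m z * sz z ^ 2) volume :=
    integrable_continuous ((smooth_ker m).continuous.mul (continuous_sz.pow 2))
  calc ∫ z, ker m z * nrm (dl z g)
      ≤ ∫ z, (ε / 2 * ker m z + C * (ker m z * sz z ^ 2)) := by
        refine integral_mono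
          (integrable_continuous ((smooth_ker m).continuous.mul (continuous_nrm_dl hg)))
          (((smooth_ker m).integrable.const_mul _).add (hs.const_mul _)) fun z => ?_
        have := mul_le_mul_of_nonneg_left (h z).2 (ker_nonneg m z)
        simp only
        linarith
    _ = ε / 2 + C * ∫ z, ker m z * sz z ^ 2 := by
        rw [integral_add ((smooth_ker m).integrable.const_mul _) (hs.const_mul _),
          integral_const_mul, integral_const_mul, integral_ker, mul_one]
    _ ≤ ε / 2 + C * (1 / (m + 1)) :=
        add_le_add le_rfl (mul_le_mul_of_nonneg_left (integral_ker_mul_sz_sq m) hC)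
    _ < ε := by linarith

lemma tendsto_nrm_mol {g : T2 → ℝ} (hg : MemLp g 2 volume) :
    Filter.Tendsto (fun m => nrm (mol m g)) Filter.atTop (nhds (nrm g)) := by
  refine tendsto_iff_dist_tendsto_zero.2 (squeeze_zero (fun _ => dist_nonneg) (fun m => ?_)
    (tendsto_nrm_mol_sub hg))
  exact abs_nrm_sub_nrm_le ((smooth_mol m hg.integrable_two).memLp 2) hg

/-! ### Weak derivatives: translation bound, Poincaré inequality, product rule -/

lemma nrm_dl_single_le {ψ : T2 → ℝ} (hψ : SmoothScalar ψ) (j : Fin 2) (h : ℝ) :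
    nrm (dl (proj (Pi.single j h)) ψ) ≤ |h| * nrm (pd j ψ) := by
  set φ := dl (proj (Pi.single j h)) ψ with hφ
  have sφ : SmoothScalar φ := (hψ.translate _).sub hψ
  obtain ⟨K, -, hK⟩ := (sφ).bounded
  obtain ⟨L, -, hL⟩ := (hψ.pd j).bounded
  let G : ℝ → ℝ := fun r => ∫ x, φ x * ψ (x + proj (Pi.single j r))
  have hG : ∀ r, HasDerivAt G (∫ x, φ x * pd j ψ (x + proj (Pi.single j r))) r := fun r =>
    (hasDerivAt_integral_of_dominated_loc_of_deriv_le
      (F := fun (r : ℝ) (x : T2) => φ x * ψ (x + proj (Pi.single j r)))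
      (F' := fun (r : ℝ) (x : T2) => φ x * pd j ψ (x + proj (Pi.single j r)))
      (μ := (volume : Measure T2)) (x₀ := r) (bound := fun _ => K * L) (s := univ) Filter.univ_mem
      (.of_forall fun h => (sφ.mul (hψ.translate _)).continuous.aestronglyMeasurable)
      (sφ.mul (hψ.translate _)).integrable
      (sφ.mul ((hψ.pd j).translate _)).continuous.aestronglyMeasurable
      (.of_forall fun x h _ => by
        rw [norm_mul]
        exact mul_le_mul (hK _) (hL _) (norm_nonneg _) ((abs_nonneg _).trans (hK x)))
      (integrable_const _)
      (.of_forall fun x h _ => (hψ.hasDerivAt j x h).const_mul _)).2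
  have hb : ∀ r, ‖∫ x, φ x * pd j ψ (x + proj (Pi.single j r))‖ ≤ nrm φ * nrm (pd j ψ) := fun r => by
    have := abs_integral_mul_le (sφ.memLp 2) (((hψ.pd j).translate (proj (Pi.single j r))).memLp 2)
    rwa [nrm_translate] at this
  have hmv := Convex.norm_image_sub_le_of_norm_hasDerivWithin_le (s := univ) (x := 0) (y := h)
    (fun r _ => (hG r).hasDerivWithinAt) (fun r _ => hb r) convex_univ (mem_univ _) (mem_univ _)
  have e : G h - G 0 = nrm φ ^ 2 := by
    simp only [G, proj_single_zero, add_zero]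
    rw [← integral_sub (sφ.mul (hψ.translate _)).integrable (sφ.mul hψ).integrable, sq_nrm]
    congr 1; ext x; simp only [hφ, dl]; ring
  rw [e, sub_zero, Real.norm_eq_abs, abs_of_nonneg (sq_nonneg _), Real.norm_eq_abs, sq] at hmv
  rcases (nrm_nonneg φ).eq_or_lt with h0 | h0
  · rw [← h0]; exact mul_nonneg (abs_nonneg _) (nrm_nonneg _)
  · refine le_of_mul_le_mul_left (hmv.trans (le_of_eq ?_)) h0
    ring

lemma exists_rep (z : T2) : ∃ y : Fin 2 → ℝ, proj y = z ∧ ∀ j, |y j| ≤ sz z := by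
  have h1 : ∀ j, ∃ r : ℝ, (r : UnitAddCircle) = z j ∧ |r| ≤ 1 / 2 := by
    intro j
    obtain ⟨r, hr⟩ := QuotientAddGroup.mk_surjective (z j)
    refine ⟨r - round r, ?_, abs_sub_round r⟩
    rw [AddCircle.coe_sub, show (r : UnitAddCircle) = z j from hr, sub_eq_self]
    exact AddCircle.coe_eq_zero_iff _ |>.2 ⟨round r, by simp⟩
  choose y hy hb using h1
  refine ⟨y, funext hy, fun j => ?_⟩
  have hz : proj y = z := funext hy
  refine le_trans ?_ (sqrt_bv_le_sz j z)
  have e : bv j z = Real.sin (Real.pi * |y j|) ^ 2 := by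
    rw [← hz, bv, av, mc_proj]
    have e : ((Pi.single j 1 : Fin 2 → ℤ) 0 : ℝ) * y 0 +
        ((Pi.single j 1 : Fin 2 → ℤ) 1 : ℝ) * y 1 = y j := by fin_cases j <;> simp
    rw [e, Real.sin_sq_eq_half_sub, ← mul_assoc, show 2 * Real.pi * |y j| = |2 * Real.pi * y j| by
      rw [abs_mul, abs_of_pos Real.two_pi_pos], Real.cos_abs]
    ring
  have hpi := Real.pi_pos
  have hsin := Real.mul_le_sin (x := Real.pi * |y j|) (by positivity) (by nlinarith [hb j])
  have h2 : 2 / Real.pi * (Real.pi * |y j|) = 2 * |y j| := by field_simp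
  rw [h2] at hsin
  have h0 := abs_nonneg (y j)
  rw [e, Real.sqrt_sq (by linarith)]
  linarith

lemma proj_eq_add (y : Fin 2 → ℝ) : proj y = proj (Pi.single 0 (y 0)) + proj (Pi.single 1 (y 1)) := by
  rw [← proj_add]
  congr 1
  ext j; fin_cases j <;> simp

lemma nrm_dl_le_of_smooth {ψ : T2 → ℝ} (hψ : SmoothScalar ψ) (z : T2) :
    nrm (dl z ψ) ≤ sz z * (nrm (pd 0 ψ) + nrm (pd 1 ψ)) := by
  obtain ⟨y, rfl, hy⟩ := exists_rep z
  have h1 := nrm_dl_add_le (hψ.memLp 2) (proj (Pi.single 0 (y 0))) (proj (Pi.single 1 (y 1)))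
  rw [← proj_eq_add] at h1
  have h2 := nrm_dl_single_le hψ 0 (y 0)
  have h3 := nrm_dl_single_le hψ 1 (y 1)
  have h4 := mul_le_mul_of_nonneg_right (hy 0) (nrm_nonneg (pd 0 ψ))
  have h5 := mul_le_mul_of_nonneg_right (hy 1) (nrm_nonneg (pd 1 ψ))
  linarith

/-- Increments of a function with weak gradient `D` in `L²` are controlled by `‖D‖`. -/
lemma nrm_dl_le_of_weak {g : T2 → ℝ} {D : Fin 2 → T2 → ℝ} (hg : MemLp g 2 volume)
    (hD : ∀ j, MemLp (D j) 2 volume) (hw : ∀ j, IsWeakPartial j g (D j)) (z : T2) :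
    nrm (dl z g) ≤ sz z * (nrm (D 0) + nrm (D 1)) := by
  have hs := fun m => smooth_mol m hg.integrable_two
  have hlim : Filter.Tendsto (fun m => nrm (dl z (mol m g))) Filter.atTop (nhds (nrm (dl z g))) := by
    have h0 := (tendsto_nrm_mol_sub hg).const_mul 2
    rw [mul_zero] at h0
    refine tendsto_iff_dist_tendsto_zero.2 (squeeze_zero (fun _ => dist_nonneg) (fun m => ?_) h0)
    refine (abs_nrm_sub_nrm_le (memLp_dl ((hs m).memLp 2) z) (memLp_dl hg z)).trans ?_
    refine le_trans (le_of_eq ?_) (nrm_dl_le (((hs m).memLp 2).sub hg) z)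
    congr 1; ext x; simp only [dl, Pi.sub_apply]; ring
  refine le_of_tendsto hlim (.of_forall fun m => (nrm_dl_le_of_smooth (hs m) z).trans ?_)
  have e : ∀ j, nrm (pd j (mol m g)) ≤ nrm (D j) := fun j => by
    rw [show pd j (mol m g) = mol m (D j) from funext (pd_mol_of_weak m hg.integrable_two (hw j))]
    exact nrm_mol_le m (hD j)
  exact mul_le_mul_of_nonneg_left (add_le_add (e 0) (e 1)) (sz_nonneg z)

lemma sz_le (z : T2) : sz z ≤ 2 := by
  refine Real.sqrt_le_iff.2 ⟨by norm_num, ?_⟩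
  linarith [bv_le_one 0 z, bv_le_one 1 z]

/-- Poincaré's inequality, from the bound on increments. -/
lemma poincare {g : T2 → ℝ} {D : Fin 2 → T2 → ℝ} (hg : MemLp g 2 volume)
    (hD : ∀ j, MemLp (D j) 2 volume) (hw : ∀ j, IsWeakPartial j g (D j)) (h0 : ∫ x, g x = 0) :
    nrm g ≤ 2 * (nrm (D 0) + nrm (D 1)) := by
  have hi := hg.integrable_two
  have hF := integrable_shear_ker (k := fun _ => 1) hi hi continuous_const
  simp only [one_mul] at hF
  have hsw := integral_integral_swap (f := fun x z => g x * g (x + z)) hF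
  have hz : ∫ z, ∫ x, g x * g (x + z) = 0 := by
    rw [← hsw]
    simp_rw [integral_const_mul, integral_add_left_eq_self, h0, mul_zero, integral_zero]
  have hright : Integrable (fun z => ∫ x, g x * g (x + z)) volume := hF.integral_prod_right
  have e : nrm g ^ 2 = ∫ z, (nrm g ^ 2 - ∫ x, g x * g (x + z)) := by
    rw [integral_sub (integrable_const _) hright, hz]; simp
  have hle : nrm g ^ 2 ≤ nrm g * (2 * (nrm (D 0) + nrm (D 1))) := by
    rw [e]
    calc _ ≤ ∫ z : T2, nrm g * (2 * (nrm (D 0) + nrm (D 1))) := by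
          refine integral_mono ((integrable_const _).sub hright) (integrable_const _) fun z => ?_
          have i1 : Integrable (fun x => g x * g (x + z)) volume :=
            hg.integrable_mul (memLp_translate hg z)
          have e2 : nrm g ^ 2 - ∫ x, g x * g (x + z) = -∫ x, g x * dl z g x := by
            rw [sq_nrm, ← integral_sub hg.integrable_sq i1, ← integral_neg]
            congr 1; ext x; simp only [dl]; ring
          simp only [e2]
          refine (neg_le_abs _).trans ((abs_integral_mul_le hg (memLp_dl hg z)).trans ?_)
          refine mul_le_mul_of_nonneg_left ((nrm_dl_le_of_weak hg hD hw z).trans ?_) (nrm_nonneg _)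
          exact mul_le_mul_of_nonneg_right (sz_le z) (add_nonneg (nrm_nonneg _) (nrm_nonneg _))
      _ = _ := by simp
  rcases (nrm_nonneg g).eq_or_lt with h | h
  · rw [← h]; have := nrm_nonneg (D 0); have := nrm_nonneg (D 1); positivity
  · rw [sq] at hle
    exact le_of_mul_le_mul_left hle h

lemma integrable_mul_two {f g : T2 → ℝ} (hf : MemLp f 2 volume) (hg : MemLp g 2 volume) :
    Integrable (fun x => f x * g x) volume := hf.integrable_mul hg

lemma tendsto_integral_mol_mul {f h : T2 → ℝ} (hf : MemLp f 2 volume) (hh : MemLp h 2 volume) :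
    Filter.Tendsto (fun m => ∫ x, mol m f x * h x) Filter.atTop (nhds (∫ x, f x * h x)) := by
  have h0 := (tendsto_nrm_mol_sub hf).mul_const (nrm h)
  rw [zero_mul] at h0
  refine tendsto_iff_dist_tendsto_zero.2 (squeeze_zero (fun _ => dist_nonneg) (fun m => ?_) h0)
  have hm := (smooth_mol m hf.integrable_two).memLp 2
  rw [Real.dist_eq, ← integral_sub (integrable_mul_two hm hh) (integrable_mul_two hf hh)]
  simp_rw [← sub_mul]
  exact abs_integral_mul_le (hm.sub hf) hh

lemma memLp_mul_smooth {g ψ : T2 → ℝ} (hg : MemLp g 2 volume) (hψ : SmoothScalar ψ) :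
    MemLp (fun x => g x * ψ x) 2 volume := by
  exact MemLp.mul (hψ.memLp ∞) hg (r := 2)

/-- The product rule for weak derivatives in `L²`. -/
lemma integral_mul_mul_pd {a b Da Db ψ : T2 → ℝ} {j : Fin 2} (ha : MemLp a 2 volume)
    (hb : MemLp b 2 volume) (hDa : MemLp Da 2 volume) (hDb : MemLp Db 2 volume)
    (hwa : IsWeakPartial j a Da) (hwb : IsWeakPartial j b Db) (hψ : SmoothScalar ψ) :
    ∫ x, a x * (b x * pd j ψ x) =
      -(∫ x, Da x * (b x * ψ x)) - ∫ x, a x * (Db x * ψ x) := by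
  have h1 := tendsto_integral_mol_mul ha (memLp_mul_smooth hb (hψ.pd j))
  have h2 := tendsto_integral_mol_mul hDa (memLp_mul_smooth hb hψ)
  have h3 := tendsto_integral_mol_mul ha (memLp_mul_smooth hDb hψ)
  have h4 := h2.neg.sub h3
  refine tendsto_nhds_unique h1 (h4.congr fun m => ?_)
  have sm := smooth_mol m ha.integrable_two
  have sD := smooth_mol m hDa.integrable_two
  have key := hwb _ (sm.mul hψ)
  simp_rw [pd_mul sm hψ, pd_mol_of_weak m ha.integrable_two hwa, mul_add] at key
  have i1 : Integrable (fun x => b x * (mol m Da x * ψ x)) volume :=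
    integrable_mul_smooth (sD.mul hψ) hb.integrable_two
  have i2 : Integrable (fun x => b x * (mol m a x * pd j ψ x)) volume :=
    integrable_mul_smooth (sm.mul (hψ.pd j)) hb.integrable_two
  rw [integral_add i1 i2] at key
  have e1 : ∫ x, mol m Da x * (b x * ψ x) = ∫ x, b x * (mol m Da x * ψ x) := by
    congr 1; ext x; ring
  have e2 : ∫ x, mol m a x * (b x * pd j ψ x) = ∫ x, b x * (mol m a x * pd j ψ x) := by
    congr 1; ext x; ring
  have e3 : ∫ x, mol m a x * (Db x * ψ x) = ∫ x, Db x * (mol m a x * ψ x) := by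
    congr 1; ext x; ring
  rw [e1, e2, e3]
  linarith

/-! ### Divergence-free fields in `H¹` -/

/-- `D i j` is the weak derivative `∂_j v_i`, the field `v` is divergence-free, and all these
functions are in `L²`. -/
structure IsSobolevDivFree (v : Fin 2 → T2 → ℝ) (D : Fin 2 → Fin 2 → T2 → ℝ) : Prop where
  memLp : ∀ i, MemLp (v i) 2 volume
  memLp_grad : ∀ i j, MemLp (D i j) 2 volume
  weak : ∀ i j, IsWeakPartial j (v i) (D i j)
  div_free : ∀ ψ, SmoothScalar ψ → ∫ x, ∑ j, v j x * pd j ψ x = 0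

namespace IsSobolevDivFree

variable {v : Fin 2 → T2 → ℝ} {D : Fin 2 → Fin 2 → T2 → ℝ}

lemma integrable_mul_pd (h : IsSobolevDivFree v D) {ψ : T2 → ℝ} (hψ : SmoothScalar ψ) (i j : Fin 2) :
    Integrable (fun x => v i x * pd j ψ x) volume :=
  integrable_mul_smooth (hψ.pd j) (h.memLp i).integrable_two

/-- The transport term in conservative and in convective form. -/
lemma integral_transport (h : IsSobolevDivFree v D) {ψ : T2 → ℝ} (hψ : SmoothScalar ψ)
    (i : Fin 2) :
    ∫ x, ∑ j, v j x * (v i x * pd j ψ x) = -∫ x, ∑ j, v j x * (D i j x * ψ x) := by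
  have hmem := fun j => memLp_mul_smooth (h.memLp j) (hψ.pd j)
  have hmem' := fun j => memLp_mul_smooth (h.memLp j) hψ
  have h1 : ∀ j, Filter.Tendsto (fun m => ∫ x, mol m (v i) x * (v j x * pd j ψ x)) Filter.atTop
      (nhds (∫ x, v i x * (v j x * pd j ψ x))) :=
    fun j => tendsto_integral_mol_mul (h.memLp i) (hmem j)
  have h2 : ∀ j, Filter.Tendsto (fun m => ∫ x, mol m (D i j) x * (v j x * ψ x)) Filter.atTop
      (nhds (∫ x, D i j x * (v j x * ψ x))) :=
    fun j => tendsto_integral_mol_mul (h.memLp_grad i j) (hmem' j)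
  have h3 := tendsto_finsetSum Finset.univ fun j _ => (h1 j).add (h2 j)
  have key : ∑ j, ((∫ x, v i x * (v j x * pd j ψ x)) + ∫ x, D i j x * (v j x * ψ x)) = 0 := by
    refine tendsto_nhds_unique h3 ?_
    refine tendsto_const_nhds.congr fun m => ?_
    have sm := smooth_mol m (h.memLp i).integrable_two
    have e := h.div_free _ (sm.mul hψ)
    rw [← e]
    rw [integral_finsetSum _ fun j _ => h.integrable_mul_pd (sm.mul hψ) j j]
    refine Finset.sum_congr rfl fun j _ => ?_
    rw [← integral_add
      (integrable_mul_two (sm.memLp 2) (hmem j))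
      (integrable_mul_two ((smooth_mol m (h.memLp_grad i j).integrable_two).memLp 2) (hmem' j))]
    congr 1; ext x
    rw [pd_mul sm hψ, pd_mol_of_weak m (h.memLp i).integrable_two (h.weak i j)]
    ring
  have i1 : ∀ j, Integrable (fun x => v j x * (v i x * pd j ψ x)) volume := fun j =>
    (h.memLp j).integrable_mul (memLp_mul_smooth (h.memLp i) (hψ.pd j))
  have i2 : ∀ j, Integrable (fun x => v j x * (D i j x * ψ x)) volume := fun j =>
    (h.memLp j).integrable_mul (memLp_mul_smooth (h.memLp_grad i j) hψ)
  rw [integral_finsetSum _ fun j _ => i1 j, integral_finsetSum _ fun j _ => i2 j,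
    ← add_eq_zero_iff_eq_neg, ← Finset.sum_add_distrib, ← key]
  refine Finset.sum_congr rfl fun j _ => ?_
  congr 1
  · congr 1; ext x; ring
  · congr 1; ext x; ring

/-- The vorticity `∂₀ v₁ - ∂₁ v₀`. -/
def vort (D : Fin 2 → Fin 2 → T2 → ℝ) (x : T2) : ℝ := D 1 0 x - D 0 1 x

lemma memLp_vort (h : IsSobolevDivFree v D) : MemLp (vort D) 2 volume :=
  (h.memLp_grad 1 0).sub (h.memLp_grad 0 1)

lemma integral_vort_mul (h : IsSobolevDivFree v D) {ψ : T2 → ℝ} (hψ : SmoothScalar ψ) :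
    ∫ x, vort D x * ψ x = ∫ x, (v 0 x * pd 1 ψ x - v 1 x * pd 0 ψ x) := by
  rw [integral_sub (h.integrable_mul_pd hψ 0 1) (h.integrable_mul_pd hψ 1 0),
    h.weak 0 1 ψ hψ, h.weak 1 0 ψ hψ]
  simp only [vort, sub_mul]
  rw [integral_sub (integrable_mul_smooth hψ (h.memLp_grad 1 0).integrable_two)
    (integrable_mul_smooth hψ (h.memLp_grad 0 1).integrable_two)]
  ring

/-- Tested with a rotated gradient, the quadratic term is the transport of the vorticity: the
remaining part of `v·∇v` is the gradient of `|v|²/2`. -/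
lemma integral_quadratic_curl (h : IsSobolevDivFree v D) {ψ : T2 → ℝ} (hψ : SmoothScalar ψ) :
    (∫ x, ∑ j, v j x * (v 0 x * pd j (pd 1 ψ) x)) - ∫ x, ∑ j, v j x * (v 1 x * pd j (pd 0 ψ) x) =
      ∫ x, vort D x * ∑ j, v j x * pd j ψ x := by
  rw [h.integral_transport (hψ.pd 1) 0, h.integral_transport (hψ.pd 0) 1]
  have i : ∀ i j k l, Integrable (fun x => v i x * (D j k x * pd l ψ x)) volume := fun i j k l =>
    (h.memLp i).integrable_mul (memLp_mul_smooth (h.memLp_grad j k) (hψ.pd l))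
  have q : ∀ i j, 2 * ∫ x, v i x * (D i j x * pd (1 - j) ψ x) =
      -∫ x, v i x * (v i x * pd j (pd (1 - j) ψ) x) := by
    intro i j
    have := integral_mul_mul_pd (h.memLp i) (h.memLp i) (h.memLp_grad i j) (h.memLp_grad i j)
      (h.weak i j) (h.weak i j) (hψ.pd (1 - j))
    have e : ∫ x, D i j x * (v i x * pd (1 - j) ψ x) = ∫ x, v i x * (D i j x * pd (1 - j) ψ x) := by
      congr 1; ext x; ring
    rw [e] at this
    linarith
  have q' : ∀ i, ∫ x, v i x * (D i 0 x * pd 1 ψ x) = ∫ x, v i x * (D i 1 x * pd 0 ψ x) := by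
    intro i
    have a := q i 0
    have b := q i 1
    simp only [show (1 : Fin 2) - 0 = 1 from rfl, show (1 : Fin 2) - 1 = 0 from rfl] at a b
    simp_rw [pd_comm hψ 0 1] at a
    linarith
  have e : ∀ x, vort D x * ∑ j, v j x * pd j ψ x =
      v 0 x * (D 1 0 x * pd 0 ψ x) + v 1 x * (D 1 0 x * pd 1 ψ x) -
      v 0 x * (D 0 1 x * pd 0 ψ x) - v 1 x * (D 0 1 x * pd 1 ψ x) := fun x => by
    rw [Fin.sum_univ_two, vort]; ring
  simp_rw [e, Fin.sum_univ_two]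
  have i3 : Integrable (fun x => v 0 x * (D 1 0 x * pd 0 ψ x) + v 1 x * (D 1 0 x * pd 1 ψ x))
    volume := (i _ _ _ _).add (i _ _ _ _)
  have i4 : Integrable (fun x => v 0 x * (D 1 0 x * pd 0 ψ x) + v 1 x * (D 1 0 x * pd 1 ψ x) -
    v 0 x * (D 0 1 x * pd 0 ψ x)) volume := i3.sub (i _ _ _ _)
  rw [integral_add (i _ _ _ _) (i _ _ _ _), integral_add (i _ _ _ _) (i _ _ _ _),
    integral_sub i4 (i _ _ _ _), integral_sub i3 (i _ _ _ _), integral_add (i _ _ _ _) (i _ _ _ _)]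
  linarith [q' 0, q' 1]

/-- The total size of the gradient. -/
noncomputable def gradNrm (D : Fin 2 → Fin 2 → T2 → ℝ) : ℝ := ∑ i, ∑ j, nrm (D i j)

lemma nrm_dl_le (h : IsSobolevDivFree v D) (i : Fin 2) (z : T2) :
    nrm (dl z (v i)) ≤ sz z * gradNrm D := by
  refine (nrm_dl_le_of_weak (h.memLp i) (h.memLp_grad i) (h.weak i) z).trans
    (mul_le_mul_of_nonneg_left ?_ (sz_nonneg z))
  have n := fun i j => nrm_nonneg (D i j)
  simp only [gradNrm, Fin.sum_univ_two]
  fin_cases i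
  · simp only [Fin.zero_eta]; linarith [n 1 0, n 1 1]
  · simp only [Fin.mk_one]; linarith [n 0 0, n 0 1]

end IsSobolevDivFree

/-! ### The commutator estimate -/

lemma integral_ker_shear_left {f g k : T2 → ℝ} (hf : Integrable f volume)
    (hg : Integrable g volume) (hk : Continuous k) :
    ∫ z, k z * ∫ x, f x * g (x + z) = ∫ x, f x * ∫ z, k z * g (x + z) := by
  have h := integral_integral_swap (f := fun x z => k z * (f x * g (x + z)))
    (integrable_shear_ker hf hg hk)
  simp_rw [← integral_const_mul]
  rw [← h]
  refine integral_congr_ae (.of_forall fun x => integral_congr_ae (.of_forall fun z => ?_))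
  simp only; ring

lemma integral_conv_eq (k g : T2 → ℝ) (x : T2) :
    ∫ y, k (x - y) * g y = ∫ z, k (-z) * g (x + z) := by
  have h := integral_add_left_eq_self (fun y => k (x - y) * g y) (μ := (volume : Measure T2)) x
  rw [← h]
  simp

lemma integral_ker_shear_right {f g k : T2 → ℝ} (hf : Integrable f volume)
    (hg : Integrable g volume) (hk : Continuous k) :
    ∫ z, k z * ∫ x, f x * g (x + z) = ∫ y, g y * ∫ x, k (y - x) * f x := by
  have h1 := integral_neg_eq_self (fun z => k z * ∫ x, f x * g (x + z)) (volume : Measure T2)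
  have h2 : ∀ z, ∫ x, f x * g (x + -z) = ∫ x, g x * f (x + z) := fun z => by
    have := integral_add_right_eq_self (fun x => f x * g (x + -z)) (μ := (volume : Measure T2)) z
    rw [← this]
    congr 1; ext x; simp [mul_comm]
  rw [← h1]
  simp_rw [h2, integral_conv_eq]
  exact integral_ker_shear_left hg hf (hk.comp continuous_neg)

lemma integral_pd_ker (m : ℕ) (j : Fin 2) : ∫ z, pd j (ker m) z = 0 := integral_pd (smooth_ker m) j

/-- Mollification preserves divergence-free fields. -/
lemma sum_pd_mol_eq_zero {v : Fin 2 → T2 → ℝ} (hv : ∀ i, MemLp (v i) 2 volume)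
    (hdiv : ∀ ψ, SmoothScalar ψ → ∫ x, ∑ j, v j x * pd j ψ x = 0) (m : ℕ) (x : T2) :
    ∑ j, pd j (mol m (v j)) x = 0 := by
  have h := hdiv _ (smooth_ker_sub m x)
  simp_rw [pd_ker_sub, mul_neg, Finset.sum_neg_distrib] at h
  have ii : ∀ j, Integrable (fun y => v j y * pd j (ker m) (x - y)) volume := fun j => by
    have := integrable_mul_smooth ((smooth_ker_sub m x).pd j) (hv j).integrable_two
    simp_rw [pd_ker_sub, mul_neg] at this
    simpa using this.neg
  rw [integral_neg, neg_eq_zero, integral_finsetSum _ fun j _ => ii j] at h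
  rw [← h]
  refine Finset.sum_congr rfl fun j _ => ?_
  rw [pd_mol_eq_integral m (hv j).integrable_two]
  simp_rw [mul_comm]

/-- The commutator of mollification and transport: for `θ` and `v` in `L²`, `v` divergence-free,
`∫ θ v·∇(κ * B'(κ * θ))` is an integral of products of increments of `θ` and `v`, because
`∫ v·∇(B(κ * θ)) = 0`. -/
lemma IsSobolevDivFree.integral_commutator {v : Fin 2 → T2 → ℝ} {D : Fin 2 → Fin 2 → T2 → ℝ}
    (h : IsSobolevDivFree v D) {θ : T2 → ℝ} (hθ : MemLp θ 2 volume) {B : ℝ → ℝ}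
    (hB : ContDiff ℝ ∞ B) (m : ℕ) :
    ∫ x, θ x * ∑ j, v j x * pd j (mol m (fun x => deriv B (mol m θ x))) x =
      ∑ j, ∫ z, pd j (ker m) z * ∫ x, deriv B (mol m θ x) * (dl z θ x * dl z (v j) x) := by
  set W := mol m θ with hW
  have sW : SmoothScalar W := smooth_mol m hθ.integrable_two
  have hB' : ContDiff ℝ ∞ (deriv B) := (contDiff_infty_iff_deriv.1 hB).2
  set g : T2 → ℝ := fun x => deriv B (W x) with hg
  have sg : SmoothScalar g := sW.comp hB'
  have hk := fun j => ((smooth_ker m).pd j).continuous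
  have igθ : Integrable (fun x => g x * θ x) volume := integrable_smooth_mul sg hθ.integrable_two
  have igv := fun j => integrable_smooth_mul sg (h.memLp j).integrable_two
  have iθv := fun j => integrable_mul_two hθ (h.memLp j)
  have igθv : ∀ j, Integrable (fun x => g x * (θ x * v j x)) volume := fun j =>
    integrable_smooth_mul sg (iθv j)
  -- the four terms of the expansion
  have tA : ∀ j, ∫ z, pd j (ker m) z * ∫ x, g x * (θ (x + z) * v j (x + z)) =
      ∫ x, θ x * (v j x * pd j (mol m g) x) := fun j => by
    rw [integral_ker_shear_right (g := fun x => θ x * v j x) sg.integrable (iθv j) (hk j)]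
    simp_rw [← pd_mol_eq_integral m sg.integrable, mul_assoc]
  have tB : ∀ j, ∫ z, pd j (ker m) z * ∫ x, (g x * v j x) * θ (x + z) =
      -∫ x, v j x * pd j (fun x => B (W x)) x := fun j => by
    rw [integral_ker_shear_left (igv j) hθ.integrable_two (hk j), ← integral_neg]
    congr 1; ext x
    have e : ∫ z, pd j (ker m) z * θ (x + z) = -pd j W x := by
      rw [hW, pd_mol_eq_integral m hθ.integrable_two, integral_conv_eq, ← integral_neg]
      simp_rw [pd_ker_neg, neg_mul, neg_neg]
    rw [e, pd_comp sW (hB.differentiable (by simp))]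
    simp only [hg]; ring
  have tC : ∀ j, ∫ z, pd j (ker m) z * ∫ x, (g x * θ x) * v j (x + z) =
      -∫ x, (g x * θ x) * pd j (mol m (v j)) x := fun j => by
    rw [integral_ker_shear_left igθ (h.memLp j).integrable_two (hk j), ← integral_neg]
    congr 1; ext x
    have e : ∫ z, pd j (ker m) z * v j (x + z) = -pd j (mol m (v j)) x := by
      rw [pd_mol_eq_integral m (h.memLp j).integrable_two, integral_conv_eq, ← integral_neg]
      simp_rw [pd_ker_neg, neg_mul, neg_neg]
    rw [e]; ring
  have tD : ∀ j, ∫ z, pd j (ker m) z * ∫ x, g x * (θ x * v j x) = 0 := fun j => by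
    rw [integral_mul_const, integral_pd_ker, zero_mul]
  have iA : ∀ j, Integrable (fun z => pd j (ker m) z * ∫ x, g x * (θ (x + z) * v j (x + z)))
      volume := fun j => by
    have := (integrable_shear_ker (g := fun x => θ x * v j x) sg.integrable (iθv j)
      (hk j)).integral_prod_right
    simpa only [integral_const_mul] using this
  have iB : ∀ j, Integrable (fun z => pd j (ker m) z * ∫ x, (g x * v j x) * θ (x + z))
      volume := fun j => by
    have := (integrable_shear_ker (igv j) hθ.integrable_two (hk j)).integral_prod_right
    simpa only [integral_const_mul] using this
  have iC : ∀ j, Integrable (fun z => pd j (ker m) z * ∫ x, (g x * θ x) * v j (x + z))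
      volume := fun j => by
    have := (integrable_shear_ker igθ (h.memLp j).integrable_two (hk j)).integral_prod_right
    simpa only [integral_const_mul] using this
  have iD : ∀ j, Integrable (fun z => pd j (ker m) z * ∫ x, g x * (θ x * v j x)) volume :=
    fun j => ((smooth_ker m).pd j).integrable.mul_const _
  have hexp : ∀ j, ∫ z, pd j (ker m) z * ∫ x, g x * (dl z θ x * dl z (v j) x) =
      (∫ x, θ x * (v j x * pd j (mol m g) x)) + (∫ x, v j x * pd j (fun x => B (W x)) x) +
        ∫ x, (g x * θ x) * pd j (mol m (v j)) x := by
    intro j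
    have hz : ∀ z, pd j (ker m) z * ∫ x, g x * (dl z θ x * dl z (v j) x) =
        ((pd j (ker m) z * ∫ x, g x * (θ (x + z) * v j (x + z))) -
        (pd j (ker m) z * ∫ x, (g x * v j x) * θ (x + z)) -
        (pd j (ker m) z * ∫ x, (g x * θ x) * v j (x + z))) +
        (pd j (ker m) z * ∫ x, g x * (θ x * v j x)) := by
      intro z
      have tθ := memLp_translate hθ z
      have tv := memLp_translate (h.memLp j) z
      have j1 : Integrable (fun x => g x * (θ (x + z) * v j (x + z))) volume :=
        integrable_smooth_mul sg (integrable_mul_two tθ tv)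
      have j2 : Integrable (fun x => (g x * v j x) * θ (x + z)) volume := by
        have := integrable_smooth_mul sg (integrable_mul_two (h.memLp j) tθ)
        simpa only [mul_assoc] using this
      have j3 : Integrable (fun x => (g x * θ x) * v j (x + z)) volume := by
        have := integrable_smooth_mul sg (integrable_mul_two hθ tv)
        simpa only [mul_assoc] using this
      have j12 : Integrable (fun x => g x * (θ (x + z) * v j (x + z)) - (g x * v j x) * θ (x + z))
        volume := j1.sub j2
      have j123 : Integrable (fun x => g x * (θ (x + z) * v j (x + z)) -
        (g x * v j x) * θ (x + z) - (g x * θ x) * v j (x + z)) volume := j12.sub j3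
      rw [← mul_sub, ← mul_sub, ← mul_add]
      congr 1
      rw [← integral_sub j1 j2, ← integral_sub j12 j3, ← integral_add j123 (igθv j)]
      congr 1; ext x; simp only [dl]; ring
    simp_rw [hz]
    have iAB := (iA j).sub (iB j)
    have iABC := iAB.sub (iC j)
    have r1 := integral_add iABC (iD j)
    have r2 := integral_sub iAB (iC j)
    have r3 := integral_sub (iA j) (iB j)
    simp only [Pi.sub_apply] at r1 r2 r3
    rw [r1, r2, r3, tA, tB, tC, tD]
    ring
  change ∫ x, θ x * ∑ j, v j x * pd j (mol m g) x =
    ∑ j, ∫ z, pd j (ker m) z * ∫ x, g x * (dl z θ x * dl z (v j) x)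
  simp_rw [hexp, Finset.sum_add_distrib]
  have z1 : ∑ j, ∫ x, v j x * pd j (fun x => B (W x)) x = 0 := by
    rw [← integral_finsetSum _ fun j _ => h.integrable_mul_pd (sW.comp hB) j j]
    exact h.div_free _ (sW.comp hB)
  have z2 : ∑ j, ∫ x, (g x * θ x) * pd j (mol m (v j)) x = 0 := by
    rw [← integral_finsetSum _ fun j _ => integrable_mul_smooth
      ((smooth_mol m (h.memLp j).integrable_two).pd j) igθ]
    have := sum_pd_mol_eq_zero h.memLp h.div_free m
    simp_rw [← Finset.mul_sum, this, mul_zero, integral_zero]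
  rw [z1, z2, add_zero, add_zero, ← integral_finsetSum]
  · simp_rw [Finset.mul_sum]
  · intro j _
    have := integrable_mul_smooth ((smooth_mol m sg.integrable).pd j) (iθv j)
    simpa only [mul_assoc] using this

/-- The modulus of `θ` that controls the commutator. -/
noncomputable def modulus (m : ℕ) (θ : T2 → ℝ) : ℝ :=
  ∑ j, ∫ z, |pd j (ker m) z| * (sz z * nrm (dl z θ))

lemma integrable_modulus (m : ℕ) (j : Fin 2) {θ : T2 → ℝ} (hθ : MemLp θ 2 volume) :
    Integrable (fun z => |pd j (ker m) z| * (sz z * nrm (dl z θ))) volume :=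
  integrable_continuous (((smooth_ker m).pd j).continuous.abs.mul
    (continuous_sz.mul (continuous_nrm_dl hθ)))

lemma modulus_nonneg (m : ℕ) (θ : T2 → ℝ) : 0 ≤ modulus m θ :=
  Finset.sum_nonneg fun _ _ => integral_nonneg fun z =>
    mul_nonneg (abs_nonneg _) (mul_nonneg (sz_nonneg z) (nrm_nonneg _))

lemma integrable_abs_pd_ker_mul (m : ℕ) (j : Fin 2) {k : T2 → ℝ} (hk : Continuous k) :
    Integrable (fun z => |pd j (ker m) z| * k z) volume :=
  integrable_continuous (((smooth_ker m).pd j).continuous.abs.mul hk)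

lemma modulus_le (m : ℕ) {θ : T2 → ℝ} (hθ : MemLp θ 2 volume) :
    modulus m θ ≤ 16 * Real.pi * nrm θ := by
  have : ∀ j ∈ Finset.univ, ∫ z, |pd j (ker m) z| * (sz z * nrm (dl z θ)) ≤
      8 * Real.pi * nrm θ := fun j _ => by
    calc _ ≤ ∫ z, (2 * nrm θ) * (|pd j (ker m) z| * sz z) := by
          refine integral_mono (integrable_modulus m j hθ)
            ((integrable_abs_pd_ker_mul m j continuous_sz).const_mul _) fun z => ?_
          have := mul_le_mul_of_nonneg_left (nrm_dl_le hθ z)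
            (mul_nonneg (abs_nonneg (pd j (ker m) z)) (sz_nonneg z))
          simp only
          linarith
      _ ≤ (2 * nrm θ) * (4 * Real.pi) := by
          rw [integral_const_mul]
          exact mul_le_mul_of_nonneg_left (integral_abs_pd_ker_mul_sz m j)
            (by have := nrm_nonneg θ; positivity)
      _ = _ := by ring
  refine (Finset.sum_le_sum this).trans (le_of_eq ?_)
  simp; ring

lemma modulus_le_of_dl_le (m : ℕ) {θ : T2 → ℝ} (hθ : MemLp θ 2 volume) {V : ℝ}
    (h : ∀ z, nrm (dl z θ) ≤ sz z * V) : modulus m θ ≤ 16 * Real.pi / √(m + 1) * V := by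
  have : ∀ j ∈ Finset.univ, ∫ z, |pd j (ker m) z| * (sz z * nrm (dl z θ)) ≤
      (∫ z, |pd j (ker m) z| * sz z ^ 2) * V := fun j _ => by
    rw [← integral_mul_const]
    refine integral_mono (integrable_modulus m j hθ)
      ((integrable_abs_pd_ker_mul m j (continuous_sz.pow 2)).mul_const _) fun z => ?_
    have := mul_le_mul_of_nonneg_left (h z)
      (mul_nonneg (abs_nonneg (pd j (ker m) z)) (sz_nonneg z))
    simp only
    linarith
  have hV : 0 ≤ V := by
    by_contra hneg
    push Not at hneg
    obtain ⟨z, hz⟩ : ∃ z : T2, z ≠ 0 := by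
      refine ⟨proj fun _ => 1 / 2, fun h0 => ?_⟩
      have : mc (Pi.single 0 1) (proj fun _ => 1 / 2) = 1 := by
        rw [h0, ← proj_zero, mc_proj]; simp
      rw [mc_proj] at this
      norm_num at this
      rw [show 2 * Real.pi * (1 / 2) = Real.pi by ring, Real.cos_pi] at this
      norm_num at this
    have h1 := h z
    have h2 := nrm_nonneg (dl z θ)
    nlinarith [sz_pos hz]
  have h2 : ∀ j ∈ Finset.univ, (∫ z, |pd j (ker m) z| * sz z ^ 2) * V ≤
      8 * Real.pi / √(m + 1) * V := fun j _ =>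
    mul_le_mul_of_nonneg_right (integral_abs_pd_ker_mul_sz_sq m j) hV
  refine (Finset.sum_le_sum this).trans ((Finset.sum_le_sum h2).trans (le_of_eq ?_))
  simp; ring

lemma tendsto_inv_sqrt : Filter.Tendsto (fun m : ℕ => 1 / √((m : ℝ) + 1)) Filter.atTop (nhds 0) := by
  have h := (tendsto_one_div_add_atTop_nhds_zero_nat (𝕜 := ℝ)).sqrt
  rw [Real.sqrt_zero] at h
  refine h.congr fun m => ?_
  rw [Real.sqrt_div zero_le_one, Real.sqrt_one]

lemma tendsto_modulus {θ : T2 → ℝ} (hθ : MemLp θ 2 volume) :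
    Filter.Tendsto (fun m => modulus m θ) Filter.atTop (nhds 0) := by
  have hj : ∀ j, Filter.Tendsto (fun m => ∫ z, |pd j (ker m) z| * (sz z * nrm (dl z θ)))
      Filter.atTop (nhds 0) := by
    intro j
    refine Metric.tendsto_nhds.2 fun ε hε => ?_
    have hpi := Real.pi_pos
    obtain ⟨C, hC, h⟩ := exists_le_add_mul_sz (continuous_nrm_dl hθ) (nrm_dl_zero θ)
      (show 0 < ε / (8 * Real.pi) by positivity)
    have hlim := tendsto_inv_sqrt.const_mul (C * (8 * Real.pi))
    rw [mul_zero] at hlim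
    filter_upwards [hlim.eventually (gt_mem_nhds (half_pos hε))] with m hm
    rw [Real.dist_eq, sub_zero, abs_of_nonneg (integral_nonneg fun z =>
      mul_nonneg (abs_nonneg _) (mul_nonneg (sz_nonneg z) (nrm_nonneg _)))]
    have i1 := integrable_abs_pd_ker_mul m j continuous_sz
    have i2 : Integrable (fun z => |pd j (ker m) z| * sz z ^ 2) volume :=
      integrable_abs_pd_ker_mul m j (continuous_sz.pow 2)
    calc _ ≤ ∫ z, (ε / (8 * Real.pi) * (|pd j (ker m) z| * sz z) +
          C * (|pd j (ker m) z| * sz z ^ 2)) := by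
          refine integral_mono (integrable_modulus m j hθ)
            ((i1.const_mul _).add (i2.const_mul _)) fun z => ?_
          have := mul_le_mul_of_nonneg_left (h z).1
            (mul_nonneg (abs_nonneg (pd j (ker m) z)) (sz_nonneg z))
          simp only
          linarith
      _ = ε / (8 * Real.pi) * (∫ z, |pd j (ker m) z| * sz z) +
          C * ∫ z, |pd j (ker m) z| * sz z ^ 2 := by
          rw [integral_add (i1.const_mul _) (i2.const_mul _), integral_const_mul,
            integral_const_mul]
      _ ≤ ε / (8 * Real.pi) * (4 * Real.pi) + C * (8 * Real.pi / √(m + 1)) :=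
          add_le_add (mul_le_mul_of_nonneg_left (integral_abs_pd_ker_mul_sz m j) (by positivity))
            (mul_le_mul_of_nonneg_left (integral_abs_pd_ker_mul_sz_sq m j) hC)
      _ = ε / 2 + C * (8 * Real.pi) * (1 / √(m + 1)) := by field_simp; ring
      _ < ε := by linarith
  have := tendsto_finsetSum Finset.univ fun j _ => hj j
  rw [Finset.sum_const_zero] at this
  exact this

/-- The commutator estimate. Since `v` has a gradient in `L²` and `|∇κ|` has a bounded first moment,
`modulus m θ` tends to zero for every `θ` in `L²`, see `tendsto_modulus`. -/
lemma IsSobolevDivFree.abs_commutator_le {v : Fin 2 → T2 → ℝ} {D : Fin 2 → Fin 2 → T2 → ℝ}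
    (h : IsSobolevDivFree v D) {θ : T2 → ℝ} (hθ : MemLp θ 2 volume) {B : ℝ → ℝ}
    (hB : ContDiff ℝ ∞ B) (m : ℕ) {K : ℝ} (hK : ∀ x, |deriv B (mol m θ x)| ≤ K) :
    |∫ x, θ x * ∑ j, v j x * pd j (mol m (fun x => deriv B (mol m θ x))) x| ≤
      K * IsSobolevDivFree.gradNrm D * modulus m θ := by
  rw [h.integral_commutator hθ hB m]
  have hK0 : 0 ≤ K := (abs_nonneg _).trans (hK 0)
  refine (Finset.abs_sum_le_sum_abs _ _).trans ?_
  rw [modulus, Finset.mul_sum]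
  refine Finset.sum_le_sum fun j _ => ?_
  refine abs_integral_le_integral_abs.trans ?_
  rw [← integral_const_mul]
  refine integral_mono_of_nonneg (.of_forall fun _ => abs_nonneg _)
    ((integrable_modulus m j hθ).const_mul _) (.of_forall fun z => ?_)
  have m1 := memLp_dl hθ z
  have m2 := memLp_dl (h.memLp j) z
  have h1 : |∫ x, deriv B (mol m θ x) * (dl z θ x * dl z (v j) x)| ≤
      K * (nrm (dl z θ) * (sz z * IsSobolevDivFree.gradNrm D)) := by
    refine abs_integral_le_integral_abs.trans ?_
    calc _ ≤ ∫ x, K * |dl z θ x * dl z (v j) x| := by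
          refine integral_mono_of_nonneg (.of_forall fun _ => abs_nonneg _)
            ((integrable_mul_two m1 m2).abs.const_mul K) (.of_forall fun x => ?_)
          simp only
          rw [abs_mul]
          exact mul_le_mul_of_nonneg_right (hK x) (abs_nonneg _)
      _ ≤ _ := by
          rw [integral_const_mul]
          refine mul_le_mul_of_nonneg_left ((integral_abs_mul_le m1 m2).trans ?_) hK0
          exact mul_le_mul_of_nonneg_left (h.nrm_dl_le j z) (nrm_nonneg _)
  simp only [abs_mul]
  calc _ ≤ |pd j (ker m) z| * (K * (nrm (dl z θ) * (sz z * IsSobolevDivFree.gradNrm D))) :=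
        mul_le_mul_of_nonneg_left h1 (abs_nonneg _)
    _ = _ := by ring

/-! ### The momentum functional at a fixed time -/

/-- The right-hand side of the momentum equation at a fixed time, for the velocity `v`, the force
`F` and the test field `φ`. -/
noncomputable def gen (v F φ : Fin 2 → T2 → ℝ) : ℝ :=
  ∫ x, ((∑ i : Fin 2, v i x * lap (φ i) x) +
    (∑ i : Fin 2, ∑ j : Fin 2, v j x * v i x * pd j (φ i) x) + ∑ i : Fin 2, F i x * φ i x)

section gen

variable {v F φ : Fin 2 → T2 → ℝ}

lemma gen_split (hv : ∀ i, MemLp (v i) 2 volume) (hF : ∀ i, MemLp (F i) 2 volume)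
    (hφ : ∀ i, SmoothScalar (φ i)) :
    gen v F φ = (∑ i, ∫ x, v i x * lap (φ i) x) +
      (∑ i, ∫ x, ∑ j, v j x * (v i x * pd j (φ i) x)) + ∑ i, ∫ x, F i x * φ i x := by
  have i1 : ∀ i, Integrable (fun x => v i x * lap (φ i) x) volume := fun i =>
    integrable_mul_smooth (hφ i).lap (hv i).integrable_two
  have i2 : ∀ i j, Integrable (fun x => v j x * (v i x * pd j (φ i) x)) volume := fun i j =>
    integrable_mul_two (hv j) (memLp_mul_smooth (hv i) ((hφ i).pd j))
  have i3 : ∀ i, Integrable (fun x => F i x * φ i x) volume := fun i =>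
    integrable_mul_smooth (hφ i) (hF i).integrable_two
  have s1 : Integrable (fun x => ∑ i, v i x * lap (φ i) x) volume :=
    integrable_finsetSum _ fun i _ => i1 i
  have s2' : ∀ i, Integrable (fun x => ∑ j, v j x * (v i x * pd j (φ i) x)) volume := fun i =>
    integrable_finsetSum _ fun j _ => i2 i j
  have s2 : Integrable (fun x => ∑ i, ∑ j, v j x * (v i x * pd j (φ i) x)) volume :=
    integrable_finsetSum _ fun i _ => s2' i
  have s3 : Integrable (fun x => ∑ i, F i x * φ i x) volume :=
    integrable_finsetSum _ fun i _ => i3 i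
  have s12 : Integrable (fun x => (∑ i, v i x * lap (φ i) x) +
    ∑ i, ∑ j, v j x * (v i x * pd j (φ i) x)) volume := s1.add s2
  unfold gen
  simp_rw [mul_assoc]
  rw [integral_add s12 s3, integral_add s1 s2, integral_finsetSum _ fun i _ => i1 i,
    integral_finsetSum _ fun i _ => s2' i, integral_finsetSum _ fun i _ => i3 i]

lemma lap_sum_mul {ι : Type*} (s : Finset ι) (c : ι → ℝ) {ψ : ι → T2 → ℝ}
    (hψ : ∀ a, SmoothScalar (ψ a)) (x : T2) :
    lap (fun x => ∑ a ∈ s, c a * ψ a x) x = ∑ a ∈ s, c a * lap (ψ a) x := by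
  have h1 : ∀ j, pd j (fun x => ∑ a ∈ s, c a * ψ a x) = fun x => ∑ a ∈ s, c a * pd j (ψ a) x := by
    intro j; ext x
    rw [pd_sum fun a _ => (SmoothScalar.const _).mul (hψ a)]
    simp_rw [pd_const_mul (hψ _)]
  unfold lap
  simp_rw [h1]
  simp_rw [pd_sum fun a _ => (SmoothScalar.const _).mul ((hψ a).pd _), pd_const_mul ((hψ _).pd _),
    Finset.mul_sum]
  rw [Finset.sum_comm]

lemma gen_sum_mul {ι : Type*} (s : Finset ι) (c : ι → ℝ) {Φ : ι → Fin 2 → T2 → ℝ}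
    (hv : ∀ i, MemLp (v i) 2 volume) (hF : ∀ i, MemLp (F i) 2 volume)
    (hΦ : ∀ a i, SmoothScalar (Φ a i)) :
    gen v F (fun i x => ∑ a ∈ s, c a * Φ a i x) = ∑ a ∈ s, c a * gen v F (Φ a) := by
  have i1 : ∀ a i, Integrable (fun x => v i x * lap (Φ a i) x) volume := fun a i =>
    integrable_mul_smooth (hΦ a i).lap (hv i).integrable_two
  have i2 : ∀ a i j, Integrable (fun x => v j x * v i x * pd j (Φ a i) x) volume := fun a i j => by
    simpa only [mul_assoc] using
      integrable_mul_two (hv j) (memLp_mul_smooth (hv i) ((hΦ a i).pd j))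
  have i3 : ∀ a i, Integrable (fun x => F i x * Φ a i x) volume := fun a i =>
    integrable_mul_smooth (hΦ a i) (hF i).integrable_two
  have it : ∀ a, Integrable (fun x => (∑ i : Fin 2, v i x * lap (Φ a i) x) +
    (∑ i : Fin 2, ∑ j : Fin 2, v j x * v i x * pd j (Φ a i) x) + ∑ i : Fin 2, F i x * Φ a i x)
    volume := fun a => ((integrable_finsetSum _ fun i _ => i1 a i).add
      (integrable_finsetSum _ fun i _ => integrable_finsetSum _ fun j _ => i2 a i j)).add
      (integrable_finsetSum _ fun i _ => i3 a i)
  unfold gen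
  simp_rw [← integral_const_mul]
  rw [← integral_finsetSum _ fun a _ => (it a).const_mul (c a)]
  congr 1
  ext x
  simp_rw [lap_sum_mul s c (fun a => hΦ a _), pd_sum fun a _ => (SmoothScalar.const _).mul (hΦ a _),
    pd_const_mul (hΦ _ _), Finset.mul_sum, Fin.sum_univ_two, ← Finset.sum_add_distrib]
  refine Finset.sum_congr rfl fun a _ => ?_
  ring

/-- A constant controlling a test field in `C²`. -/
lemma exists_gen_bound (hφ : ∀ i, SmoothScalar (φ i)) : ∃ K : ℝ, 0 ≤ K ∧
    ∀ v F : Fin 2 → T2 → ℝ, (∀ i, MemLp (v i) 2 volume) → (∀ i, MemLp (F i) 2 volume) →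
      |gen v F φ| ≤ K * (∑ i, nrm (v i) + (∑ i, nrm (v i)) ^ 2 + ∑ i, nrm (F i)) := by
  choose A hA0 hA using fun i => (hφ i).lap.bounded
  choose B hB0 hB using fun i j => ((hφ i).pd j).bounded
  choose E hE0 hE using fun i => (hφ i).bounded
  refine ⟨(∑ i, A i) + (∑ i, ∑ j, B i j) + ∑ i, E i, add_nonneg (add_nonneg
    (Finset.sum_nonneg fun i _ => hA0 i) (Finset.sum_nonneg fun i _ => Finset.sum_nonneg fun j _ =>
    hB0 i j)) (Finset.sum_nonneg fun i _ => hE0 i), fun v F hv hF => ?_⟩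
  have key : ∀ {f ψ : T2 → ℝ} {K : ℝ}, Integrable f volume → (∀ x, |ψ x| ≤ K) →
      |∫ x, f x * ψ x| ≤ K * ∫ x, |f x| := by
    intro f ψ K hf hψ
    refine abs_integral_le_integral_abs.trans ?_
    rw [← integral_const_mul]
    refine integral_mono_of_nonneg (.of_forall fun _ => abs_nonneg _) (hf.abs.const_mul K)
      (.of_forall fun x => ?_)
    simp only [abs_mul]
    rw [mul_comm]
    exact mul_le_mul_of_nonneg_right (hψ x) (abs_nonneg _)
  have nv := fun i => nrm_nonneg (v i)
  have nF := fun i => nrm_nonneg (F i)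
  set S := ∑ i, nrm (v i) with hS
  set R := ∑ i, nrm (F i) with hR
  have hS0 : 0 ≤ S := Finset.sum_nonneg fun i _ => nv i
  have hR0 : 0 ≤ R := Finset.sum_nonneg fun i _ => nF i
  have hvS : ∀ i, nrm (v i) ≤ S := fun i =>
    Finset.single_le_sum (f := fun i => nrm (v i)) (fun i _ => nv i) (Finset.mem_univ i)
  have hFR : ∀ i, nrm (F i) ≤ R := fun i =>
    Finset.single_le_sum (f := fun i => nrm (F i)) (fun i _ => nF i) (Finset.mem_univ i)
  set T := S + S ^ 2 + R with hT
  have hST : S ≤ T := by have := sq_nonneg S; linarith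
  have hS2T : S ^ 2 ≤ T := by linarith
  have hRT : R ≤ T := by have := sq_nonneg S; linarith
  have b1 : |∑ i, ∫ x, v i x * lap (φ i) x| ≤ (∑ i, A i) * T := by
    refine (Finset.abs_sum_le_sum_abs _ _).trans ?_
    rw [Finset.sum_mul]
    refine Finset.sum_le_sum fun i _ => (key (hv i).integrable_two (hA i)).trans ?_
    exact mul_le_mul_of_nonneg_left
      ((integral_abs_le_nrm (hv i)).trans ((hvS i).trans hST)) (hA0 i)
  have b2 : |∑ i, ∫ x, ∑ j, v j x * (v i x * pd j (φ i) x)| ≤ (∑ i, ∑ j, B i j) * T := by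
    refine (Finset.abs_sum_le_sum_abs _ _).trans ?_
    rw [Finset.sum_mul]
    refine Finset.sum_le_sum fun i _ => ?_
    rw [integral_finsetSum _ fun j _ =>
      integrable_mul_two (hv j) (memLp_mul_smooth (hv i) ((hφ i).pd j)), Finset.sum_mul]
    refine (Finset.abs_sum_le_sum_abs _ _).trans (Finset.sum_le_sum fun j _ => ?_)
    simp_rw [← mul_assoc]
    refine (key (integrable_mul_two (hv j) (hv i)) (hB i j)).trans ?_
    refine mul_le_mul_of_nonneg_left ((integral_abs_mul_le (hv j) (hv i)).trans ?_) (hB0 i j)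
    refine le_trans ?_ hS2T
    rw [sq]
    exact mul_le_mul (hvS j) (hvS i) (nv i) hS0
  have b3 : |∑ i, ∫ x, F i x * φ i x| ≤ (∑ i, E i) * T := by
    refine (Finset.abs_sum_le_sum_abs _ _).trans ?_
    rw [Finset.sum_mul]
    refine Finset.sum_le_sum fun i _ => (key (hF i).integrable_two (hE i)).trans ?_
    exact mul_le_mul_of_nonneg_left
      ((integral_abs_le_nrm (hF i)).trans ((hFR i).trans hRT)) (hE0 i)
  rw [gen_split hv hF hφ]
  refine (abs_add_three _ _ _).trans ?_
  rw [add_mul, add_mul]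
  exact add_le_add (add_le_add b1 b2) b3

end gen

/-- The rotated gradient of a stream function. -/
noncomputable def curl (ψ : T2 → ℝ) (i : Fin 2) (x : T2) : ℝ :=
  if i = 0 then pd 1 ψ x else -pd 0 ψ x

lemma smooth_curl {ψ : T2 → ℝ} (hψ : SmoothScalar ψ) (i : Fin 2) : SmoothScalar (curl ψ i) := by
  unfold curl
  fin_cases i
  · exact hψ.pd 1
  · exact (hψ.pd 0).neg

lemma curl_zero (ψ : T2 → ℝ) : curl ψ 0 = pd 1 ψ := by ext x; simp [curl]

lemma curl_one (ψ : T2 → ℝ) : curl ψ 1 = fun x => -pd 0 ψ x := by ext x; simp [curl]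

lemma curl_div_free {ψ : T2 → ℝ} (hψ : SmoothScalar ψ) (x : T2) :
    ∑ i, pd i (curl ψ i) x = 0 := by
  rw [Fin.sum_univ_two, curl_zero, curl_one, pd_neg (hψ.pd 0), pd_comm hψ 0 1]
  ring

lemma lap_neg {ψ : T2 → ℝ} (hψ : SmoothScalar ψ) (x : T2) :
    lap (fun x => -ψ x) x = -lap ψ x := by
  unfold lap
  rw [← Finset.sum_neg_distrib]
  refine Finset.sum_congr rfl fun j _ => ?_
  rw [show pd j (fun x => -ψ x) = fun x => -pd j ψ x from funext (pd_neg hψ j),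
    pd_neg (hψ.pd j)]

lemma lap_pd {ψ : T2 → ℝ} (hψ : SmoothScalar ψ) (k : Fin 2) (x : T2) :
    lap (pd k ψ) x = pd k (lap ψ) x := by
  have : lap ψ = fun x => ∑ j, pd j (pd j ψ) x := rfl
  rw [this, pd_sum fun j _ => (hψ.pd j).pd j]
  refine Finset.sum_congr rfl fun j _ => ?_
  rw [show pd j (pd k ψ) = pd k (pd j ψ) from funext (pd_comm hψ j k), pd_comm (hψ.pd j)]

/-- The momentum functional on rotated gradients is the vorticity equation in weak form. -/
lemma IsSobolevDivFree.gen_curl {v F : Fin 2 → T2 → ℝ} {D : Fin 2 → Fin 2 → T2 → ℝ}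
    (h : IsSobolevDivFree v D) (hF : ∀ i, MemLp (F i) 2 volume) {ψ : T2 → ℝ}
    (hψ : SmoothScalar ψ) :
    gen v F (curl ψ) = (∫ x, vort D x * lap ψ x) + (∫ x, vort D x * ∑ j, v j x * pd j ψ x) +
      ((∫ x, F 0 x * pd 1 ψ x) - ∫ x, F 1 x * pd 0 ψ x) := by
  rw [gen_split h.memLp hF (smooth_curl hψ), ← h.integral_quadratic_curl hψ,
    h.integral_vort_mul hψ.lap, integral_sub (h.integrable_mul_pd hψ.lap 0 1)
      (h.integrable_mul_pd hψ.lap 1 0)]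
  simp only [Fin.sum_univ_two, curl_zero, curl_one, lap_neg (hψ.pd 0), lap_pd hψ,
    pd_neg (hψ.pd 0), mul_neg, integral_neg]
  simp only [← neg_add, integral_neg]
  ring

lemma integral_mul_lap_mol {θ g : T2 → ℝ} (hθ : MemLp θ 2 volume) (hg : SmoothScalar g) (m : ℕ) :
    ∫ x, θ x * lap (mol m g) x = -∑ j, ∫ x, pd j (mol m θ) x * pd j g x := by
  have sW := smooth_mol m hθ.integrable_two
  simp_rw [lap_mol m hg]
  rw [← integral_mol_mul m hθ.integrable_two hg.lap.integrable]
  simp only [lap, Finset.mul_sum]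
  rw [integral_finsetSum _ fun j _ => (sW.mul ((hg.pd j).pd j)).integrable,
    ← Finset.sum_neg_distrib]
  refine Finset.sum_congr rfl fun j _ => ?_
  rw [integral_pd_mul sW (hg.pd j), neg_neg]

lemma integral_mul_pd_mol {f g : T2 → ℝ} (hf : MemLp f 2 volume) (hg : SmoothScalar g) (m : ℕ)
    (j : Fin 2) : ∫ x, f x * pd j (mol m g) x = ∫ x, mol m f x * pd j g x := by
  rw [pd_mol m hg, integral_mol_mul m hf.integrable_two (hg.pd j).integrable]

/-- The evolution of `∫ β(κ * ω)` at a fixed time: dissipation, force, and a commutator that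
vanishes as `m → ∞`. -/
lemma IsSobolevDivFree.gen_curl_mol_le {v F : Fin 2 → T2 → ℝ} {D : Fin 2 → Fin 2 → T2 → ℝ}
    (h : IsSobolevDivFree v D) (hF : ∀ i, MemLp (F i) 2 volume) {β : ℝ → ℝ}
    (hβ : ContDiff ℝ ∞ β) (hconv : ∀ s, 0 ≤ deriv (deriv β) s) {N : ℝ}
    (hN : ∀ s, |deriv β s| ≤ N) (m : ℕ) :
    gen v F (curl (mol m (fun x => deriv β (mol m (vort D) x)))) ≤
      -(1 / 2) * (∑ j, ∫ x, deriv (deriv β) (mol m (vort D) x) * pd j (mol m (vort D)) x ^ 2) +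
      (1 / 2) * (∑ i, ∫ x, deriv (deriv β) (mol m (vort D) x) * mol m (F i) x ^ 2) +
      N * gradNrm D * modulus m (vort D) := by
  have hω := h.memLp_vort
  set W := mol m (vort D) with hW
  have sW : SmoothScalar W := smooth_mol m hω.integrable_two
  have hβ' : ContDiff ℝ ∞ (deriv β) := (contDiff_infty_iff_deriv.1 hβ).2
  have hβ'' : ContDiff ℝ ∞ (deriv (deriv β)) := (contDiff_infty_iff_deriv.1 hβ').2
  have sg : SmoothScalar (fun x => deriv β (W x)) := sW.comp hβ'
  have sb : SmoothScalar (fun x => deriv (deriv β) (W x)) := sW.comp hβ''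
  have sF := fun i => smooth_mol m (hF i).integrable_two
  rw [h.gen_curl hF (smooth_mol m sg.integrable), integral_mul_lap_mol hω sg,
    integral_mul_pd_mol (hF 0) sg, integral_mul_pd_mol (hF 1) sg]
  have hc := (le_abs_self _).trans (h.abs_commutator_le hω hβ m (K := N) fun x => hN _)
  rw [← hW] at hc ⊢
  simp_rw [pd_comp sW (hβ'.differentiable (by simp))]
  have hf : (∫ x, mol m (F 0) x * (deriv (deriv β) (W x) * pd 1 W x)) -
      (∫ x, mol m (F 1) x * (deriv (deriv β) (W x) * pd 0 W x)) ≤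
      (1 / 2) * (∑ j, ∫ x, deriv (deriv β) (W x) * pd j W x ^ 2) +
      (1 / 2) * (∑ i, ∫ x, deriv (deriv β) (W x) * mol m (F i) x ^ 2) := by
    have iP : ∀ j, Integrable (fun x => deriv (deriv β) (W x) * pd j W x ^ 2) volume := fun j =>
      (sb.mul ((sW.pd j).pow 2)).integrable
    have iF : ∀ i, Integrable (fun x => deriv (deriv β) (W x) * mol m (F i) x ^ 2) volume :=
      fun i => (sb.mul ((sF i).pow 2)).integrable
    have q0 : ∫ x, mol m (F 0) x * (deriv (deriv β) (W x) * pd 1 W x) ≤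
        ∫ x, ((1 / 2) * (deriv (deriv β) (W x) * pd 1 W x ^ 2) +
          (1 / 2) * (deriv (deriv β) (W x) * mol m (F 0) x ^ 2)) := by
      refine integral_mono ((sF 0).mul (sb.mul (sW.pd 1))).integrable
        (((iP 1).const_mul _).add ((iF 0).const_mul _)) fun x => ?_
      simp only
      nlinarith [mul_nonneg (hconv (W x)) (sq_nonneg (mol m (F 0) x - pd 1 W x))]
    have q1 : -∫ x, mol m (F 1) x * (deriv (deriv β) (W x) * pd 0 W x) ≤
        ∫ x, ((1 / 2) * (deriv (deriv β) (W x) * pd 0 W x ^ 2) +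
          (1 / 2) * (deriv (deriv β) (W x) * mol m (F 1) x ^ 2)) := by
      rw [← integral_neg]
      refine integral_mono ((sF 1).mul (sb.mul (sW.pd 0))).integrable.neg
        (((iP 0).const_mul _).add ((iF 1).const_mul _)) fun x => ?_
      simp only
      nlinarith [mul_nonneg (hconv (W x)) (sq_nonneg (mol m (F 1) x + pd 0 W x))]
    rw [integral_add ((iP _).const_mul _) ((iF _).const_mul _), integral_const_mul,
      integral_const_mul] at q0 q1
    simp only [Fin.sum_univ_two]
    linarith
  have hd : ∑ j, ∫ x, pd j W x * (deriv (deriv β) (W x) * pd j W x) =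
      ∑ j, ∫ x, deriv (deriv β) (W x) * pd j W x ^ 2 := by
    refine Finset.sum_congr rfl fun j _ => ?_
    congr 1; ext x; ring
  rw [hd]
  linarith

/-- The evolution of `∫ |κ * v|² / 2` at a fixed time. -/
lemma IsSobolevDivFree.gen_mol_mol_le {v F : Fin 2 → T2 → ℝ} {D : Fin 2 → Fin 2 → T2 → ℝ}
    (h : IsSobolevDivFree v D) (hF : ∀ i, MemLp (F i) 2 volume) (m : ℕ)
    {K : Fin 2 → ℝ} (hK : ∀ i x, |mol m (v i) x| ≤ K i) :
    gen v F (fun i => mol m (mol m (v i))) ≤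
      -(∑ i, ∑ j, nrm (mol m (D i j)) ^ 2) + (∑ i, nrm (F i) * nrm (v i)) +
      ∑ i, K i * gradNrm D * modulus m (v i) := by
  have sU := fun i => smooth_mol m (h.memLp i).integrable_two
  rw [gen_split h.memLp hF fun i => smooth_mol m (sU i).integrable]
  have e1 : ∀ i, ∫ x, v i x * lap (mol m (mol m (v i))) x = -∑ j, nrm (mol m (D i j)) ^ 2 := by
    intro i
    rw [integral_mul_lap_mol (h.memLp i) (sU i)]
    congr 1
    refine Finset.sum_congr rfl fun j _ => ?_
    rw [sq_nrm, show pd j (mol m (v i)) = mol m (D i j) from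
      funext (pd_mol_of_weak m (h.memLp i).integrable_two (h.weak i j))]
    simp_rw [sq]
  have hB : ContDiff ℝ ∞ (fun s : ℝ => s ^ 2 / 2) := by fun_prop
  have hdB : deriv (fun s : ℝ => s ^ 2 / 2) = fun s => s := by
    ext s; simp
  have e2 : ∀ i, ∫ x, ∑ j, v j x * (v i x * pd j (mol m (mol m (v i))) x) ≤
      K i * gradNrm D * modulus m (v i) := by
    intro i
    have := (le_abs_self _).trans (h.abs_commutator_le (h.memLp i) hB m
      (K := K i) fun x => by rw [hdB]; exact hK i x)
    simp only [hdB] at this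
    refine le_trans (le_of_eq ?_) this
    congr 1; ext x
    rw [Finset.mul_sum]
    refine Finset.sum_congr rfl fun j _ => ?_
    ring
  have e3 : ∀ i, ∫ x, F i x * mol m (mol m (v i)) x ≤ nrm (F i) * nrm (v i) := by
    intro i
    refine (le_abs_self _).trans ((abs_integral_mul_le (hF i)
      ((smooth_mol m (sU i).integrable).memLp 2)).trans ?_)
    exact mul_le_mul_of_nonneg_left ((nrm_mol_le m ((sU i).memLp 2)).trans
      (nrm_mol_le m (h.memLp i))) (nrm_nonneg _)
  simp_rw [e1, Finset.sum_neg_distrib]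
  have := Finset.sum_le_sum fun i (_ : i ∈ Finset.univ) => e2 i
  have := Finset.sum_le_sum fun i (_ : i ∈ Finset.univ) => e3 i
  linarith

/-! ### Helmholtz decomposition of Fourier modes -/

/-- The potential of the gradient part of the field `md a e_i`. For `k = 0` the junk value of the
division gives the right answer `0`. -/
noncomputable def potential (a : (Fin 2 → ℤ) × Bool) (i : Fin 2) (x : T2) : ℝ :=
  (a.1 i / (2 * Real.pi * ((a.1 0 : ℝ) ^ 2 + (a.1 1 : ℝ) ^ 2))) *
    (if a.2 then -mc a.1 x else ms a.1 x)

lemma smooth_potential (a : (Fin 2 → ℤ) × Bool) (i : Fin 2) : SmoothScalar (potential a i) := by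
  obtain ⟨k, b⟩ := a
  refine (SmoothScalar.const _).mul ?_
  cases b
  · simpa using smooth_ms k
  · simpa using (smooth_mc k).neg

lemma lap_potential (a : (Fin 2 → ℤ) × Bool) (i : Fin 2) (x : T2) :
    lap (potential a i) x = pd i (md a) x := by
  obtain ⟨k, b⟩ := a
  set c : ℝ := k i / (2 * Real.pi * ((k 0 : ℝ) ^ 2 + (k 1 : ℝ) ^ 2)) with hc
  have hck : c * (2 * Real.pi * ((k 0 : ℝ) ^ 2 + (k 1 : ℝ) ^ 2)) = k i := by
    by_cases h0 : (k 0 : ℝ) ^ 2 + (k 1 : ℝ) ^ 2 = 0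
    · have h1 : (k 0 : ℝ) = 0 := by nlinarith [sq_nonneg (k 0 : ℝ), sq_nonneg (k 1 : ℝ)]
      have h2 : (k 1 : ℝ) = 0 := by nlinarith [sq_nonneg (k 0 : ℝ), sq_nonneg (k 1 : ℝ)]
      rw [h0, mul_zero, mul_zero]
      fin_cases i
      · simp [h1]
      · simp [h2]
    · have := Real.pi_pos
      rw [hc]; field_simp
  cases b
  · have e : potential (k, false) i = fun x => c * ms k x := by ext x; simp [potential, hc]
    have h1 : ∀ j, pd j (fun x => c * ms k x) = fun x => (c * (2 * Real.pi * k j)) * mc k x := by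
      intro j; ext x; rw [pd_const_mul (smooth_ms k), pd_ms]; ring
    rw [e, lap]
    simp_rw [h1, pd_const_mul (smooth_mc k), pd_mc, Fin.sum_univ_two]
    rw [show md (k, false) = mc k by simp [md], pd_mc]
    linear_combination (-2 * Real.pi * ms k x) * hck
  · have e : potential (k, true) i = fun x => (-c) * mc k x := by ext x; simp [potential, hc]
    have h1 : ∀ j, pd j (fun x => (-c) * mc k x) = fun x => (c * (2 * Real.pi * k j)) * ms k x := by
      intro j; ext x; rw [pd_const_mul (smooth_mc k), pd_mc]; ring
    rw [e, lap]
    simp_rw [h1, pd_const_mul (smooth_ms k), pd_ms, Fin.sum_univ_two]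
    rw [show md (k, true) = ms k by simp [md], pd_ms]
    linear_combination (2 * Real.pi * mc k x) * hck

/-- The divergence-free part of the field `md a e_i`. -/
noncomputable def solenoidal (a : (Fin 2 → ℤ) × Bool) (i l : Fin 2) (x : T2) : ℝ :=
  (if l = i then md a x else 0) - pd l (potential a i) x

lemma smooth_solenoidal (a : (Fin 2 → ℤ) × Bool) (i l : Fin 2) :
    SmoothScalar (solenoidal a i l) := by
  refine SmoothScalar.sub ?_ ((smooth_potential a i).pd l)
  split
  · exact smooth_md a
  · exact SmoothScalar.const 0

lemma solenoidal_div_free (a : (Fin 2 → ℤ) × Bool) (i : Fin 2) (x : T2) :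
    ∑ l, pd l (solenoidal a i l) x = 0 := by
  have h : ∀ l, pd l (solenoidal a i l) x =
      (if l = i then pd l (md a) x else 0) - pd l (pd l (potential a i)) x := by
    intro l
    unfold solenoidal
    by_cases hl : l = i
    · simp only [hl, if_true]
      rw [pd_sub (smooth_md a) ((smooth_potential a i).pd i)]
    · simp only [hl, if_false]
      rw [pd_sub (SmoothScalar.const 0) ((smooth_potential a i).pd l), pd_const]
  simp_rw [h, Finset.sum_sub_distrib, Finset.sum_ite_eq' Finset.univ i]
  have := lap_potential a i x
  unfold lap at this
  rw [this]
  simp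

/-- The `L²` pairing of two vector fields. -/
noncomputable def pair (v φ : Fin 2 → T2 → ℝ) : ℝ := ∫ x, ∑ i, v i x * φ i x

lemma pair_solenoidal {v : Fin 2 → T2 → ℝ} (hv : ∀ i, MemLp (v i) 2 volume)
    (hdiv : ∀ ψ, SmoothScalar ψ → ∫ x, ∑ j, v j x * pd j ψ x = 0) (a : (Fin 2 → ℤ) × Bool)
    (i : Fin 2) : pair v (solenoidal a i) = ∫ x, md a x * v i x := by
  have h := hdiv _ (smooth_potential a i)
  have e : ∀ x, ∑ l, v l x * solenoidal a i l x =
      md a x * v i x - ∑ l, v l x * pd l (potential a i) x := by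
    intro x
    simp only [solenoidal, mul_sub, Finset.sum_sub_distrib, mul_ite, mul_zero,
      Finset.sum_ite_eq', Finset.mem_univ, if_true]
    ring
  unfold pair
  simp_rw [e]
  rw [integral_sub (integrable_smooth_mul (smooth_md a) (hv i).integrable_two)
    (integrable_finsetSum _ fun l _ => integrable_mul_smooth ((smooth_potential a i).pd l)
      (hv l).integrable_two), h, sub_zero]

lemma pd_eq_zero_of_lap_eq_zero {Z : T2 → ℝ} (hZ : SmoothScalar Z) (h : ∀ x, lap Z x = 0)
    (l : Fin 2) (x : T2) : pd l Z x = 0 := by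
  have h1 : ∫ x, ∑ j, pd j Z x ^ 2 = 0 := by
    have e : ∀ j, ∫ x, pd j Z x ^ 2 = -∫ x, Z x * pd j (pd j Z) x := fun j => by
      rw [← integral_pd_mul hZ (hZ.pd j)]
      simp_rw [sq]
    rw [integral_finsetSum _ fun j _ => ((hZ.pd j).pow 2).integrable]
    simp_rw [e, Finset.sum_neg_distrib]
    rw [← integral_finsetSum _ fun j _ => (hZ.mul ((hZ.pd j).pd j)).integrable]
    simp_rw [← Finset.mul_sum]
    have : ∀ x, ∑ j, pd j (pd j Z) x = 0 := h
    simp [this]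
  have hs : SmoothScalar fun x => ∑ j, pd j Z x ^ 2 := SmoothScalar.sum fun j _ => (hZ.pd j).pow 2
  have hae := (integral_eq_zero_iff_of_nonneg
    (fun x => Finset.sum_nonneg fun j _ => sq_nonneg _) hs.integrable).1 h1
  have h0 : (fun x => ∑ j, pd j Z x ^ 2) = 0 :=
    (Continuous.ae_eq_iff_eq volume hs.continuous continuous_const).1 hae
  have h2 := congrFun h0 x
  simp only [Pi.zero_apply] at h2
  have h3 := (Finset.sum_eq_zero_iff_of_nonneg fun j _ => sq_nonneg _).1 h2 l (Finset.mem_univ l)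
  simpa using h3

/-- The doubly mollified field as a combination of divergence-free modes. -/
lemma mol_mol_eq_sum_solenoidal {v : Fin 2 → T2 → ℝ} (hv : ∀ i, MemLp (v i) 2 volume)
    (hdiv : ∀ ψ, SmoothScalar ψ → ∫ x, ∑ j, v j x * pd j ψ x = 0) (m : ℕ) (l : Fin 2) (x : T2) :
    mol m (mol m (v l)) x = ∑ p ∈ (Finset.univ : Finset (Fin 2)) ×ˢ freq m,
      (fcoef m p.2 * ∫ y, md p.2 y * mol m (v p.1) y) * solenoidal p.2 p.1 l x := by
  have sU := fun i => smooth_mol m (hv i).integrable_two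
  set c : Fin 2 × ((Fin 2 → ℤ) × Bool) → ℝ :=
    fun p => fcoef m p.2 * ∫ y, md p.2 y * mol m (v p.1) y with hc
  set S := (Finset.univ : Finset (Fin 2)) ×ˢ freq m with hS
  let Z : T2 → ℝ := fun x => ∑ p ∈ S, c p * potential p.2 p.1 x
  have sZ : SmoothScalar Z :=
    SmoothScalar.sum fun p _ => (SmoothScalar.const _).mul (smooth_potential _ _)
  have hpdZ : ∀ l x, pd l Z x = ∑ p ∈ S, c p * pd l (potential p.2 p.1) x := by
    intro l x
    rw [pd_sum fun p _ => (SmoothScalar.const _).mul (smooth_potential _ _)]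
    simp_rw [pd_const_mul (smooth_potential _ _)]
  have hsum : ∀ l x, ∑ p ∈ S, c p * solenoidal p.2 p.1 l x = mol m (mol m (v l)) x - pd l Z x := by
    intro l x
    rw [hpdZ, mol_eq_sum m (sU l).integrable]
    simp only [solenoidal, mul_sub, Finset.sum_sub_distrib]
    congr 1
    rw [hS, Finset.sum_product]
    simp [hc]
  have hlap : ∀ x, lap Z x = 0 := by
    intro x
    have h1 : ∑ l, pd l (fun x => ∑ p ∈ S, c p * solenoidal p.2 p.1 l x) x = 0 := by
      simp_rw [pd_sum fun p _ => (SmoothScalar.const (c p)).mul (smooth_solenoidal p.2 p.1 _),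
        pd_const_mul (smooth_solenoidal _ _ _)]
      rw [Finset.sum_comm]
      simp_rw [← Finset.mul_sum, solenoidal_div_free, mul_zero, Finset.sum_const_zero]
    have h2 : ∑ l, pd l (mol m (mol m (v l))) x = 0 := by
      have hd := sum_pd_mol_eq_zero hv hdiv m
      simp_rw [pd_mol m (sU _)]
      have e : ∀ j, mol m (pd j (mol m (v j))) x = ∫ y, ker m (x - y) * pd j (mol m (v j)) y :=
        fun j => rfl
      simp_rw [e]
      rw [← integral_finsetSum _ fun j _ => ((smooth_ker_sub m x).mul ((sU j).pd j)).integrable]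
      simp_rw [← Finset.mul_sum, hd, mul_zero, integral_zero]
    have h3 : ∀ l, (fun x => ∑ p ∈ S, c p * solenoidal p.2 p.1 l x) =
        fun x => mol m (mol m (v l)) x - pd l Z x := fun l => funext (hsum l)
    simp_rw [h3, pd_sub (smooth_mol m (sU _).integrable) (sZ.pd _), Finset.sum_sub_distrib,
      h2] at h1
    unfold lap
    linarith
  rw [hsum, pd_eq_zero_of_lap_eq_zero sZ hlap, sub_zero]

lemma curl_sum_mul {ι : Type*} (s : Finset ι) (c : ι → ℝ) {ψ : ι → T2 → ℝ}
    (hψ : ∀ a, SmoothScalar (ψ a)) :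
    curl (fun x => ∑ a ∈ s, c a * ψ a x) = fun i x => ∑ a ∈ s, c a * curl (ψ a) i x := by
  have h1 : ∀ j x, pd j (fun x => ∑ a ∈ s, c a * ψ a x) x = ∑ a ∈ s, c a * pd j (ψ a) x := by
    intro j x
    rw [pd_sum fun a _ => (SmoothScalar.const _).mul (hψ a)]
    simp_rw [pd_const_mul (hψ _)]
  ext i x
  unfold curl
  by_cases hi : i = 0
  · simp [hi, h1]
  · simp [hi, h1]

/-! ### The chain rule along finite-dimensional evolutions -/

/-- If the coefficients `A a` of a finite combination of smooth functions are Lipschitz in time with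
derivatives `g a`, then `∫ β(∑ A a P a)` satisfies the fundamental theorem of calculus. -/
lemma integral_comp_sub_eq {ι : Type*} (S : Finset ι) {P : ι → T2 → ℝ}
    (hP : ∀ i, SmoothScalar (P i)) {A g : ι → ℝ → ℝ} {a b : ℝ} (hab : a ≤ b)
    (hg : ∀ i, IntervalIntegrable (g i) volume a b)
    (hA : ∀ i, ∀ t ∈ Icc a b, A i t = A i a + ∫ s in a..t, g i s)
    {K : ι → ℝ} (hK : ∀ i, 0 ≤ K i)
    (hlip : ∀ i, ∀ s ∈ Icc a b, ∀ t ∈ Icc a b, |A i t - A i s| ≤ K i * |t - s|)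
    {β : ℝ → ℝ} (hβ : ContDiff ℝ ∞ β) :
    IntervalIntegrable (fun t => ∑ i ∈ S, g i t *
      ∫ x, deriv β (∑ j ∈ S, A j t * P j x) * P i x) volume a b ∧
    (∫ x, β (∑ i ∈ S, A i b * P i x)) - ∫ x, β (∑ i ∈ S, A i a * P i x) =
      ∫ t in a..b, ∑ i ∈ S, g i t * ∫ x, deriv β (∑ j ∈ S, A j t * P j x) * P i x := by
  rcases hab.eq_or_lt with rfl | hlt
  · simp
  choose M hM0 hM using fun i => (hP i).bounded
  set X : ℝ → T2 → ℝ := fun t x => ∑ i ∈ S, A i t * P i x with hX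
  have sX : ∀ t, SmoothScalar (X t) := fun t =>
    SmoothScalar.sum fun i _ => (SmoothScalar.const _).mul (hP i)
  set L : ℝ := ∑ i ∈ S, K i * M i with hL
  have hL0 : 0 ≤ L := Finset.sum_nonneg fun i _ => mul_nonneg (hK i) (hM0 i)
  have hXlip : ∀ s ∈ Icc a b, ∀ t ∈ Icc a b, ∀ x, |X t x - X s x| ≤ L * |t - s| := by
    intro s hs t ht x
    simp only [hX, ← Finset.sum_sub_distrib, ← sub_mul]
    refine (Finset.abs_sum_le_sum_abs _ _).trans ?_
    rw [hL, Finset.sum_mul]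
    refine Finset.sum_le_sum fun i _ => ?_
    rw [abs_mul]
    calc _ ≤ (K i * |t - s|) * M i := mul_le_mul (hlip i s hs t ht) (hM i x) (abs_nonneg _)
          ((abs_nonneg _).trans (hlip i s hs t ht))
      _ = _ := by ring
  obtain ⟨R0, hR00, hR0⟩ := (sX a).bounded
  set R := R0 + L * (b - a) with hR
  have hXR : ∀ t ∈ Icc a b, ∀ x, X t x ∈ Icc (-R) R := by
    intro t ht x
    refine abs_le.1 ?_
    have h1 := hXlip a (left_mem_Icc.2 hlt.le) t ht x
    have h2 : |t - a| ≤ b - a := by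
      rw [abs_of_nonneg (sub_nonneg.2 ht.1)]; linarith [ht.2]
    have h3 := mul_le_mul_of_nonneg_left h2 hL0
    have h4 := hR0 x
    have h5 : |X t x| ≤ |X t x - X a x| + |X a x| := by
      have := abs_add_le (X t x - X a x) (X a x)
      simpa using this
    linarith
  have hβd : Differentiable ℝ β := hβ.differentiable (by simp)
  have hβ' : Continuous (deriv β) := (contDiff_infty_iff_deriv.1 hβ).2.continuous
  obtain ⟨Q, hQ⟩ := (isCompact_Icc (a := -R) (b := R)).exists_bound_of_continuousOn
    hβ'.continuousOn
  have hβlip : ∀ p ∈ Icc (-R) R, ∀ q ∈ Icc (-R) R, |β q - β p| ≤ Q * |q - p| := by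
    intro p hp q hq
    exact (convex_Icc (-R) R).norm_image_sub_le_of_norm_deriv_le (fun z _ => hβd z) hQ hp hq
  have hQ0 : 0 ≤ Q := by
    have hR' : (0 : ℝ) ≤ R := by
      have := mul_nonneg hL0 (sub_pos.2 hlt).le
      linarith
    exact (norm_nonneg _).trans (hQ 0 ⟨by linarith, hR'⟩)
  have hcomp : ∀ s ∈ Icc a b, ∀ t ∈ Icc a b, ∀ x, |β (X t x) - β (X s x)| ≤ Q * L * |t - s| := by
    intro s hs t ht x
    refine (hβlip _ (hXR s hs x) _ (hXR t ht x)).trans ?_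
    rw [mul_assoc]
    exact mul_le_mul_of_nonneg_left (hXlip s hs t ht x) hQ0
  set Φ : ℝ → ℝ := fun t => ∫ x, β (X t x) with hΦ
  have sβ : ∀ t, SmoothScalar fun x => β (X t x) := fun t => (sX t).comp hβ
  have hac : AbsolutelyContinuousOnInterval Φ a b := by
    refine LipschitzOnWith.absolutelyContinuousOnInterval (K := (Q * L).toNNReal) ?_
    rw [uIcc_of_le hlt.le]
    refine LipschitzOnWith.of_dist_le_mul fun s hs t ht => ?_
    rw [Real.coe_toNNReal _ (mul_nonneg hQ0 hL0), Real.dist_eq, Real.dist_eq]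
    simp only [hΦ]
    rw [← integral_sub (sβ s).integrable (sβ t).integrable]
    refine (norm_integral_le_of_norm_le_const (μ := (volume : Measure T2))
      (f := fun x => β (X s x) - β (X t x)) (C := Q * L * |s - t|) (.of_forall fun x =>
      hcomp t ht s hs x)).trans (le_of_eq ?_)
    simp
  have hder : ∀ᵐ t, t ∈ Ioo a b →
      deriv Φ t = ∑ i ∈ S, g i t * ∫ x, deriv β (X t x) * P i x := by
    have h1 : ∀ᵐ t, ∀ i ∈ S, t ∈ uIcc a b → ∀ c ∈ uIcc a b,
        HasDerivAt (fun x => ∫ s in c..x, g i s) (g i t) t :=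
      (Finset.eventually_all S).2 fun i _ => (hg i).ae_hasDerivAt_integral
    filter_upwards [h1] with t ht htab
    have hmem : t ∈ uIcc a b := by rw [uIcc_of_le hlt.le]; exact Ioo_subset_Icc_self htab
    have hnhds : Ioo a b ∈ nhds t := Ioo_mem_nhds htab.1 htab.2
    have hAd : ∀ i ∈ S, HasDerivAt (A i) (g i t) t := by
      intro i hi
      have h2 := (ht i hi hmem a left_mem_uIcc).const_add (A i a)
      refine h2.congr_of_eventuallyEq ?_
      filter_upwards [hnhds] with r hr
      exact hA i r (Ioo_subset_Icc_self hr)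
    have hXd : ∀ x, HasDerivAt (fun r => X r x) (∑ i ∈ S, g i t * P i x) t := fun x =>
      HasDerivAt.fun_sum fun i hi => (hAd i hi).mul_const _
    have h3 := (hasDerivAt_integral_of_dominated_loc_of_lip
      (F := fun r x => β (X r x)) (F' := fun x => deriv β (X t x) * ∑ i ∈ S, g i t * P i x)
      (μ := (volume : Measure T2)) (x₀ := t) (bound := fun _ => Q * L) hnhds
      (.of_forall fun r => (sβ r).continuous.aestronglyMeasurable) (sβ t).integrable
      ((hβ'.comp (sX t).continuous).mul (SmoothScalar.sum fun i _ =>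
        (SmoothScalar.const (g i t)).mul (hP i)).continuous).aestronglyMeasurable
      (.of_forall fun x => by
        refine LipschitzOnWith.of_dist_le_mul fun r hr q hq => ?_
        rw [Real.coe_nnabs, abs_of_nonneg (mul_nonneg hQ0 hL0), Real.dist_eq, Real.dist_eq]
        exact hcomp q (Ioo_subset_Icc_self hq) r (Ioo_subset_Icc_self hr) x)
      (integrable_const _)
      (.of_forall fun x => (hβd (X t x)).hasDerivAt.comp t (hXd x))).2
    rw [h3.deriv]
    simp_rw [Finset.mul_sum]
    have ii : ∀ i ∈ S, Integrable (fun x => deriv β (X t x) * (g i t * P i x)) volume := fun i _ =>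
      (((sX t).comp (contDiff_infty_iff_deriv.1 hβ).2).mul
        ((SmoothScalar.const _).mul (hP i))).integrable
    rw [integral_finsetSum _ ii]
    refine Finset.sum_congr rfl fun i _ => ?_
    rw [← integral_const_mul]
    congr 1; ext x; ring
  have hb : ∀ᵐ t : ℝ, t ≠ b := by simp [ae_iff]
  have hder' : ∀ᵐ t, t ∈ uIoc a b →
      deriv Φ t = ∑ i ∈ S, g i t * ∫ x, deriv β (X t x) * P i x := by
    filter_upwards [hder, hb] with t ht htb hmem
    rw [uIoc_of_le hlt.le] at hmem
    exact ht ⟨hmem.1, lt_of_le_of_ne hmem.2 htb⟩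
  refine ⟨hac.intervalIntegrable_deriv.congr_ae
    ((ae_restrict_iff' measurableSet_uIoc).2 hder'), ?_⟩
  rw [show (∫ x, β (∑ i ∈ S, A i b * P i x)) - ∫ x, β (∑ i ∈ S, A i a * P i x) = Φ b - Φ a from rfl,
    ← hac.integral_deriv_eq_sub]
  exact intervalIntegral.integral_congr_ae hder'

/-! ### Weak solutions in components -/

/-- A weak solution `u` of the Navier-Stokes system with force `f`, in components: `D t i j` is the
weak derivative `∂_j u_i` at time `t`, and `F` bounds `f` in `L^∞(L^8)`. -/
structure IsFlow (F : ℝ) (u f : ℝ → Fin 2 → T2 → ℝ) (D : ℝ → Fin 2 → Fin 2 → T2 → ℝ) : Prop where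
  meas : ∀ i, AEStronglyMeasurable (fun z : ℝ × T2 => u z.1 i z.2)
    ((volume.restrict (Ici (0 : ℝ))).prod (volume : Measure T2))
  meas_force : ∀ i, AEStronglyMeasurable (fun z : ℝ × T2 => f z.1 i z.2)
    ((volume.restrict (Ici (0 : ℝ))).prod (volume : Measure T2))
  memLp_grad : ∀ i j T, MemLp (fun z : ℝ × T2 => D z.1 i j z.2) 2
    ((volume.restrict (Icc (0 : ℝ) T)).prod (volume : Measure T2))
  memLp : ∀ t, 0 ≤ t → ∀ i, MemLp (u t i) 2 volume
  bounded : ∀ T, ∃ K, ∀ t ∈ Icc 0 T, ∀ i, nrm (u t i) ≤ K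
  sobolev : ∀ᵐ t ∂(volume.restrict (Ici (0 : ℝ))), IsSobolevDivFree (u t) (D t)
  div_free : ∀ t, 0 ≤ t → ∀ ψ, SmoothScalar ψ → ∫ x, ∑ j, u t j x * pd j ψ x = 0
  mean_zero : ∀ t, 0 ≤ t → ∀ i, ∫ x, u t i x = 0
  nonneg : 0 ≤ F
  force : ∀ᵐ t ∂(volume.restrict (Ici (0 : ℝ))), ∀ i,
    MemLp (f t i) 8 volume ∧ ∫ x, f t i x ^ 8 ≤ F ^ 8
  momentum : ∀ φ : Fin 2 → T2 → ℝ, (∀ i, SmoothScalar (φ i)) → (∀ x, ∑ i, pd i (φ i) x = 0) →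
    ∀ t, 0 ≤ t → pair (u t) φ = pair (u 0) φ + ∫ r in (0 : ℝ)..t, gen (u r) (f r) φ

lemma sq_integral_le {g : T2 → ℝ} (hg : MemLp g 2 volume) : (∫ x, g x) ^ 2 ≤ ∫ x, g x ^ 2 := by
  rw [← sq_nrm, sq_le_sq, abs_of_nonneg (nrm_nonneg g)]
  exact abs_integral_le_integral_abs.trans (integral_abs_le_nrm hg)

lemma memLp_sq {g : T2 → ℝ} {p q : ℝ≥0∞} (hpq : p = 2 * q) (hg : MemLp g p volume) :
    MemLp (fun x => g x ^ 2) q volume := by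
  have : ENNReal.HolderTriple p p q := ⟨by
    rw [hpq, ENNReal.mul_inv (by simp) (by simp), ← add_mul, ENNReal.inv_two_add_inv_two, one_mul]⟩
  have h := hg.mul hg (r := q)
  refine (memLp_congr_ae (.of_forall fun x => ?_)).1 h
  simp [sq]

lemma nrm_le_of_integral_pow_eight_le {g : T2 → ℝ} {F : ℝ} (hF : 0 ≤ F) (hg : MemLp g 8 volume)
    (h : ∫ x, g x ^ 8 ≤ F ^ 8) : nrm g ≤ F := by
  have m4 : MemLp (fun x => g x ^ 2) 4 volume := memLp_sq (by norm_num) hg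
  have m2 : MemLp (fun x => (g x ^ 2) ^ 2) 2 volume := memLp_sq (by norm_num) m4
  have h1 := sq_integral_le (m4.mono_exponent (p := 2) (by norm_num))
  have h2 := sq_integral_le m2
  have h3 : ∫ x, ((g x ^ 2) ^ 2) ^ 2 = ∫ x, g x ^ 8 := by
    congr 1; ext x; ring
  have h0 := nrm_nonneg g
  have h5 : nrm g ^ 8 ≤ F ^ 8 := by
    calc nrm g ^ 8 = ((∫ x, g x ^ 2) ^ 2) ^ 2 := by rw [← sq_nrm]; ring
      _ ≤ (∫ x, (g x ^ 2) ^ 2) ^ 2 := pow_le_pow_left₀ (sq_nonneg _) h1 2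
      _ ≤ ∫ x, g x ^ 8 := h2.trans h3.le
      _ ≤ F ^ 8 := h
  exact le_of_pow_le_pow_left₀ (by norm_num) hF h5

/-- The time-space measure on `(s, t) × 𝕋²`. -/
noncomputable abbrev slab (s t : ℝ) : Measure (ℝ × T2) :=
  (volume.restrict (Ioc s t)).prod (volume : Measure T2)

namespace IsFlow

variable {F : ℝ} {u f : ℝ → Fin 2 → T2 → ℝ} {D : ℝ → Fin 2 → Fin 2 → T2 → ℝ}

lemma ae_Ioc {p : ℝ → Prop} (h : ∀ᵐ t ∂(volume.restrict (Ici (0 : ℝ))), p t) {s : ℝ} (hs : 0 ≤ s)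
    (t : ℝ) : ∀ᵐ r ∂(volume.restrict (Ioc s t)), p r :=
  ae_mono (Measure.restrict_mono (fun _ hr => hs.trans hr.1.le) le_rfl) h

lemma slab_le {s : ℝ} (hs : 0 ≤ s) (t : ℝ) :
    slab s t ≤ (volume.restrict (Ici (0 : ℝ))).prod (volume : Measure T2) :=
  Measure.prod_mono (Measure.restrict_mono (fun _ hr => hs.trans hr.1.le) le_rfl) le_rfl

lemma nrm_force (h : IsFlow F u f D) : ∀ᵐ t ∂(volume.restrict (Ici (0 : ℝ))), ∀ i,
    MemLp (f t i) 2 volume ∧ nrm (f t i) ≤ F := by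
  filter_upwards [h.force] with t ht i
  exact ⟨(ht i).1.mono_exponent (by norm_num),
    nrm_le_of_integral_pow_eight_le h.nonneg (ht i).1 (ht i).2⟩

lemma aesm_gen (h : IsFlow F u f D) {s : ℝ} (hs : 0 ≤ s) (t : ℝ) {φ : Fin 2 → T2 → ℝ}
    (hφ : ∀ i, SmoothScalar (φ i)) :
    AEStronglyMeasurable (fun r => gen (u r) (f r) φ) (volume.restrict (Ioc s t)) := by
  have mu := fun i => (h.meas i).mono_measure (slab_le hs t)
  have mf := fun i => (h.meas_force i).mono_measure (slab_le hs t)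
  have ms : ∀ {ψ : T2 → ℝ}, SmoothScalar ψ →
      AEStronglyMeasurable (fun z : ℝ × T2 => ψ z.2) (slab s t) := fun hψ =>
    (hψ.continuous.comp continuous_snd).aestronglyMeasurable
  refine AEStronglyMeasurable.integral_prod_right' (μ := volume.restrict (Ioc s t))
    (ν := (volume : Measure T2)) (f := fun z : ℝ × T2 =>
    (∑ i, u z.1 i z.2 * lap (φ i) z.2) +
    (∑ i, ∑ j, u z.1 j z.2 * u z.1 i z.2 * pd j (φ i) z.2) + ∑ i, f z.1 i z.2 * φ i z.2) ?_
  simp only [Fin.sum_univ_two]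
  exact ((((mu 0).mul (ms (hφ 0).lap)).add ((mu 1).mul (ms (hφ 1).lap))).add
    (((((mu 0).mul (mu 0)).mul (ms ((hφ 0).pd 0))).add
      (((mu 1).mul (mu 0)).mul (ms ((hφ 0).pd 1)))).add
      ((((mu 0).mul (mu 1)).mul (ms ((hφ 1).pd 0))).add
      (((mu 1).mul (mu 1)).mul (ms ((hφ 1).pd 1)))))).add
    (((mf 0).mul (ms (hφ 0))).add ((mf 1).mul (ms (hφ 1))))

lemma exists_gen_le (h : IsFlow F u f D) (T : ℝ) {φ : Fin 2 → T2 → ℝ} (hφ : ∀ i, SmoothScalar (φ i)) :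
    ∃ L : ℝ, 0 ≤ L ∧ ∀ s t, 0 ≤ s → t ≤ T →
      ∀ᵐ r ∂(volume.restrict (Ioc s t)), ‖gen (u r) (f r) φ‖ ≤ L := by
  obtain ⟨K, hK0, hK⟩ := exists_gen_bound hφ
  obtain ⟨B, hB⟩ := h.bounded T
  refine ⟨K * (2 * |B| + (2 * |B|) ^ 2 + 2 * F), by have := h.nonneg; positivity,
    fun s t hs ht => ?_⟩
  filter_upwards [ae_Ioc h.nrm_force hs t, ae_restrict_mem measurableSet_Ioc] with r hf hr
  have hr0 : 0 ≤ r := hs.trans hr.1.le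
  refine (hK (u r) (f r) (h.memLp r hr0) fun i => (hf i).1).trans
    (mul_le_mul_of_nonneg_left ?_ hK0)
  have hb := fun i => (hB r ⟨hr0, hr.2.trans ht⟩ i).trans (le_abs_self B)
  have n := fun i => nrm_nonneg (u r i)
  simp only [Fin.sum_univ_two]
  have h1 : nrm (u r 0) + nrm (u r 1) ≤ 2 * |B| := by linarith [hb 0, hb 1]
  have h2 := pow_le_pow_left₀ (add_nonneg (n 0) (n 1)) h1 2
  linarith [(hf 0).2, (hf 1).2]

lemma intervalIntegrable_gen (h : IsFlow F u f D) {s t : ℝ} (hs : 0 ≤ s) (hst : s ≤ t) {φ : Fin 2 → T2 → ℝ}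
    (hφ : ∀ i, SmoothScalar (φ i)) :
    IntervalIntegrable (fun r => gen (u r) (f r) φ) volume s t := by
  obtain ⟨L, -, hL⟩ := h.exists_gen_le t hφ
  rw [intervalIntegrable_iff_integrableOn_Ioc_of_le hst]
  exact (integrable_const L).mono' (h.aesm_gen hs t hφ) (hL s t hs le_rfl)

lemma pair_eq (h : IsFlow F u f D) {s t : ℝ} (hs : 0 ≤ s) (hst : s ≤ t) {φ : Fin 2 → T2 → ℝ}
    (hφ : ∀ i, SmoothScalar (φ i)) (hdiv : ∀ x, ∑ i, pd i (φ i) x = 0) :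
    pair (u t) φ = pair (u s) φ + ∫ r in s..t, gen (u r) (f r) φ := by
  rw [h.momentum φ hφ hdiv t (hs.trans hst), h.momentum φ hφ hdiv s hs, add_assoc,
    intervalIntegral.integral_add_adjacent_intervals (h.intervalIntegrable_gen le_rfl hs hφ)
      (h.intervalIntegrable_gen hs hst hφ)]

lemma exists_pair_lipschitz (h : IsFlow F u f D) (T : ℝ) {φ : Fin 2 → T2 → ℝ} (hφ : ∀ i, SmoothScalar (φ i))
    (hdiv : ∀ x, ∑ i, pd i (φ i) x = 0) :
    ∃ L : ℝ, 0 ≤ L ∧ ∀ s ∈ Icc 0 T, ∀ t ∈ Icc 0 T,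
      |pair (u t) φ - pair (u s) φ| ≤ L * |t - s| := by
  obtain ⟨L, hL0, hL⟩ := h.exists_gen_le T hφ
  have key : ∀ s ∈ Icc 0 T, ∀ t ∈ Icc 0 T, s ≤ t →
      |pair (u t) φ - pair (u s) φ| ≤ L * |t - s| := by
    intro s hs t ht hst
    rw [h.pair_eq hs.1 hst hφ hdiv, add_sub_cancel_left]
    refine intervalIntegral.norm_integral_le_of_norm_le_const_ae (C := L)
      (f := fun r => gen (u r) (f r) φ) ?_
    rw [uIoc_of_le hst]
    exact (ae_restrict_iff' measurableSet_Ioc).1 (hL s t hs.1 ht.2)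
  refine ⟨L, hL0, fun s hs t ht => ?_⟩
  rcases le_total s t with hst | hst
  · exact key s hs t ht hst
  · rw [abs_sub_comm, abs_sub_comm t s]; exact key t ht s hs hst

lemma continuousOn_pair (h : IsFlow F u f D) (T : ℝ) {φ : Fin 2 → T2 → ℝ} (hφ : ∀ i, SmoothScalar (φ i))
    (hdiv : ∀ x, ∑ i, pd i (φ i) x = 0) : ContinuousOn (fun t => pair (u t) φ) (Icc 0 T) := by
  obtain ⟨L, hL0, hL⟩ := h.exists_pair_lipschitz T hφ hdiv
  refine LipschitzOnWith.continuousOn (K := L.toNNReal)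
    (LipschitzOnWith.of_dist_le_mul fun s hs t ht => ?_)
  rw [Real.coe_toNNReal _ hL0, Real.dist_eq, Real.dist_eq]
  exact hL t ht s hs

/-- The chain rule along finitely many divergence-free test fields. -/
lemma integral_comp_evolution (h : IsFlow F u f D) {ι : Type*} (S : Finset ι) {P : ι → T2 → ℝ}
    (hP : ∀ a, SmoothScalar (P a)) {Φ : ι → Fin 2 → T2 → ℝ} (hΦ : ∀ a i, SmoothScalar (Φ a i))
    (hdiv : ∀ a x, ∑ i, pd i (Φ a i) x = 0) {β : ℝ → ℝ} (hβ : ContDiff ℝ ∞ β) {s t : ℝ}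
    (hs : 0 ≤ s) (hst : s ≤ t) :
    IntervalIntegrable (fun r => ∑ a ∈ S, gen (u r) (f r) (Φ a) *
      ∫ x, deriv β (∑ b ∈ S, pair (u r) (Φ b) * P b x) * P a x) volume s t ∧
    (∫ x, β (∑ a ∈ S, pair (u t) (Φ a) * P a x)) - ∫ x, β (∑ a ∈ S, pair (u s) (Φ a) * P a x) =
      ∫ r in s..t, ∑ a ∈ S, gen (u r) (f r) (Φ a) *
        ∫ x, deriv β (∑ b ∈ S, pair (u r) (Φ b) * P b x) * P a x := by
  choose L hL0 hL using fun a => h.exists_pair_lipschitz t (hΦ a) (hdiv a)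
  exact integral_comp_sub_eq S hP (A := fun a r => pair (u r) (Φ a)) hst
    (fun a => h.intervalIntegrable_gen hs hst (hΦ a))
    (fun a r hr => h.pair_eq hs hr.1 (hΦ a) (hdiv a)) hL0
    (fun a p hp q hq => hL a p ⟨hs.trans hp.1, hp.2⟩ q ⟨hs.trans hq.1, hq.2⟩) hβ

/-- The mollified vorticity, defined at every time through the velocity. -/
noncomputable def molVort (m : ℕ) (v : Fin 2 → T2 → ℝ) (x : T2) : ℝ :=
  ∑ a ∈ freq m, pair v (curl (md a)) * (fcoef m a * md a x)

lemma pair_curl_eq {v : Fin 2 → T2 → ℝ} {D : Fin 2 → Fin 2 → T2 → ℝ}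
    (hv : IsSobolevDivFree v D) {ψ : T2 → ℝ} (hψ : SmoothScalar ψ) :
    pair v (curl ψ) = ∫ x, IsSobolevDivFree.vort D x * ψ x := by
  rw [hv.integral_vort_mul hψ]
  unfold pair
  simp only [Fin.sum_univ_two, curl_zero, curl_one]
  congr 1; ext x; ring

lemma molVort_eq (m : ℕ) {v : Fin 2 → T2 → ℝ} {D : Fin 2 → Fin 2 → T2 → ℝ}
    (hv : IsSobolevDivFree v D) : molVort m v = mol m (IsSobolevDivFree.vort D) := by
  ext x
  rw [mol_eq_sum m hv.memLp_vort.integrable_two]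
  refine Finset.sum_congr rfl fun a _ => ?_
  rw [pair_curl_eq hv (smooth_md a)]
  simp_rw [mul_comm (IsSobolevDivFree.vort D _)]
  ring

lemma smooth_molVort (m : ℕ) (v : Fin 2 → T2 → ℝ) : SmoothScalar (molVort m v) :=
  SmoothScalar.sum fun a _ => (SmoothScalar.const _).mul ((SmoothScalar.const _).mul (smooth_md a))

lemma vorticity_evolution (h : IsFlow F u f D) (m : ℕ) {β : ℝ → ℝ} (hβ : ContDiff ℝ ∞ β) {s t : ℝ}
    (hs : 0 ≤ s) (hst : s ≤ t) :
    IntervalIntegrable (fun r => gen (u r) (f r)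
      (curl (mol m (fun x => deriv β (molVort m (u r) x))))) volume s t ∧
    (∫ x, β (molVort m (u t) x)) - ∫ x, β (molVort m (u s) x) =
      ∫ r in s..t, gen (u r) (f r) (curl (mol m (fun x => deriv β (molVort m (u r) x)))) := by
  have hβ' := (contDiff_infty_iff_deriv.1 hβ).2
  have hmain := h.integral_comp_evolution (freq m) (P := fun a x => fcoef m a * md a x)
    (fun a => (SmoothScalar.const _).mul (smooth_md a)) (Φ := fun a => curl (md a))
    (fun a => smooth_curl (smooth_md a)) (fun a => curl_div_free (smooth_md a)) hβ hs hst
  have e : ∀ᵐ r ∂(volume.restrict (Ioc s t)), ∑ a ∈ freq m, gen (u r) (f r) (curl (md a)) *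
      ∫ x, deriv β (molVort m (u r) x) * (fcoef m a * md a x) =
      gen (u r) (f r) (curl (mol m (fun x => deriv β (molVort m (u r) x)))) := by
    filter_upwards [ae_Ioc h.nrm_force hs t, ae_restrict_mem measurableSet_Ioc] with r hf hr
    have sg : SmoothScalar (fun x => deriv β (molVort m (u r) x)) := (smooth_molVort m _).comp hβ'
    rw [show mol m (fun x => deriv β (molVort m (u r) x)) = _ from
      funext (mol_eq_sum m sg.integrable), curl_sum_mul _ _ smooth_md,
      gen_sum_mul _ _ (h.memLp r (hs.trans hr.1.le)) (fun i => (hf i).1)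
        fun a i => smooth_curl (smooth_md a) i]
    refine Finset.sum_congr rfl fun a _ => ?_
    rw [mul_comm]
    congr 1
    rw [← integral_const_mul]
    congr 1; ext x; ring
  refine ⟨hmain.1.congr_ae ?_, hmain.2.trans (intervalIntegral.integral_congr_ae ?_)⟩
  · rw [uIoc_of_le hst]; exact e
  · rw [uIoc_of_le hst]; exact (ae_restrict_iff' measurableSet_Ioc).1 e

lemma mol_eq_sum_pair (h : IsFlow F u f D) (m : ℕ) {t : ℝ} (ht : 0 ≤ t) (i : Fin 2) (x : T2) :
    mol m (u t i) x = ∑ a ∈ freq m, pair (u t) (solenoidal a i) * (fcoef m a * md a x) := by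
  rw [mol_eq_sum m (h.memLp t ht i).integrable_two]
  refine Finset.sum_congr rfl fun a _ => ?_
  rw [pair_solenoidal (h.memLp t ht) (h.div_free t ht)]
  ring

lemma energy_evolution (h : IsFlow F u f D) (m : ℕ) {s t : ℝ} (hs : 0 ≤ s) (hst : s ≤ t) :
    IntervalIntegrable (fun r => gen (u r) (f r) (fun i => mol m (mol m (u r i)))) volume s t ∧
    (∑ i, nrm (mol m (u t i)) ^ 2 / 2) - ∑ i, nrm (mol m (u s i)) ^ 2 / 2 =
      ∫ r in s..t, gen (u r) (f r) (fun i => mol m (mol m (u r i))) := by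
  have hB : ContDiff ℝ ∞ (fun s : ℝ => s ^ 2 / 2) := by fun_prop
  have hdB : deriv (fun s : ℝ => s ^ 2 / 2) = fun s => s := by
    ext s; simp
  have hmain := fun i => h.integral_comp_evolution (freq m) (P := fun a x => fcoef m a * md a x)
    (fun a => (SmoothScalar.const _).mul (smooth_md a)) (Φ := fun a => solenoidal a i)
    (fun a => smooth_solenoidal a i) (fun a => solenoidal_div_free a i) hB hs hst
  simp only [hdB] at hmain
  have e : ∀ᵐ r ∂(volume.restrict (Ioc s t)),
      (∑ i, ∑ a ∈ freq m, gen (u r) (f r) (solenoidal a i) *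
        ∫ x, (∑ b ∈ freq m, pair (u r) (solenoidal b i) * (fcoef m b * md b x)) *
          (fcoef m a * md a x)) = gen (u r) (f r) (fun i => mol m (mol m (u r i))) := by
    filter_upwards [ae_Ioc h.nrm_force hs t, ae_restrict_mem measurableSet_Ioc] with r hf hr
    have hr0 := hs.trans hr.1.le
    rw [show (fun i => mol m (mol m (u r i))) = _ from funext fun l => funext fun x =>
      mol_mol_eq_sum_solenoidal (h.memLp r hr0) (h.div_free r hr0) m l x,
      gen_sum_mul (Φ := fun p : Fin 2 × ((Fin 2 → ℤ) × Bool) => solenoidal p.2 p.1) _ _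
        (h.memLp r hr0) (fun i => (hf i).1) fun p l => smooth_solenoidal p.2 p.1 l,
      Finset.sum_product]
    refine Finset.sum_congr rfl fun i _ => Finset.sum_congr rfl fun a _ => ?_
    simp_rw [← h.mol_eq_sum_pair m hr0]
    rw [mul_comm]
    congr 1
    rw [← integral_const_mul]
    congr 1; ext x; ring
  have hsum := IntervalIntegrable.sum Finset.univ fun i _ => (hmain i).1
  have hn : ∀ r, 0 ≤ r → ∀ i, nrm (mol m (u r i)) ^ 2 / 2 =
      ∫ x, (∑ a ∈ freq m, pair (u r) (solenoidal a i) * (fcoef m a * md a x)) ^ 2 / 2 := by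
    intro r hr i
    simp_rw [← h.mol_eq_sum_pair m hr, sq_nrm, integral_div]
  refine ⟨IntervalIntegrable.congr_ae hsum ?_, ?_⟩
  · rw [uIoc_of_le hst]
    filter_upwards [e] with r hr
    rw [← hr, Finset.sum_apply]
  · simp_rw [hn t (hs.trans hst), hn s hs]
    rw [← Finset.sum_sub_distrib, Finset.sum_congr rfl fun i _ => (hmain i).2,
      ← intervalIntegral.integral_finsetSum fun i _ => (hmain i).1]
    refine intervalIntegral.integral_congr_ae ?_
    rw [uIoc_of_le hst]; exact (ae_restrict_iff' measurableSet_Ioc).1 e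

end IsFlow

/-! ### The energy inequality and decay of the energy -/

/-- The mollification of an `L²` function is `o(√m)` uniformly, since smooth functions are dense. -/
lemma exists_abs_mol_le {g : T2 → ℝ} (hg : MemLp g 2 volume) : ∃ K : ℕ → ℝ,
    (∀ m x, |mol m g x| ≤ K m) ∧ (∀ m, K m ≤ √(8 * (m + 1)) * nrm g) ∧
    Filter.Tendsto (fun m : ℕ => K m * (1 / √(m + 1))) Filter.atTop (nhds 0) := by
  have sm := fun m => smooth_mol m hg.integrable_two
  have hbdd : ∀ m, BddAbove (range fun x => |mol m g x|) := fun m =>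
    ⟨√(8 * (m + 1)) * nrm g, by rintro _ ⟨x, rfl⟩; exact abs_mol_le_nrm m hg x⟩
  have hK : ∀ m x, |mol m g x| ≤ ⨆ x, |mol m g x| := fun m x => le_ciSup (hbdd m) x
  refine ⟨fun m => ⨆ x, |mol m g x|, hK, fun m => ciSup_le fun x => abs_mol_le_nrm m hg x, ?_⟩
  refine Metric.tendsto_nhds.2 fun ε hε => ?_
  obtain ⟨k, hk⟩ := ((Metric.tendsto_nhds.1 (tendsto_nrm_mol_sub hg)) (ε / 8) (by positivity)).exists
  rw [Real.dist_eq, sub_zero, abs_of_nonneg (nrm_nonneg _)] at hk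
  obtain ⟨B, hB0, hB⟩ := (sm k).bounded
  have h0 := tendsto_inv_sqrt.const_mul B
  rw [mul_zero] at h0
  filter_upwards [(Metric.tendsto_nhds.1 h0) (ε / 2) (by positivity)] with m hm
  have hs : 0 < √((m : ℝ) + 1) := Real.sqrt_pos.2 (by positivity)
  rw [Real.dist_eq, sub_zero, abs_of_nonneg (by positivity)] at hm
  have h1 : (⨆ x, |mol m g x|) ≤ √(8 * (m + 1)) * (ε / 8) + B := by
    refine ciSup_le fun x => ?_
    have hd : mol m g x = mol m (fun x => g x - mol k g x) x + mol m (mol k g) x := by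
      have i1 := integrable_smooth_mul (smooth_ker_sub m x) hg.integrable_two
      have i2 := integrable_smooth_mul (smooth_ker_sub m x) (sm k).integrable
      unfold mol at i2 ⊢
      simp_rw [mul_sub]
      rw [integral_sub i1 i2, sub_add_cancel]
    rw [hd]
    refine (abs_add_le _ _).trans (add_le_add ?_ (abs_mol_le_of_bound m hB x))
    refine (abs_mol_le_nrm m (hg.sub ((sm k).memLp 2)) x).trans
      (mul_le_mul_of_nonneg_left ?_ (Real.sqrt_nonneg _))
    rw [nrm_sub_comm] at hk
    exact hk.le
  have h2 : √(8 * ((m : ℝ) + 1)) ≤ 3 * √((m : ℝ) + 1) := by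
    refine Real.sqrt_le_iff.2 ⟨by positivity, ?_⟩
    rw [mul_pow, Real.sq_sqrt (by positivity)]
    nlinarith [Nat.cast_nonneg (α := ℝ) m]
  have h3 : 0 ≤ ⨆ x, |mol m g x| := (abs_nonneg _).trans (hK m 0)
  rw [Real.dist_eq, sub_zero, abs_of_nonneg (by positivity)]
  calc (⨆ x, |mol m g x|) * (1 / √((m : ℝ) + 1))
      ≤ (3 * √((m : ℝ) + 1) * (ε / 8) + B) * (1 / √((m : ℝ) + 1)) := by
        refine mul_le_mul_of_nonneg_right (h1.trans ?_) (by positivity)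
        have := mul_le_mul_of_nonneg_right h2 (by positivity : 0 ≤ ε / 8)
        linarith
    _ = 3 * (ε / 8) + B * (1 / √((m : ℝ) + 1)) := by field_simp
    _ < ε := by linarith

/-- A one-sided dominated convergence theorem. -/
lemma tendsto_integral_max_sub {α : Type*} [MeasurableSpace α] {μ : Measure α}
    {g e : ℕ → α → ℝ} {k b : α → ℝ} (hg : ∀ m, AEStronglyMeasurable (g m) μ)
    (hk : AEStronglyMeasurable k μ) (hb : Integrable b μ)
    (hle : ∀ᵐ r ∂μ, ∀ m, g m r ≤ k r + e m r ∧ 0 ≤ e m r ∧ e m r ≤ b r)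
    (he : ∀ᵐ r ∂μ, Filter.Tendsto (fun m => e m r) Filter.atTop (nhds 0)) :
    (∀ m, Integrable (fun r => max (g m r - k r) 0) μ) ∧
      Filter.Tendsto (fun m => ∫ r, max (g m r - k r) 0 ∂μ) Filter.atTop (nhds 0) := by
  have h0 : ∀ᵐ r ∂μ, ∀ m, 0 ≤ max (g m r - k r) 0 ∧ max (g m r - k r) 0 ≤ e m r := by
    filter_upwards [hle] with r hr m
    exact ⟨le_max_right _ _, max_le (by linarith [(hr m).1]) (hr m).2.1⟩
  have hmeas : ∀ m, AEStronglyMeasurable (fun r => max (g m r - k r) 0) μ := fun m =>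
    ((hg m).sub hk).sup aestronglyMeasurable_const
  have hdom : ∀ m, ∀ᵐ r ∂μ, ‖max (g m r - k r) 0‖ ≤ b r := fun m => by
    filter_upwards [h0, hle] with r h1 h2
    rw [Real.norm_eq_abs, abs_of_nonneg (h1 m).1]
    exact (h1 m).2.trans (h2 m).2.2
  refine ⟨fun m => hb.mono' (hmeas m) (hdom m), ?_⟩
  have h := tendsto_integral_of_dominated_convergence (F := fun m r => max (g m r - k r) 0)
    (f := fun _ => (0 : ℝ)) b hmeas hb hdom
    (by
      filter_upwards [h0, he] with r h1 h2
      exact squeeze_zero (fun m => (h1 m).1) (fun m => (h1 m).2) h2)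
  simpa using h

/-- The squared `L²` norm of a gradient. -/
noncomputable def gradEnergy (D : Fin 2 → Fin 2 → T2 → ℝ) : ℝ := ∑ i, ∑ j, nrm (D i j) ^ 2

lemma gradEnergy_nonneg (D : Fin 2 → Fin 2 → T2 → ℝ) : 0 ≤ gradEnergy D :=
  Finset.sum_nonneg fun _ _ => Finset.sum_nonneg fun _ _ => sq_nonneg _

lemma IsSobolevDivFree.gradNrm_nonneg (D : Fin 2 → Fin 2 → T2 → ℝ) : 0 ≤ gradNrm D :=
  Finset.sum_nonneg fun _ _ => Finset.sum_nonneg fun _ _ => nrm_nonneg _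

lemma IsSobolevDivFree.sq_gradNrm_le (D : Fin 2 → Fin 2 → T2 → ℝ) :
    gradNrm D ^ 2 ≤ 4 * gradEnergy D := by
  simp only [gradNrm, gradEnergy, Fin.sum_univ_two]
  nlinarith [sq_nonneg (nrm (D 0 0) - nrm (D 0 1)), sq_nonneg (nrm (D 0 0) - nrm (D 1 0)),
    sq_nonneg (nrm (D 0 0) - nrm (D 1 1)), sq_nonneg (nrm (D 0 1) - nrm (D 1 0)),
    sq_nonneg (nrm (D 0 1) - nrm (D 1 1)), sq_nonneg (nrm (D 1 0) - nrm (D 1 1))]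

/-- The kinetic energy, up to a factor `2`. -/
noncomputable def energy (v : Fin 2 → T2 → ℝ) : ℝ := ∑ i, nrm (v i) ^ 2

lemma energy_nonneg (v : Fin 2 → T2 → ℝ) : 0 ≤ energy v := Finset.sum_nonneg fun _ _ => sq_nonneg _

lemma IsSobolevDivFree.energy_le {v : Fin 2 → T2 → ℝ} {D : Fin 2 → Fin 2 → T2 → ℝ}
    (h : IsSobolevDivFree v D) (h0 : ∀ i, ∫ x, v i x = 0) : energy v ≤ 8 * gradEnergy D := by
  have hp := fun i => poincare (h.memLp i) (h.memLp_grad i) (h.weak i) (h0 i)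
  have key : ∀ i, nrm (v i) ^ 2 ≤ 8 * ∑ j, nrm (D i j) ^ 2 := by
    intro i
    have h1 := pow_le_pow_left₀ (nrm_nonneg _) (hp i) 2
    rw [Fin.sum_univ_two]
    nlinarith [sq_nonneg (nrm (D i 0) - nrm (D i 1))]
  unfold energy gradEnergy
  rw [Finset.mul_sum]
  exact Finset.sum_le_sum fun i _ => key i

namespace IsFlow

variable {F : ℝ} {u f : ℝ → Fin 2 → T2 → ℝ} {D : ℝ → Fin 2 → Fin 2 → T2 → ℝ}

lemma memLp_grad_slab (h : IsFlow F u f D) {s : ℝ} (hs : 0 ≤ s) (t : ℝ) (i j : Fin 2) :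
    MemLp (fun z : ℝ × T2 => D z.1 i j z.2) 2 (slab s t) := by
  have hsub : Ioc s t ⊆ Icc 0 t := fun _ hr => ⟨hs.trans hr.1.le, hr.2⟩
  exact (h.memLp_grad i j t).mono_measure
    (Measure.prod_mono (Measure.restrict_mono hsub le_rfl) le_rfl)

lemma integrable_gradEnergy (h : IsFlow F u f D) {s : ℝ} (hs : 0 ≤ s) (t : ℝ) :
    Integrable (fun r => gradEnergy (D r)) (volume.restrict (Ioc s t)) := by
  refine integrable_finsetSum _ fun i _ => integrable_finsetSum _ fun j _ => ?_
  simp_rw [sq_nrm]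
  exact (h.memLp_grad_slab hs t i j).integrable_sq.integral_prod_left

lemma aesm_nrm (h : IsFlow F u f D) {s : ℝ} (hs : 0 ≤ s) (t : ℝ) (i : Fin 2) :
    AEStronglyMeasurable (fun r => nrm (u r i)) (volume.restrict (Ioc s t)) :=
  Real.continuous_sqrt.comp_aestronglyMeasurable
    (AEStronglyMeasurable.integral_prod_right' (μ := volume.restrict (Ioc s t))
      (ν := (volume : Measure T2)) (f := fun z : ℝ × T2 => u z.1 i z.2 ^ 2)
      (((h.meas i).mono_measure (slab_le hs t)).pow 2))

lemma integrable_nrm (h : IsFlow F u f D) {s : ℝ} (hs : 0 ≤ s) (t : ℝ) (i : Fin 2) :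
    Integrable (fun r => nrm (u r i)) (volume.restrict (Ioc s t)) := by
  obtain ⟨K, hK⟩ := h.bounded t
  refine (integrable_const K).mono' (h.aesm_nrm hs t i) ?_
  filter_upwards [ae_restrict_mem measurableSet_Ioc] with r hr
  rw [Real.norm_eq_abs, abs_of_nonneg (nrm_nonneg _)]
  exact hK r ⟨hs.trans hr.1.le, hr.2⟩ i

lemma energy_inequality (h : IsFlow F u f D) {s t : ℝ} (hs : 0 ≤ s) (hst : s ≤ t) :
    energy (u t) / 2 - energy (u s) / 2 ≤
      ∫ r in Ioc s t, (-gradEnergy (D r) + F * ∑ i, nrm (u r i)) := by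
  set μ := (volume : Measure ℝ).restrict (Ioc s t) with hμ
  set k : ℝ → ℝ := fun r => -gradEnergy (D r) + F * ∑ i, nrm (u r i) with hk
  set g : ℕ → ℝ → ℝ := fun m r => gen (u r) (f r) (fun i => mol m (mol m (u r i))) with hg
  have ik : Integrable k μ := (h.integrable_gradEnergy hs t).neg.add
    ((integrable_finsetSum _ fun i _ => h.integrable_nrm hs t i).const_mul F)
  have ig : ∀ m, Integrable (g m) μ := fun m =>
    (intervalIntegrable_iff_integrableOn_Ioc_of_le hst).1 (h.energy_evolution m hs hst).1
  obtain ⟨B, hB⟩ := h.bounded t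
  have hgood : ∀ᵐ r ∂μ, ∃ K : Fin 2 → ℕ → ℝ, (∀ i m x, |mol m (u r i) x| ≤ K i m) ∧
      (∀ i m, K i m ≤ √(8 * (m + 1)) * nrm (u r i)) ∧
      (∀ i, Filter.Tendsto (fun m : ℕ => K i m * (1 / √(m + 1))) Filter.atTop (nhds 0)) ∧
      IsSobolevDivFree (u r) (D r) ∧ (∀ i, MemLp (f r i) 2 volume ∧ nrm (f r i) ≤ F) ∧
      ∀ i, nrm (u r i) ≤ B := by
    filter_upwards [ae_Ioc h.sobolev hs t, ae_Ioc h.nrm_force hs t,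
      ae_restrict_mem measurableSet_Ioc] with r h1 h2 hr
    choose K hK using fun i => exists_abs_mol_le (h1.memLp i)
    exact ⟨K, fun i => (hK i).1, fun i => (hK i).2.1, fun i => (hK i).2.2, h1, h2,
      hB r ⟨hs.trans hr.1.le, hr.2⟩⟩
  set E : ℕ → ℝ → ℝ := fun m r => max (g m r - k r) 0 with hE
  have hlim : Filter.Tendsto (fun m => ∫ r, max (g m r - k r) 0 ∂μ) Filter.atTop (nhds 0) := by
    refine And.right (tendsto_integral_max_sub (e := E)
      (b := fun r => gradEnergy (D r) + (1024 * Real.pi * |B|) * gradEnergy (D r))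
      (fun m => (ig m).1) ik.1 ((h.integrable_gradEnergy hs t).add
        ((h.integrable_gradEnergy hs t).const_mul _)) ?_ ?_)
    all_goals
      filter_upwards [hgood] with r hr
      obtain ⟨K, hK1, hK2, hK3, hv, hf, huB⟩ := hr
      have hG0 := IsSobolevDivFree.gradNrm_nonneg (D r)
      have hK0 : ∀ i m, 0 ≤ K i m := fun i m => (abs_nonneg _).trans (hK1 i m 0)
      have hmain : ∀ m, g m r - k r ≤ (gradEnergy (D r) - ∑ i, ∑ j, nrm (mol m (D r i j)) ^ 2) +
          ∑ i, K i m * (1 / √(m + 1)) * (16 * Real.pi * IsSobolevDivFree.gradNrm (D r) ^ 2) := by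
        intro m
        have h1 := hv.gen_mol_mol_le (fun i => (hf i).1) m (K := fun i => K i m)
          fun i x => hK1 i m x
        have h2 : ∑ i, nrm (f r i) * nrm (u r i) ≤ F * ∑ i, nrm (u r i) := by
          rw [Finset.mul_sum]
          exact Finset.sum_le_sum fun i _ => mul_le_mul_of_nonneg_right (hf i).2 (nrm_nonneg _)
        have h3 : ∑ i, K i m * IsSobolevDivFree.gradNrm (D r) * modulus m (u r i) ≤
            ∑ i, K i m * (1 / √(m + 1)) *
              (16 * Real.pi * IsSobolevDivFree.gradNrm (D r) ^ 2) := by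
          refine Finset.sum_le_sum fun i _ => ?_
          calc _ ≤ K i m * IsSobolevDivFree.gradNrm (D r) *
                (16 * Real.pi / √(m + 1) * IsSobolevDivFree.gradNrm (D r)) :=
                mul_le_mul_of_nonneg_left (modulus_le_of_dl_le m (hv.memLp i) (hv.nrm_dl_le i))
                  (mul_nonneg (hK0 i m) hG0)
            _ = _ := by ring
        simp only [hg, hk]
        linarith
    · intro m
      refine ⟨by simp only [hE]; linarith [le_max_left (g m r - k r) 0], le_max_right _ _,
        max_le ((hmain m).trans (add_le_add ?_ ?_)) ?_⟩
      · have : 0 ≤ ∑ i, ∑ j, nrm (mol m (D r i j)) ^ 2 :=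
          Finset.sum_nonneg fun _ _ => Finset.sum_nonneg fun _ _ => sq_nonneg _
        linarith
      · have hs0 : 0 < √((m : ℝ) + 1) := Real.sqrt_pos.2 (by positivity)
        have hKs : ∀ i, K i m * (1 / √(m + 1)) ≤ 4 * |B| := by
          intro i
          rw [mul_one_div, div_le_iff₀ hs0]
          refine (hK2 i m).trans ?_
          rw [Real.sqrt_mul (by norm_num)]
          have h8 : √8 ≤ (4 : ℝ) := Real.sqrt_le_iff.2 ⟨by norm_num, by norm_num⟩
          have hb := (huB i).trans (le_abs_self B)
          calc √8 * √((m : ℝ) + 1) * nrm (u r i) = √((m : ℝ) + 1) * (√8 * nrm (u r i)) := by ring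
            _ ≤ √((m : ℝ) + 1) * (4 * |B|) := mul_le_mul_of_nonneg_left
                (mul_le_mul h8 hb (nrm_nonneg _) (by norm_num)) hs0.le
            _ = _ := by ring
        have hsq := IsSobolevDivFree.sq_gradNrm_le (D r)
        have hpi := Real.pi_pos
        have hq0 : 0 ≤ 16 * Real.pi * IsSobolevDivFree.gradNrm (D r) ^ 2 := by positivity
        have h1 := fun i => mul_le_mul_of_nonneg_right (hKs i) hq0
        have h2 := mul_le_mul_of_nonneg_left hsq (by positivity : 0 ≤ 128 * Real.pi * |B|)
        have h3 : (∑ i, K i m * (1 / √(m + 1)) *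
            (16 * Real.pi * IsSobolevDivFree.gradNrm (D r) ^ 2)) ≤
            2 * (4 * |B| * (16 * Real.pi * IsSobolevDivFree.gradNrm (D r) ^ 2)) := by
          rw [Fin.sum_univ_two]; linarith [h1 0, h1 1]
        have h4 : 0 ≤ Real.pi * |B| * gradEnergy (D r) := by
          have := gradEnergy_nonneg (D r); positivity
        linarith
      · have := gradEnergy_nonneg (D r)
        have := Real.pi_pos
        positivity
    · have ht1 : Filter.Tendsto (fun m => ∑ i, ∑ j, nrm (mol m (D r i j)) ^ 2) Filter.atTop
          (nhds (gradEnergy (D r))) :=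
        tendsto_finsetSum _ fun i _ => tendsto_finsetSum _ fun j _ =>
          (tendsto_nrm_mol (hv.memLp_grad i j)).pow 2
      have ht2 := tendsto_finsetSum Finset.univ fun i _ =>
        (hK3 i).mul_const (16 * Real.pi * IsSobolevDivFree.gradNrm (D r) ^ 2)
      have ht := ((tendsto_const_nhds (x := gradEnergy (D r))).sub ht1).add ht2
      have ht' := ht.max (tendsto_const_nhds (x := (0 : ℝ)))
      simp only [sub_self, zero_mul, Finset.sum_const_zero, add_zero, max_self] at ht'
      exact squeeze_zero (fun m => le_max_right _ _) (fun m => max_le_max_right 0 (hmain m)) ht'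
  have hle : ∀ m, (∑ i, nrm (mol m (u t i)) ^ 2 / 2) - ∑ i, nrm (mol m (u s i)) ^ 2 / 2 ≤
      (∫ r, k r ∂μ) + ∫ r, max (g m r - k r) 0 ∂μ := by
    intro m
    have imax : Integrable (fun r => max (g m r - k r) 0) μ := ((ig m).sub ik).pos_part
    rw [(h.energy_evolution m hs hst).2, intervalIntegral.integral_of_le hst,
      ← integral_add ik imax]
    exact integral_mono (ig m) (ik.add imax) fun r => by
      simp only
      linarith [le_max_left (g m r - k r) 0]
  have hn : ∀ r, 0 ≤ r → Filter.Tendsto (fun m => ∑ i, nrm (mol m (u r i)) ^ 2 / 2) Filter.atTop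
      (nhds (energy (u r) / 2)) := by
    intro r hr
    unfold energy
    rw [Finset.sum_div]
    exact tendsto_finsetSum _ fun i _ => ((tendsto_nrm_mol (h.memLp r hr i)).pow 2).div_const 2
  have := le_of_tendsto_of_tendsto' ((hn t (hs.trans hst)).sub (hn s hs))
    (tendsto_const_nhds.add hlim) hle
  simpa using this

lemma energy_add_integral_le (h : IsFlow F u f D) {s t : ℝ} (hs : 0 ≤ s) (hst : s ≤ t) :
    energy (u t) + ∫ r in Ioc s t, gradEnergy (D r) ≤ energy (u s) + 16 * F ^ 2 * (t - s) := by
  have h1 := h.energy_inequality hs hst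
  have iG := h.integrable_gradEnergy hs t
  have h2 : ∫ r in Ioc s t, (-gradEnergy (D r) + F * ∑ i, nrm (u r i)) ≤
      ∫ r in Ioc s t, (-(1 / 2) * gradEnergy (D r) + 8 * F ^ 2) := by
    refine integral_mono_ae (iG.neg.add
      ((integrable_finsetSum _ fun i _ => h.integrable_nrm hs t i).const_mul F))
      ((iG.const_mul _).add (integrable_const _)) ?_
    filter_upwards [ae_Ioc h.sobolev hs t, ae_restrict_mem measurableSet_Ioc] with r hv hr
    have h3 := hv.energy_le (h.mean_zero r (hs.trans hr.1.le))
    simp only [energy, Fin.sum_univ_two] at h3 ⊢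
    nlinarith [sq_nonneg (nrm (u r 0) / 4 - 2 * F), sq_nonneg (nrm (u r 1) / 4 - 2 * F)]
  rw [integral_add (iG.const_mul _) (integrable_const _), integral_const_mul] at h2
  have h3 : ∫ _ in Ioc s t, 8 * F ^ 2 = 8 * F ^ 2 * (t - s) := by
    rw [setIntegral_const, Real.volume_real_Ioc_of_le hst, smul_eq_mul]; ring
  linarith

lemma energy_le_add (h : IsFlow F u f D) {s t : ℝ} (hs : 0 ≤ s) (hst : s ≤ t) :
    energy (u t) ≤ energy (u s) + 16 * F ^ 2 * (t - s) := by
  have h1 := h.energy_add_integral_le hs hst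
  have h2 : 0 ≤ ∫ r in Ioc s t, gradEnergy (D r) := integral_nonneg fun r => gradEnergy_nonneg _
  linarith

lemma energy_add_one_le (h : IsFlow F u f D) {s : ℝ} (hs : 0 ≤ s) :
    9 / 8 * energy (u (s + 1)) ≤ energy (u s) + 18 * F ^ 2 := by
  have h1 := h.energy_add_integral_le hs (by linarith : s ≤ s + 1)
  have h2 : ∫ _ in Ioc s (s + 1), (energy (u (s + 1)) - 16 * F ^ 2) / 8 ≤
      ∫ r in Ioc s (s + 1), gradEnergy (D r) := by
    refine integral_mono_ae (integrable_const _) (h.integrable_gradEnergy hs _) ?_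
    filter_upwards [ae_Ioc h.sobolev hs (s + 1), ae_restrict_mem measurableSet_Ioc] with r hv hr
    have hr0 := hs.trans hr.1.le
    have h3 := hv.energy_le (h.mean_zero r hr0)
    have h4 := h.energy_le_add hr0 hr.2
    have h5 : 16 * F ^ 2 * (s + 1 - r) ≤ 16 * F ^ 2 * 1 :=
      mul_le_mul_of_nonneg_left (by linarith [hr.1]) (by positivity)
    linarith
  rw [setIntegral_const, Real.volume_real_Ioc_of_le (by linarith), smul_eq_mul] at h2
  linarith

lemma energy_natCast_le (h : IsFlow F u f D) (n : ℕ) :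
    energy (u n) ≤ (8 / 9) ^ n * energy (u 0) + 144 * F ^ 2 := by
  induction n with
  | zero => simp; positivity
  | succ n ih =>
    have h1 := h.energy_add_one_le n.cast_nonneg
    push_cast
    rw [pow_succ]
    linarith

/-- The energy decays exponentially up to a multiple of the squared size of the force. -/
lemma energy_le (h : IsFlow F u f D) {t : ℝ} (ht : 0 ≤ t) :
    energy (u t) ≤ (8 / 9) ^ ⌊t⌋₊ * energy (u 0) + 160 * F ^ 2 := by
  have h1 := h.energy_natCast_le ⌊t⌋₊
  have h2 := h.energy_le_add (Nat.cast_nonneg ⌊t⌋₊) (Nat.floor_le ht)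
  have h3 : 16 * F ^ 2 * (t - ⌊t⌋₊) ≤ 16 * F ^ 2 * 1 :=
    mul_le_mul_of_nonneg_left (by linarith [Nat.lt_floor_add_one t]) (by positivity)
  linarith

end IsFlow

/-! ### Ladyzhenskaya's inequality -/

lemma abs_le_integral_unit_interval {φ φ' : ℝ → ℝ} (hd : ∀ s, HasDerivAt φ (φ' s) s)
    (hc : Continuous φ') : |φ 0| ≤ ∫ s in (0 : ℝ)..1, (|φ s| + |φ' s|) := by
  have hφ : Continuous φ := continuous_iff_continuousAt.2 fun s => (hd s).continuousAt
  have key : ∀ s ∈ Icc (0 : ℝ) 1, |φ 0| ≤ |φ s| + ∫ r in (0 : ℝ)..1, |φ' r| := by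
    intro s hs
    have h1 := intervalIntegral.integral_eq_sub_of_hasDerivAt (fun r _ => hd r)
      (hc.intervalIntegrable 0 s)
    have h2 : |∫ r in (0 : ℝ)..s, φ' r| ≤ ∫ r in (0 : ℝ)..1, |φ' r| :=
      (intervalIntegral.abs_integral_le_integral_abs hs.1).trans
        (intervalIntegral.integral_mono_interval le_rfl hs.1 hs.2
          (.of_forall fun _ => abs_nonneg _) (hc.abs.intervalIntegrable 0 1))
    rw [h1] at h2
    have h3 := abs_sub_abs_le_abs_sub (φ 0) (φ s)
    rw [abs_sub_comm] at h3
    linarith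
  have h := intervalIntegral.integral_mono_on (zero_le_one' ℝ) intervalIntegrable_const
    ((hφ.abs.add (continuous_const (y := ∫ r in (0 : ℝ)..1, |φ' r|))).intervalIntegrable
      (μ := volume) 0 1) key
  simp only [Pi.add_apply] at h
  rw [intervalIntegral.integral_add (hφ.abs.intervalIntegrable 0 1)
    intervalIntegrable_const] at h
  rw [intervalIntegral.integral_add (hφ.abs.intervalIntegrable 0 1)
    (hc.abs.intervalIntegrable 0 1)]
  simpa using h

lemma abs_le_integral_line {g : T2 → ℝ} (hg : SmoothScalar g) (j : Fin 2) (x : T2) :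
    |g x| ≤ ∫ s in (0 : ℝ)..1,
      (|g (x + proj (Pi.single j s))| + |pd j g (x + proj (Pi.single j s))|) := by
  have hc : Continuous fun s : ℝ => x + proj (Pi.single j s) :=
    continuous_const.add (continuous_proj.comp (continuous_single (A := fun _ : Fin 2 => ℝ) j))
  have := abs_le_integral_unit_interval (fun s => hg.hasDerivAt j x s)
    ((hg.pd j).continuous.comp hc)
  simpa only [proj_single_zero, add_zero] using this

lemma integral_circle_line (a : UnitAddCircle) (k : UnitAddCircle → ℝ) :
    ∫ s in (0 : ℝ)..1, k (a + (s : UnitAddCircle)) = ∫ c, k c := by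
  have h := UnitAddCircle.intervalIntegral_preimage 0 (fun c => k (a + c))
  rw [zero_add] at h
  rw [h]
  exact integral_add_left_eq_self k a

lemma abs_le_integral_first {g : T2 → ℝ} (hg : SmoothScalar g) (a b : UnitAddCircle) :
    |g ![a, b]| ≤ ∫ c, (|g ![c, b]| + |pd 0 g ![c, b]|) := by
  refine (abs_le_integral_line hg 0 ![a, b]).trans (le_of_eq ?_)
  rw [← integral_circle_line a]
  congr 1
  ext s
  rw [show (![a, b] : T2) + proj (Pi.single 0 s) = ![a + (s : UnitAddCircle), b] by
    ext i; fin_cases i <;> simp [proj]]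

lemma abs_le_integral_second {g : T2 → ℝ} (hg : SmoothScalar g) (a b : UnitAddCircle) :
    |g ![a, b]| ≤ ∫ c, (|g ![a, c]| + |pd 1 g ![a, c]|) := by
  refine (abs_le_integral_line hg 1 ![a, b]).trans (le_of_eq ?_)
  rw [← integral_circle_line b]
  congr 1
  ext s
  rw [show (![a, b] : T2) + proj (Pi.single 1 s) = ![a, b + (s : UnitAddCircle)] by
    ext i; fin_cases i <;> simp [proj]]

lemma integral_finTwo (k : T2 → ℝ) :
    ∫ p : UnitAddCircle × UnitAddCircle, k ![p.1, p.2] = ∫ x, k x := by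
  have h := (volume_preserving_finTwoArrow UnitAddCircle).symm.integral_comp'
    (g := fun x : T2 => k x)
  rw [← h]
  rfl

lemma continuous_finTwo : Continuous fun p : UnitAddCircle × UnitAddCircle => (![p.1, p.2] : T2) := by
  refine continuous_pi fun i => ?_
  fin_cases i
  · exact continuous_fst
  · exact continuous_snd

/-- The Sobolev inequality `‖g‖_2 ≤ ‖g‖_{W^{1,1}}` in two dimensions. -/
lemma integral_sq_le_mul {g : T2 → ℝ} (hg : SmoothScalar g) :
    ∫ x, g x ^ 2 ≤ (∫ x, (|g x| + |pd 0 g x|)) * ∫ x, (|g x| + |pd 1 g x|) := by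
  have hk : ∀ j, Continuous fun x => |g x| + |pd j g x| := fun j =>
    hg.continuous.abs.add (hg.pd j).continuous.abs
  have hk2 : ∀ j, Continuous fun p : UnitAddCircle × UnitAddCircle =>
      |g ![p.1, p.2]| + |pd j g ![p.1, p.2]| := fun j => (hk j).comp continuous_finTwo
  have ic : ∀ {k : UnitAddCircle × UnitAddCircle → ℝ}, Continuous k →
      Integrable k (volume.prod volume) := fun hk =>
    hk.integrable_of_hasCompactSupport (HasCompactSupport.of_compactSpace _)
  have e0 : ∫ x, (|g x| + |pd 0 g x|) = ∫ b, ∫ a, (|g ![a, b]| + |pd 0 g ![a, b]|) := by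
    rw [← integral_finTwo]
    exact integral_prod_symm _ (ic (hk2 0))
  have e1 : ∫ x, (|g x| + |pd 1 g x|) = ∫ a, ∫ b, (|g ![a, b]| + |pd 1 g ![a, b]|) := by
    rw [← integral_finTwo]
    exact integral_prod _ (ic (hk2 1))
  have i0 := (ic (hk2 0)).integral_prod_right
  have i1 := (ic (hk2 1)).integral_prod_left
  have hmul := integral_prod_mul (μ := (volume : Measure UnitAddCircle))
    (ν := (volume : Measure UnitAddCircle))
    (fun a => ∫ b, (|g ![a, b]| + |pd 1 g ![a, b]|)) (fun b => ∫ a, (|g ![a, b]| + |pd 0 g ![a, b]|))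
  rw [e0, e1, mul_comm, ← hmul, ← integral_finTwo]
  refine integral_mono (ic ((hg.continuous.pow 2).comp continuous_finTwo)) (i1.mul_prod i0)
    fun p => ?_
  simp only
  rw [← sq_abs, sq]
  exact mul_le_mul (abs_le_integral_second hg _ _) (abs_le_integral_first hg _ _) (abs_nonneg _)
    ((abs_nonneg _).trans (abs_le_integral_second hg p.1 p.2))

/-- Ladyzhenskaya's inequality, obtained from the `W^{1,1}` inequality for `v²`. -/
lemma ladyzhenskaya {v : T2 → ℝ} (hv : SmoothScalar v) :
    ∫ x, v x ^ 4 ≤ 5 * nrm v ^ 2 * (nrm v ^ 2 + ∑ j, nrm (pd j v) ^ 2) := by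
  have h := integral_sq_le_mul (hv.mul hv)
  have key : ∀ j, ∫ x, (|v x * v x| + |pd j (fun x => v x * v x) x|) ≤
      nrm v * (nrm v + 2 * nrm (pd j v)) := by
    intro j
    have h1 := integral_abs_mul_le (hv.memLp 2) (hv.memLp 2)
    have h2 := integral_abs_mul_le (hv.memLp 2) ((hv.pd j).memLp 2)
    have i1 : Integrable (fun x => |v x * v x|) volume := (hv.mul hv).integrable.abs
    have i2 : Integrable (fun x => 2 * |v x * pd j v x|) volume :=
      (hv.mul (hv.pd j)).integrable.abs.const_mul 2
    have e : ∀ x, |pd j (fun x => v x * v x) x| = 2 * |v x * pd j v x| := by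
      intro x
      rw [pd_mul hv hv, show pd j v x * v x + v x * pd j v x = 2 * (v x * pd j v x) by ring,
        abs_mul, abs_of_pos two_pos]
    simp_rw [e]
    rw [integral_add i1 i2, integral_const_mul]
    linarith
  have n := fun j => nrm_nonneg (pd j v)
  have n0 := nrm_nonneg v
  have e : ∫ x, v x ^ 4 = ∫ x, (v x * v x) ^ 2 := by
    congr 1; ext x; ring
  rw [e]
  refine h.trans ((mul_le_mul (key 0) (key 1)
    (integral_nonneg fun x => add_nonneg (abs_nonneg _) (abs_nonneg _))
    (mul_nonneg n0 (add_nonneg n0 (mul_nonneg two_pos.le (n 0))))).trans ?_)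
  rw [Fin.sum_univ_two]
  have h2 : (nrm v + 2 * nrm (pd 0 v)) * (nrm v + 2 * nrm (pd 1 v)) ≤
      5 * (nrm v ^ 2 + (nrm (pd 0 v) ^ 2 + nrm (pd 1 v) ^ 2)) := by
    nlinarith [sq_nonneg (nrm v - nrm (pd 0 v)), sq_nonneg (nrm v - nrm (pd 1 v)),
      sq_nonneg (nrm (pd 0 v) - nrm (pd 1 v)), sq_nonneg (nrm v), sq_nonneg (nrm (pd 0 v)),
      sq_nonneg (nrm (pd 1 v))]
  have h3 := mul_le_mul_of_nonneg_left h2 (sq_nonneg (nrm v))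
  linarith

/-! ### The truncated vorticity estimate -/

/-- A smooth convex function `β` of at most linear growth with `β'' ≤ 1` and `β'² ≤ 2 β`, such as
the regularizations of `(s - k)₊² / 2`. -/
structure IsTruncation (N N' : ℝ) (β : ℝ → ℝ) : Prop where
  smooth : ContDiff ℝ ∞ β
  convex : ∀ s, 0 ≤ deriv (deriv β) s
  le_one : ∀ s, deriv (deriv β) s ≤ 1
  abs_deriv_le : ∀ s, |deriv β s| ≤ N
  abs_third_le : ∀ s, |deriv (deriv (deriv β)) s| ≤ N'
  sq_deriv_le : ∀ s, deriv β s ^ 2 ≤ 2 * β s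

lemma abs_sub_le_of_abs_deriv_le {B : ℝ → ℝ} (hB : Differentiable ℝ B) {L : ℝ}
    (h : ∀ s, |deriv B s| ≤ L) (a b : ℝ) : |B a - B b| ≤ L * |a - b| :=
  convex_univ.norm_image_sub_le_of_norm_deriv_le (fun s _ => hB s) (fun s _ => h s)
    (mem_univ b) (mem_univ a)

namespace IsTruncation

variable {N N' : ℝ} {β : ℝ → ℝ}

lemma smooth_one (hβ : IsTruncation N N' β) : ContDiff ℝ ∞ (deriv β) :=
  (contDiff_infty_iff_deriv.1 hβ.smooth).2

lemma smooth_two (hβ : IsTruncation N N' β) : ContDiff ℝ ∞ (deriv (deriv β)) :=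
  (contDiff_infty_iff_deriv.1 hβ.smooth_one).2

lemma nonneg (hβ : IsTruncation N N' β) (s : ℝ) : 0 ≤ β s := by
  nlinarith [hβ.sq_deriv_le s, sq_nonneg (deriv β s)]

lemma bound_nonneg (hβ : IsTruncation N N' β) : 0 ≤ N := (abs_nonneg _).trans (hβ.abs_deriv_le 0)

lemma lipschitz (hβ : IsTruncation N N' β) (a b : ℝ) : |β a - β b| ≤ N * |a - b| :=
  abs_sub_le_of_abs_deriv_le (hβ.smooth.differentiable (by simp)) hβ.abs_deriv_le a b

lemma lipschitz_two (hβ : IsTruncation N N' β) (a b : ℝ) :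
    |deriv (deriv β) a - deriv (deriv β) b| ≤ N' * |a - b| :=
  abs_sub_le_of_abs_deriv_le (hβ.smooth_two.differentiable (by simp)) hβ.abs_third_le a b

lemma lipschitz_pow (hβ : IsTruncation N N' β) (a b : ℝ) :
    |deriv β a ^ 4 - deriv β b ^ 4| ≤ 4 * N ^ 3 * |a - b| := by
  have hd := hβ.smooth_one.differentiable (by simp)
  refine abs_sub_le_of_abs_deriv_le (B := fun s => deriv β s ^ 4) (hd.pow 4) (fun s => ?_) a b
  rw [((hd s).hasDerivAt.fun_pow 4).deriv]
  have h1 := pow_le_pow_left₀ (abs_nonneg _) (hβ.abs_deriv_le s) 3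
  have h2 : |deriv (deriv β) s| ≤ 1 := by
    rw [abs_of_nonneg (hβ.convex s)]; exact hβ.le_one s
  rw [abs_mul, abs_mul, abs_pow]
  norm_num
  calc 4 * |deriv β s| ^ 3 * |deriv (deriv β) s| ≤ 4 * N ^ 3 * 1 :=
        mul_le_mul (by linarith) h2 (abs_nonneg _) (by have := hβ.bound_nonneg; positivity)
    _ = _ := mul_one _

end IsTruncation

lemma integrable_lipschitz_comp {B : ℝ → ℝ} {L : ℝ} (hB : Continuous B)
    (hL : ∀ a b, |B a - B b| ≤ L * |a - b|) {w : T2 → ℝ} (hw : MemLp w 2 volume) :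
    Integrable (fun x => B (w x)) volume := by
  refine ((hw.integrable_two.abs.const_mul L).add (integrable_const |B 0|)).mono'
    (hB.comp_aestronglyMeasurable hw.1) (.of_forall fun x => ?_)
  have h1 := hL (w x) 0
  rw [sub_zero] at h1
  have h2 := abs_sub_abs_le_abs_sub (B (w x)) (B 0)
  simp only [Real.norm_eq_abs, Pi.add_apply]
  linarith

lemma tendsto_integral_lipschitz_comp {B : ℝ → ℝ} {L : ℝ} (hB : Continuous B)
    (hL0 : 0 ≤ L) (hL : ∀ a b, |B a - B b| ≤ L * |a - b|) {w : T2 → ℝ} (hw : MemLp w 2 volume) :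
    Filter.Tendsto (fun m => ∫ x, B (mol m w x)) Filter.atTop (nhds (∫ x, B (w x))) := by
  have h0 := (tendsto_nrm_mol_sub hw).const_mul L
  rw [mul_zero] at h0
  refine tendsto_iff_dist_tendsto_zero.2 (squeeze_zero (fun _ => dist_nonneg) (fun m => ?_) h0)
  have hm := (smooth_mol m hw.integrable_two).memLp 2
  rw [Real.dist_eq, ← integral_sub (integrable_lipschitz_comp hB hL hm)
    (integrable_lipschitz_comp hB hL hw)]
  calc |∫ x, (B (mol m w x) - B (w x))| ≤ ∫ x, |B (mol m w x) - B (w x)| :=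
        abs_integral_le_integral_abs
    _ ≤ ∫ x, L * |mol m w x - w x| := by
        refine integral_mono_of_nonneg (.of_forall fun _ => abs_nonneg _)
          ((hm.sub hw).integrable_two.abs.const_mul L) (.of_forall fun x => hL _ _)
    _ ≤ L * nrm (fun x => mol m w x - w x) := by
        rw [integral_const_mul]
        exact mul_le_mul_of_nonneg_left (integral_abs_le_nrm (hm.sub hw)) hL0

lemma integrable_bounded_comp_mul {B : ℝ → ℝ} (hB : Continuous B) {K : ℝ} (hK : ∀ s, |B s| ≤ K)
    {w g : T2 → ℝ} (hw : MemLp w 2 volume) (hg : Integrable g volume) :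
    Integrable (fun x => B (w x) * g x) volume :=
  hg.bdd_mul (hB.comp_aestronglyMeasurable hw.1) (.of_forall fun x => hK (w x))

/-- Convergence of `∫ B(κ * w) (κ * g)²` for bounded Lipschitz `B`. -/
lemma tendsto_integral_comp_mul_sq {B : ℝ → ℝ} {L : ℝ} (hB : Continuous B) (hB1 : ∀ s, |B s| ≤ 1)
    (hL0 : 0 ≤ L) (hL : ∀ a b, |B a - B b| ≤ L * |a - b|) {w g : T2 → ℝ} (hw : MemLp w 2 volume)
    (hg : MemLp g 4 volume) :
    Filter.Tendsto (fun m => ∫ x, B (mol m w x) * mol m g x ^ 2) Filter.atTop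
      (nhds (∫ x, B (w x) * g x ^ 2)) := by
  have hg2 : MemLp g 2 volume := hg.mono_exponent (by norm_num)
  have hgg : MemLp (fun x => g x ^ 2) 2 volume := memLp_sq (by norm_num) hg
  have h1 := ((tendsto_nrm_mol_sub hg2).mul_const (2 * nrm g)).add
    (((tendsto_nrm_mol_sub hw).const_mul L).mul_const (nrm fun x => g x ^ 2))
  simp only [zero_mul, mul_zero, add_zero] at h1
  refine tendsto_iff_dist_tendsto_zero.2 (squeeze_zero (fun _ => dist_nonneg) (fun m => ?_) h1)
  have hmw := (smooth_mol m hw.integrable_two).memLp 2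
  have hmg := (smooth_mol m hg2.integrable_two).memLp 2
  have i1 := integrable_bounded_comp_mul hB hB1 hmw hmg.integrable_sq
  have i2 := integrable_bounded_comp_mul hB hB1 hw hg2.integrable_sq
  have j1 : Integrable (fun x => |(mol m g x - g x) * (mol m g x + g x)|) volume :=
    (integrable_mul_two (hmg.sub hg2) (hmg.add hg2)).abs
  have j2 : Integrable (fun x => L * |(mol m w x - w x) * g x ^ 2|) volume :=
    (integrable_mul_two (hmw.sub hw) hgg).abs.const_mul L
  rw [Real.dist_eq, ← integral_sub i1 i2]
  calc |∫ x, (B (mol m w x) * mol m g x ^ 2 - B (w x) * g x ^ 2)|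
      ≤ ∫ x, |B (mol m w x) * mol m g x ^ 2 - B (w x) * g x ^ 2| := abs_integral_le_integral_abs
    _ ≤ ∫ x, (|(mol m g x - g x) * (mol m g x + g x)| + L * |(mol m w x - w x) * g x ^ 2|) := by
        refine integral_mono_of_nonneg (.of_forall fun _ => abs_nonneg _) (j1.add j2)
          (.of_forall fun x => ?_)
        have e : B (mol m w x) * mol m g x ^ 2 - B (w x) * g x ^ 2 =
            B (mol m w x) * ((mol m g x - g x) * (mol m g x + g x)) +
            (B (mol m w x) - B (w x)) * g x ^ 2 := by ring
        simp only
        rw [e]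
        refine (abs_add_le _ _).trans (add_le_add ?_ ?_)
        · rw [abs_mul]
          exact mul_le_of_le_one_left (abs_nonneg _) (hB1 _)
        · rw [abs_mul, abs_mul, ← mul_assoc]
          exact mul_le_mul_of_nonneg_right (hL _ _) (abs_nonneg _)
    _ ≤ nrm (fun x => mol m g x - g x) * (2 * nrm g) +
        L * nrm (fun x => mol m w x - w x) * nrm (fun x => g x ^ 2) := by
        rw [integral_add j1 j2, integral_const_mul, mul_assoc L]
        refine add_le_add ((integral_abs_mul_le (hmg.sub hg2) (hmg.add hg2)).trans
          (mul_le_mul_of_nonneg_left ?_ (nrm_nonneg _)))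
          (mul_le_mul_of_nonneg_left (integral_abs_mul_le (hmw.sub hw) hgg) hL0)
        have := nrm_mol_le m hg2
        exact (nrm_add_le hmg hg2).trans (by linarith)

open IsSobolevDivFree in
lemma IsSobolevDivFree.nrm_vort_le {v : Fin 2 → T2 → ℝ} {D : Fin 2 → Fin 2 → T2 → ℝ}
    (h : IsSobolevDivFree v D) : nrm (vort D) ≤ gradNrm D := by
  refine (nrm_sub_le (h.memLp_grad 1 0) (h.memLp_grad 0 1)).trans ?_
  have n := fun i j => nrm_nonneg (D i j)
  simp only [gradNrm, Fin.sum_univ_two]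
  linarith [n 0 0, n 1 1]

/-- Ladyzhenskaya's inequality for `β'(W)`. -/
lemma IsTruncation.integral_pow_four_le {N N' : ℝ} {β : ℝ → ℝ} (hβ : IsTruncation N N' β)
    {W : T2 → ℝ} (hW : SmoothScalar W) {R : ℝ} (hR : ∫ x, β (W x) ≤ R) :
    ∫ x, deriv β (W x) ^ 4 ≤
      10 * R * (2 * R + ∑ j, ∫ x, deriv (deriv β) (W x) * pd j W x ^ 2) := by
  have sv : SmoothScalar fun x => deriv β (W x) := hW.comp hβ.smooth_one
  have sb : SmoothScalar fun x => deriv (deriv β) (W x) := hW.comp hβ.smooth_two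
  have h1 : nrm (fun x => deriv β (W x)) ^ 2 ≤ 2 * R := by
    rw [sq_nrm]
    refine (integral_mono (sv.pow 2).integrable ((hW.comp hβ.smooth).integrable.const_mul 2)
      fun x => hβ.sq_deriv_le (W x)).trans ?_
    rw [integral_const_mul]
    linarith
  have h2 : ∑ j, nrm (pd j fun x => deriv β (W x)) ^ 2 ≤
      ∑ j, ∫ x, deriv (deriv β) (W x) * pd j W x ^ 2 := by
    refine Finset.sum_le_sum fun j _ => ?_
    rw [sq_nrm]
    refine integral_mono ((sv.pd j).pow 2).integrable (sb.mul ((hW.pd j).pow 2)).integrable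
      fun x => ?_
    simp only
    rw [pd_comp hW (hβ.smooth_one.differentiable (by simp)), mul_pow]
    refine mul_le_mul_of_nonneg_right ?_ (sq_nonneg _)
    nlinarith [hβ.convex (W x), hβ.le_one (W x)]
  have h3 : 0 ≤ ∑ j, nrm (pd j fun x => deriv β (W x)) ^ 2 :=
    Finset.sum_nonneg fun _ _ => sq_nonneg _
  have h4 := sq_nonneg (nrm fun x => deriv β (W x))
  calc _ ≤ 5 * nrm (fun x => deriv β (W x)) ^ 2 * (nrm (fun x => deriv β (W x)) ^ 2 +
        ∑ j, nrm (pd j fun x => deriv β (W x)) ^ 2) := ladyzhenskaya sv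
    _ ≤ (10 * R) * (2 * R + ∑ j, ∫ x, deriv (deriv β) (W x) * pd j W x ^ 2) :=
        mul_le_mul (by linarith) (by linarith) (by linarith) (by linarith)
    _ = _ := by ring

namespace IsFlow

variable {F : ℝ} {u f : ℝ → Fin 2 → T2 → ℝ} {D : ℝ → Fin 2 → Fin 2 → T2 → ℝ}

open IsSobolevDivFree

lemma memLp_vort_slab (h : IsFlow F u f D) {s : ℝ} (hs : 0 ≤ s) (t : ℝ) :
    MemLp (fun z : ℝ × T2 => vort (D z.1) z.2) 2 (slab s t) :=
  (h.memLp_grad_slab hs t 1 0).sub (h.memLp_grad_slab hs t 0 1)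

lemma aesm_sum_pair (h : IsFlow F u f D) {s : ℝ} (hs : 0 ≤ s) (t : ℝ) (m : ℕ)
    {P : (Fin 2 → ℤ) × Bool → T2 → ℝ} (hP : ∀ a, Continuous (P a)) :
    AEStronglyMeasurable (fun z : ℝ × T2 => ∑ a ∈ freq m, pair (u z.1) (curl (md a)) * P a z.2)
      (slab s t) := by
  refine Finset.aestronglyMeasurable_fun_sum _ fun a _ => ?_
  have h1 : AEStronglyMeasurable (fun r => pair (u r) (curl (md a)))
      (volume.restrict (Ioc s t)) := by
    have := (h.continuousOn_pair t (smooth_curl (smooth_md a))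
      (curl_div_free (smooth_md a))).aestronglyMeasurable (μ := volume) measurableSet_Icc
    refine this.mono_measure (Measure.restrict_mono (fun r hr => ?_) le_rfl)
    exact ⟨hs.trans hr.1.le, hr.2⟩
  exact h1.comp_fst.mul ((hP a).comp continuous_snd).aestronglyMeasurable

lemma aesm_molVort (h : IsFlow F u f D) {s : ℝ} (hs : 0 ≤ s) (t : ℝ) (m : ℕ) :
    AEStronglyMeasurable (fun z : ℝ × T2 => molVort m (u z.1) z.2) (slab s t) :=
  h.aesm_sum_pair hs t m fun a => ((SmoothScalar.const (fcoef m a)).mul (smooth_md a)).continuous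

lemma aesm_pd_molVort (h : IsFlow F u f D) {s : ℝ} (hs : 0 ≤ s) (t : ℝ) (m : ℕ) (j : Fin 2) :
    AEStronglyMeasurable (fun z : ℝ × T2 => pd j (molVort m (u z.1)) z.2) (slab s t) := by
  have sP := fun a => (SmoothScalar.const (fcoef m a)).mul (smooth_md a)
  have := h.aesm_sum_pair hs t m fun a => ((sP a).pd j).continuous
  refine this.congr (.of_forall fun z => ?_)
  simp only
  rw [show molVort m (u z.1) = fun x => ∑ a ∈ freq m, pair (u z.1) (curl (md a)) *
    (fcoef m a * md a x) from rfl, pd_sum fun a _ => (SmoothScalar.const _).mul (sP a)]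
  refine Finset.sum_congr rfl fun a _ => ?_
  rw [pd_const_mul (sP a)]

/-- The contribution of the force to the truncated vorticity estimate. -/
noncomputable def forcing (β : ℝ → ℝ) (D : ℝ → Fin 2 → Fin 2 → T2 → ℝ) (f : ℝ → Fin 2 → T2 → ℝ)
    (r : ℝ) : ℝ := (1 / 2) * ∑ i, ∫ x, deriv (deriv β) (vort (D r) x) * f r i x ^ 2

lemma forcing_nonneg {N N' : ℝ} {β : ℝ → ℝ} (hβ : IsTruncation N N' β) (r : ℝ) :
    0 ≤ forcing β D f r :=
  mul_nonneg (by norm_num) (Finset.sum_nonneg fun i _ => integral_nonneg fun x =>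
    mul_nonneg (hβ.convex _) (sq_nonneg _))

lemma integral_truncation_mul_sq_le {N N' : ℝ} {β : ℝ → ℝ} (hβ : IsTruncation N N' β)
    {w g : T2 → ℝ} {F : ℝ} (hg : MemLp g 2 volume) (hgF : nrm g ≤ F) :
    ∫ x, deriv (deriv β) (w x) * g x ^ 2 ≤ F ^ 2 := by
  calc _ ≤ ∫ x, g x ^ 2 := integral_mono_of_nonneg
        (.of_forall fun x => mul_nonneg (hβ.convex _) (sq_nonneg _)) hg.integrable_sq
        (.of_forall fun x => mul_le_of_le_one_left (sq_nonneg _) (hβ.le_one _))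
    _ = nrm g ^ 2 := (sq_nrm g).symm
    _ ≤ F ^ 2 := pow_le_pow_left₀ (nrm_nonneg _) hgF 2

lemma integrable_forcing (h : IsFlow F u f D) {N N' : ℝ} {β : ℝ → ℝ} (hβ : IsTruncation N N' β)
    {s : ℝ} (hs : 0 ≤ s) (t : ℝ) :
    Integrable (forcing β D f) (volume.restrict (Ioc s t)) := by
  refine (integrable_finsetSum _ fun i _ => ?_).const_mul _
  refine (integrable_const (F ^ 2)).mono' (AEStronglyMeasurable.integral_prod_right'
    (μ := volume.restrict (Ioc s t)) (ν := (volume : Measure T2))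
    (f := fun z : ℝ × T2 => deriv (deriv β) (vort (D z.1) z.2) * f z.1 i z.2 ^ 2) ?_) ?_
  · exact (hβ.smooth_two.continuous.comp_aestronglyMeasurable (h.memLp_vort_slab hs t).1).mul
      (((h.meas_force i).mono_measure (slab_le hs t)).pow 2)
  · filter_upwards [ae_Ioc h.nrm_force hs t] with r hf
    rw [Real.norm_eq_abs, abs_of_nonneg (integral_nonneg fun x =>
      mul_nonneg (hβ.convex _) (sq_nonneg _))]
    exact integral_truncation_mul_sq_le hβ (hf i).1 (hf i).2

/-- The dissipation at the mollified level. -/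
noncomputable def dissipation (β : ℝ → ℝ) (u : ℝ → Fin 2 → T2 → ℝ) (m : ℕ) (r : ℝ) : ℝ :=
  ∑ j, ∫ x, deriv (deriv β) (molVort m (u r) x) * pd j (molVort m (u r)) x ^ 2

lemma dissipation_nonneg {N N' : ℝ} {β : ℝ → ℝ} (hβ : IsTruncation N N' β) (m : ℕ) (r : ℝ) :
    0 ≤ dissipation β u m r :=
  Finset.sum_nonneg fun _ _ => integral_nonneg fun _ => mul_nonneg (hβ.convex _) (sq_nonneg _)

lemma aesm_dissipation (h : IsFlow F u f D) {N N' : ℝ} {β : ℝ → ℝ} (hβ : IsTruncation N N' β)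
    {s : ℝ} (hs : 0 ≤ s) (t : ℝ) (m : ℕ) :
    AEStronglyMeasurable (dissipation β u m) (volume.restrict (Ioc s t)) := by
  refine Finset.aestronglyMeasurable_fun_sum _ fun j _ => AEStronglyMeasurable.integral_prod_right'
    (μ := volume.restrict (Ioc s t)) (ν := (volume : Measure T2))
    (f := fun z : ℝ × T2 => deriv (deriv β) (molVort m (u z.1) z.2) *
      pd j (molVort m (u z.1)) z.2 ^ 2) ?_
  exact (hβ.smooth_two.continuous.comp_aestronglyMeasurable (h.aesm_molVort hs t m)).mul
    ((h.aesm_pd_molVort hs t m j).pow 2)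

/-- The vorticity balance at the mollified level holds up to an error vanishing in the limit. -/
lemma tendsto_vorticity_error (h : IsFlow F u f D) {N N' : ℝ} {β : ℝ → ℝ}
    (hβ : IsTruncation N N' β) {s t : ℝ} (hs : 0 ≤ s) (hst : s ≤ t) :
    (∀ m, Integrable (fun r => max ((gen (u r) (f r)
      (curl (mol m (fun x => deriv β (molVort m (u r) x)))) + (1 / 2) * dissipation β u m r) -
      forcing β D f r) 0) (volume.restrict (Ioc s t))) ∧
    Filter.Tendsto (fun m => ∫ r in Ioc s t, max ((gen (u r) (f r)
      (curl (mol m (fun x => deriv β (molVort m (u r) x)))) + (1 / 2) * dissipation β u m r) -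
      forcing β D f r) 0) Filter.atTop (nhds 0) := by
  have hN0 := hβ.bound_nonneg
  have hN'0 : 0 ≤ N' := (abs_nonneg _).trans (hβ.abs_third_le 0)
  have hB1 : ∀ s, |deriv (deriv β) s| ≤ 1 := fun s => by
    rw [abs_of_nonneg (hβ.convex s)]; exact hβ.le_one s
  let e : ℕ → ℝ → ℝ := fun m r => (1 / 2) * (∑ i,
    |(∫ x, deriv (deriv β) (mol m (vort (D r)) x) * mol m (f r i) x ^ 2) -
      ∫ x, deriv (deriv β) (vort (D r) x) * f r i x ^ 2|) +
    N * gradNrm (D r) * modulus m (vort (D r))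
  refine tendsto_integral_max_sub (e := e)
    (b := fun r => F ^ 2 + (64 * Real.pi * N) * gradEnergy (D r))
    (fun m => ((intervalIntegrable_iff_integrableOn_Ioc_of_le hst).1
      (h.vorticity_evolution m hβ.smooth hs hst).1).1.add
      ((h.aesm_dissipation hβ hs t m).const_mul _)) (h.integrable_forcing hβ hs t).1
    ((integrable_const _).add ((h.integrable_gradEnergy hs t).const_mul _)) ?_ ?_
  · filter_upwards [ae_Ioc h.sobolev hs t, ae_Ioc h.nrm_force hs t] with r hv hf m
    have hG0 := gradNrm_nonneg (D r)
    have hmod0 := modulus_nonneg m (vort (D r))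
    refine ⟨?_, add_nonneg (mul_nonneg (by norm_num) (Finset.sum_nonneg fun _ _ => abs_nonneg _))
      (by positivity), add_le_add ?_ ?_⟩
    · have h1 := hv.gen_curl_mol_le (fun i => (hf i).1) hβ.smooth hβ.convex hβ.abs_deriv_le m
      have h2 : (1 / 2) * (∑ i, ∫ x, deriv (deriv β) (mol m (vort (D r)) x) *
          mol m (f r i) x ^ 2) ≤ forcing β D f r + (1 / 2) * (∑ i,
          |(∫ x, deriv (deriv β) (mol m (vort (D r)) x) * mol m (f r i) x ^ 2) -
          ∫ x, deriv (deriv β) (vort (D r) x) * f r i x ^ 2|) := by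
        rw [forcing, ← mul_add, ← Finset.sum_add_distrib]
        refine mul_le_mul_of_nonneg_left (Finset.sum_le_sum fun i _ => ?_) (by norm_num)
        have := le_abs_self ((∫ x, deriv (deriv β) (mol m (vort (D r)) x) * mol m (f r i) x ^ 2) -
          ∫ x, deriv (deriv β) (vort (D r) x) * f r i x ^ 2)
        linarith
      simp only [dissipation, molVort_eq m hv, e]
      linarith
    · have key : ∀ i, |(∫ x, deriv (deriv β) (mol m (vort (D r)) x) * mol m (f r i) x ^ 2) -
          ∫ x, deriv (deriv β) (vort (D r) x) * f r i x ^ 2| ≤ F ^ 2 := by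
        intro i
        have q1 := integral_truncation_mul_sq_le hβ (w := mol m (vort (D r)))
          ((smooth_mol m (hf i).1.integrable_two).memLp 2) ((nrm_mol_le m (hf i).1).trans (hf i).2)
        have q2 := integral_truncation_mul_sq_le hβ (w := vort (D r)) (hf i).1 (hf i).2
        have p1 : 0 ≤ ∫ x, deriv (deriv β) (mol m (vort (D r)) x) * mol m (f r i) x ^ 2 :=
          integral_nonneg fun x => mul_nonneg (hβ.convex _) (sq_nonneg _)
        have p2 : 0 ≤ ∫ x, deriv (deriv β) (vort (D r) x) * f r i x ^ 2 :=
          integral_nonneg fun x => mul_nonneg (hβ.convex _) (sq_nonneg _)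
        rw [abs_le]; constructor <;> linarith
      rw [Fin.sum_univ_two]
      linarith [key 0, key 1]
    · have h1 := (modulus_le m hv.memLp_vort).trans
        (mul_le_mul_of_nonneg_left hv.nrm_vort_le (by have := Real.pi_pos; positivity))
      have h2 := mul_le_mul_of_nonneg_left h1 (mul_nonneg hN0 hG0)
      have h3 := mul_le_mul_of_nonneg_left (sq_gradNrm_le (D r))
        (by have := Real.pi_pos; positivity : 0 ≤ 16 * Real.pi * N)
      linarith
  · filter_upwards [ae_Ioc h.sobolev hs t, ae_Ioc h.force hs t] with r hv hf
    have h1 : ∀ i, Filter.Tendsto (fun m =>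
        |(∫ x, deriv (deriv β) (mol m (vort (D r)) x) * mol m (f r i) x ^ 2) -
        ∫ x, deriv (deriv β) (vort (D r) x) * f r i x ^ 2|) Filter.atTop (nhds 0) := by
      intro i
      have := (tendsto_integral_comp_mul_sq hβ.smooth_two.continuous hB1 hN'0 hβ.lipschitz_two
        hv.memLp_vort ((hf i).1.mono_exponent (by norm_num : (4 : ℝ≥0∞) ≤ 8))).sub_const
        (∫ x, deriv (deriv β) (vort (D r) x) * f r i x ^ 2)
      simpa using this.abs
    have h2 := (tendsto_finsetSum Finset.univ fun i _ => h1 i).const_mul (1 / 2 : ℝ)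
    have h3 := (tendsto_modulus hv.memLp_vort).const_mul (N * gradNrm (D r))
    simpa [e] using h2.add h3

/-- The truncated vorticity estimate at the mollified level: the supremum in time of `∫ β` and the
dissipation are both bounded by the data, and Ladyzhenskaya's inequality combines them. -/
lemma integral_molVort_pow_four_le (h : IsFlow F u f D) {N N' : ℝ} {β : ℝ → ℝ}
    (hβ : IsTruncation N N' β) {s t : ℝ} (hs : 0 ≤ s) (hst : s ≤ t) (m : ℕ) {δ : ℝ}
    (hδ : ∫ r in Ioc s t, max ((gen (u r) (f r)
      (curl (mol m (fun x => deriv β (molVort m (u r) x)))) + (1 / 2) * dissipation β u m r) -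
      forcing β D f r) 0 = δ) :
    ∫ r in Ioc s t, ∫ x, deriv β (molVort m (u r) x) ^ 4 ≤ 20 * (1 + (t - s)) *
      ((∫ x, β (molVort m (u s) x)) + (∫ r in Ioc s t, forcing β D f r) + δ) ^ 2 := by
  set μ := (volume : Measure ℝ).restrict (Ioc s t) with hμ
  set g : ℝ → ℝ := fun r => gen (u r) (f r) (curl (mol m (fun x => deriv β (molVort m (u r) x))))
    with hg
  set q := dissipation β u m with hq
  set k := forcing β D f with hk
  set E : ℝ → ℝ := fun r => max (g r + (1 / 2) * q r - k r) 0 with hE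
  have ig : Integrable g μ := (intervalIntegrable_iff_integrableOn_Ioc_of_le hst).1
    (h.vorticity_evolution m hβ.smooth hs hst).1
  have ik : Integrable k μ := h.integrable_forcing hβ hs t
  have hq0 : ∀ r, 0 ≤ q r := dissipation_nonneg hβ m
  have hk0 : ∀ r, 0 ≤ k r := forcing_nonneg hβ
  have hE0 : ∀ r, 0 ≤ E r := fun r => le_max_right _ _
  have hgE : ∀ r, g r + (1 / 2) * q r - k r ≤ E r := fun r => le_max_left _ _
  have iE : Integrable E μ := (h.tendsto_vorticity_error hβ hs hst).1 m
  have iq : Integrable q μ := by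
    refine (((ik.add iE).sub ig).const_mul 2).mono' (h.aesm_dissipation hβ hs t m)
      (.of_forall fun r => ?_)
    rw [Real.norm_eq_abs, abs_of_nonneg (hq0 r)]
    simp only [Pi.add_apply, Pi.sub_apply]
    linarith [hgE r]
  set R := (∫ x, β (molVort m (u s) x)) + (∫ r, k r ∂μ) + δ with hR
  have hΦ0 : ∀ r, 0 ≤ ∫ x, β (molVort m (u r) x) := fun r => integral_nonneg fun x => hβ.nonneg _
  have hRle : ∀ r ∈ Icc s t, (∫ x, β (molVort m (u r) x)) + (1 / 2) * ∫ p in Ioc s r, q p ≤ R := by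
    intro r hr
    have hsub : Ioc s r ⊆ Ioc s t := Ioc_subset_Ioc_right hr.2
    have hle : (volume : Measure ℝ).restrict (Ioc s r) ≤ μ := Measure.restrict_mono hsub le_rfl
    have h1 := (h.vorticity_evolution m hβ.smooth hs hr.1).2
    rw [intervalIntegral.integral_of_le hr.1] at h1
    have h2 : (∫ p in Ioc s r, g p) + (1 / 2) * ∫ p in Ioc s r, q p ≤
        (∫ p in Ioc s r, k p) + ∫ p in Ioc s r, E p := by
      rw [← integral_const_mul, ← integral_add (ig.mono_measure hle)
        ((iq.mono_measure hle).const_mul _),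
        ← integral_add (ik.mono_measure hle) (iE.mono_measure hle)]
      exact integral_mono ((ig.mono_measure hle).add ((iq.mono_measure hle).const_mul _))
        ((ik.mono_measure hle).add (iE.mono_measure hle)) fun p => by
          simp only
          linarith [hgE p]
    have h3 : ∫ p in Ioc s r, k p ≤ ∫ p, k p ∂μ :=
      integral_mono_measure hle (.of_forall hk0) ik
    have h4 : ∫ p in Ioc s r, E p ≤ δ :=
      (integral_mono_measure hle (.of_forall hE0) iE).trans hδ.le
    simp only [hg] at h2
    linarith
  have hR0 : 0 ≤ R := by
    have h1 := hRle s ⟨le_rfl, hst⟩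
    simp only [Ioc_self, Measure.restrict_empty, integral_zero_measure, mul_zero, add_zero] at h1
    exact (hΦ0 s).trans h1
  have hqR : ∫ p, q p ∂μ ≤ 2 * R := by
    have h1 := hRle t ⟨hst, le_rfl⟩
    linarith [hΦ0 t]
  have hpt : ∀ r ∈ Ioc s t, ∫ x, deriv β (molVort m (u r) x) ^ 4 ≤ 10 * R * (2 * R + q r) := by
    intro r hr
    refine hβ.integral_pow_four_le (smooth_molVort m _) ?_
    have h1 := hRle r ⟨hr.1.le, hr.2⟩
    have h2 : 0 ≤ ∫ p in Ioc s r, q p := integral_nonneg hq0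
    linarith
  calc ∫ r, (∫ x, deriv β (molVort m (u r) x) ^ 4) ∂μ ≤ ∫ r, 10 * R * (2 * R + q r) ∂μ := by
        refine integral_mono_of_nonneg (.of_forall fun r => integral_nonneg fun x => by positivity)
          (((integrable_const _).add iq).const_mul _) ?_
        filter_upwards [ae_restrict_mem measurableSet_Ioc] with r hr using hpt r hr
    _ = 10 * R * (2 * R * (t - s) + ∫ r, q r ∂μ) := by
        rw [integral_const_mul, integral_add (integrable_const _) iq, hμ, setIntegral_const,
          Real.volume_real_Ioc_of_le hst, smul_eq_mul]
        ring
    _ ≤ 10 * R * (2 * R * (t - s) + 2 * R) := by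
        refine mul_le_mul_of_nonneg_left ?_ (by positivity)
        linarith
    _ = 20 * (1 + (t - s)) * R ^ 2 := by ring

/-- The truncated vorticity estimate: the limit `m → ∞` of `integral_molVort_pow_four_le`, at the
almost every initial time at which the velocity lies in `H¹`. -/
lemma integral_vort_pow_four_le (h : IsFlow F u f D) {N N' : ℝ} {β : ℝ → ℝ}
    (hβ : IsTruncation N N' β) {s t : ℝ} (hs : 0 ≤ s) (hst : s ≤ t)
    (hv : IsSobolevDivFree (u s) (D s)) :
    ∫ z, deriv β (vort (D z.1) z.2) ^ 4 ∂(slab s t) ≤ 20 * (1 + (t - s)) *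
      ((∫ x, β (vort (D s) x)) + ∫ r in Ioc s t, forcing β D f r) ^ 2 := by
  have hN0 := hβ.bound_nonneg
  have hb : ∀ s, |deriv β s ^ 4| ≤ N ^ 4 := fun s => by
    rw [abs_pow]; exact pow_le_pow_left₀ (abs_nonneg _) (hβ.abs_deriv_le s) 4
  have hc4 : Continuous fun s => deriv β s ^ 4 := hβ.smooth_one.continuous.pow 4
  have hint : Integrable (fun z : ℝ × T2 => deriv β (vort (D z.1) z.2) ^ 4) (slab s t) :=
    (integrable_const (N ^ 4)).mono' (hc4.comp_aestronglyMeasurable (h.memLp_vort_slab hs t).1)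
      (.of_forall fun z => hb _)
  have hlim : Filter.Tendsto (fun m => ∫ r in Ioc s t, ∫ x, deriv β (molVort m (u r) x) ^ 4)
      Filter.atTop (nhds (∫ r in Ioc s t, ∫ x, deriv β (vort (D r) x) ^ 4)) := by
    refine tendsto_integral_of_dominated_convergence (fun _ => N ^ 4) (fun m => ?_)
      (integrable_const _) (fun m => .of_forall fun r => ?_) ?_
    · exact AEStronglyMeasurable.integral_prod_right' (μ := volume.restrict (Ioc s t))
        (ν := (volume : Measure T2)) (f := fun z : ℝ × T2 => deriv β (molVort m (u z.1) z.2) ^ 4)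
        (hc4.comp_aestronglyMeasurable (h.aesm_molVort hs t m))
    · refine (norm_integral_le_of_norm_le_const (μ := (volume : Measure T2)) (.of_forall fun x =>
        hb (molVort m (u r) x))).trans (le_of_eq ?_)
      simp
    · filter_upwards [ae_Ioc h.sobolev hs t] with r hr
      simp_rw [molVort_eq _ hr]
      exact tendsto_integral_lipschitz_comp hc4 (by positivity) hβ.lipschitz_pow hr.memLp_vort
  have hΦ : Filter.Tendsto (fun m => ∫ x, β (molVort m (u s) x)) Filter.atTop
      (nhds (∫ x, β (vort (D s) x))) := by
    simp_rw [molVort_eq _ hv]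
    exact tendsto_integral_lipschitz_comp hβ.smooth.continuous hN0 hβ.lipschitz hv.memLp_vort
  have hR := (((hΦ.add_const (∫ r in Ioc s t, forcing β D f r)).add
    (h.tendsto_vorticity_error hβ hs hst).2).pow 2).const_mul (20 * (1 + (t - s)))
  rw [add_zero] at hR
  rw [integral_prod _ hint]
  exact le_of_tendsto_of_tendsto' hlim hR fun m =>
    h.integral_molVort_pow_four_le hβ hs hst m rfl

end IsFlow

/-! ### Regularized truncations -/

/-- A smooth cutoff, `0` on `(-∞, k]` and `[k + n + 1, ∞)`, that increases to the indicator of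
`(k, ∞)`. -/
noncomputable def cutoff (k : ℝ) (n : ℕ) (s : ℝ) : ℝ :=
  Real.smoothTransition (n * (s - k)) * Real.smoothTransition (n + 1 - (s - k))

lemma contDiff_cutoff (k : ℝ) (n : ℕ) : ContDiff ℝ ∞ (cutoff k n) := by
  unfold cutoff
  refine (Real.smoothTransition.contDiff.comp ?_).mul (Real.smoothTransition.contDiff.comp ?_)
  · fun_prop
  · fun_prop

lemma cutoff_nonneg (k : ℝ) (n : ℕ) (s : ℝ) : 0 ≤ cutoff k n s :=
  mul_nonneg (Real.smoothTransition.nonneg _) (Real.smoothTransition.nonneg _)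

lemma cutoff_le_one (k : ℝ) (n : ℕ) (s : ℝ) : cutoff k n s ≤ 1 :=
  mul_le_one₀ (Real.smoothTransition.le_one _) (Real.smoothTransition.nonneg _)
    (Real.smoothTransition.le_one _)

lemma cutoff_of_le {k s : ℝ} (n : ℕ) (h : s ≤ k) : cutoff k n s = 0 := by
  rw [cutoff, Real.smoothTransition.zero_of_nonpos
    (mul_nonpos_of_nonneg_of_nonpos n.cast_nonneg (sub_nonpos.2 h)), zero_mul]

lemma cutoff_of_ge {k s : ℝ} {n : ℕ} (h : k + n + 1 ≤ s) : cutoff k n s = 0 := by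
  rw [cutoff, Real.smoothTransition.zero_of_nonpos (x := n + 1 - (s - k)) (by linarith), mul_zero]

lemma tendsto_cutoff {k s : ℝ} (h : k < s) :
    Filter.Tendsto (fun n => cutoff k n s) Filter.atTop (nhds 1) := by
  refine tendsto_const_nhds.congr' ?_
  obtain ⟨N, hN⟩ := exists_nat_ge (max (1 / (s - k)) (s - k))
  filter_upwards [Filter.eventually_ge_atTop N] with n hn
  have hn' : (N : ℝ) ≤ n := Nat.cast_le.2 hn
  have h1 : 1 ≤ n * (s - k) := by
    rw [← div_le_iff₀ (sub_pos.2 h)]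
    exact (le_max_left _ _).trans (hN.trans hn')
  have h2 : s - k ≤ n := (le_max_right _ _).trans (hN.trans hn')
  rw [cutoff, Real.smoothTransition.one_of_one_le h1,
    Real.smoothTransition.one_of_one_le (by linarith), one_mul]

lemma exists_abs_deriv_cutoff_le (k : ℝ) (n : ℕ) : ∃ N' : ℝ, ∀ s, |deriv (cutoff k n) s| ≤ N' := by
  have hs : HasCompactSupport (cutoff k n) :=
    HasCompactSupport.intro (isCompact_Icc (a := k) (b := k + n + 1)) fun s hs => by
      by_cases h : s ≤ k
      · exact cutoff_of_le n h
      · refine cutoff_of_ge ?_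
        by_contra h'
        exact hs ⟨(not_le.1 h).le, (not_le.1 h').le⟩
  exact ((contDiff_cutoff k n).continuous_deriv (by simp)).bounded_above_of_compact_support hs.deriv

/-- The primitive of `cutoff k n`, a regularization of `(s - k)₊`. -/
noncomputable def ramp (k : ℝ) (n : ℕ) (s : ℝ) : ℝ := ∫ r in k..s, cutoff k n r

lemma continuous_cutoff (k : ℝ) (n : ℕ) : Continuous (cutoff k n) := (contDiff_cutoff k n).continuous

lemma hasDerivAt_ramp (k : ℝ) (n : ℕ) (s : ℝ) : HasDerivAt (ramp k n) (cutoff k n s) s :=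
  intervalIntegral.integral_hasDerivAt_right ((continuous_cutoff k n).intervalIntegrable _ _)
    ((continuous_cutoff k n).stronglyMeasurableAtFilter _ _) (continuous_cutoff k n).continuousAt

lemma deriv_ramp (k : ℝ) (n : ℕ) : deriv (ramp k n) = cutoff k n :=
  funext fun s => (hasDerivAt_ramp k n s).deriv

lemma contDiff_ramp (k : ℝ) (n : ℕ) : ContDiff ℝ ∞ (ramp k n) :=
  contDiff_infty_iff_deriv.2 ⟨fun s => (hasDerivAt_ramp k n s).differentiableAt,
    deriv_ramp k n ▸ contDiff_cutoff k n⟩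

lemma ramp_of_le {k s : ℝ} (n : ℕ) (h : s ≤ k) : ramp k n s = 0 := by
  rw [ramp, intervalIntegral.integral_symm]
  rw [intervalIntegral.integral_congr (g := fun _ => (0 : ℝ)) fun r hr => ?_]
  · simp
  · rw [uIcc_of_le h] at hr
    exact cutoff_of_le n hr.2

lemma ramp_nonneg (k : ℝ) (n : ℕ) (s : ℝ) : 0 ≤ ramp k n s := by
  rcases le_total s k with h | h
  · exact (ramp_of_le n h).ge
  · exact intervalIntegral.integral_nonneg h fun r _ => cutoff_nonneg k n r

lemma ramp_le (k : ℝ) (n : ℕ) {s : ℝ} (h : k ≤ s) : ramp k n s ≤ s - k := by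
  have := intervalIntegral.integral_mono_on h ((continuous_cutoff k n).intervalIntegrable _ _)
    (intervalIntegrable_const (c := (1 : ℝ)) (μ := volume)) fun r _ => cutoff_le_one k n r
  simpa [ramp] using this

lemma ramp_le_bound (k : ℝ) (n : ℕ) (s : ℝ) : ramp k n s ≤ n + 1 := by
  have hn : (0 : ℝ) ≤ n := n.cast_nonneg
  rcases le_total s k with h | h
  · rw [ramp_of_le n h]; linarith
  rcases le_total s (k + n + 1) with h' | h'
  · exact (ramp_le k n h).trans (by linarith)
  · have h1 := intervalIntegral.integral_add_adjacent_intervals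
      ((continuous_cutoff k n).intervalIntegrable (μ := volume) k (k + n + 1))
      ((continuous_cutoff k n).intervalIntegrable (μ := volume) (k + n + 1) s)
    have h2 : ∫ r in (k + n + 1)..s, cutoff k n r = 0 := by
      rw [intervalIntegral.integral_congr (g := fun _ => (0 : ℝ)) fun r hr => ?_]
      · simp
      · rw [uIcc_of_le h'] at hr
        exact cutoff_of_ge hr.1
    have h3 := ramp_le k n (s := k + n + 1) (by linarith)
    unfold ramp at h3 ⊢
    linarith

lemma tendsto_ramp (k s : ℝ) :
    Filter.Tendsto (fun n => ramp k n s) Filter.atTop (nhds (max (s - k) 0)) := by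
  rcases le_or_gt s k with h | h
  · simp_rw [ramp_of_le _ h]
    rw [max_eq_right (sub_nonpos.2 h)]
    exact tendsto_const_nhds
  · rw [max_eq_left (sub_pos.2 h).le]
    have h1 := intervalIntegral.tendsto_integral_filter_of_dominated_convergence
      (μ := volume) (a := k) (b := s) (F := fun n r => cutoff k n r) (f := fun _ => (1 : ℝ))
      (l := Filter.atTop) (fun _ => (1 : ℝ))
      (.of_forall fun n => (continuous_cutoff k n).aestronglyMeasurable)
      (.of_forall fun n => .of_forall fun r _ => by
        rw [Real.norm_eq_abs, abs_of_nonneg (cutoff_nonneg k n r)]; exact cutoff_le_one k n r)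
      intervalIntegrable_const
      (.of_forall fun r hr => by
        rw [uIoc_of_le h.le] at hr; exact tendsto_cutoff hr.1)
    simpa [ramp] using h1

/-- A regularization of `(s - k)₊² / 2`. -/
noncomputable def trunc (k : ℝ) (n : ℕ) (s : ℝ) : ℝ := ∫ r in k..s, ramp k n r

lemma continuous_ramp (k : ℝ) (n : ℕ) : Continuous (ramp k n) := (contDiff_ramp k n).continuous

lemma hasDerivAt_trunc (k : ℝ) (n : ℕ) (s : ℝ) : HasDerivAt (trunc k n) (ramp k n s) s :=
  intervalIntegral.integral_hasDerivAt_right ((continuous_ramp k n).intervalIntegrable _ _)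
    ((continuous_ramp k n).stronglyMeasurableAtFilter _ _) (continuous_ramp k n).continuousAt

lemma deriv_trunc (k : ℝ) (n : ℕ) : deriv (trunc k n) = ramp k n :=
  funext fun s => (hasDerivAt_trunc k n s).deriv

lemma trunc_of_le {k s : ℝ} (n : ℕ) (h : s ≤ k) : trunc k n s = 0 := by
  rw [trunc, intervalIntegral.integral_symm]
  rw [intervalIntegral.integral_congr (g := fun _ => (0 : ℝ)) fun r hr => ?_]
  · simp
  · rw [uIcc_of_le h] at hr
    exact ramp_of_le n hr.2

lemma trunc_le (k : ℝ) (n : ℕ) (s : ℝ) : trunc k n s ≤ max (s - k) 0 ^ 2 / 2 := by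
  rcases le_total s k with h | h
  · rw [trunc_of_le n h]; positivity
  · have h1 := intervalIntegral.integral_mono_on h ((continuous_ramp k n).intervalIntegrable _ _)
      ((continuous_id.sub continuous_const).intervalIntegrable (μ := volume) k s)
      fun r hr => ramp_le k n hr.1
    simp only [id, Pi.sub_apply] at h1
    rw [intervalIntegral.integral_sub (by simp) (by simp), integral_id,
      intervalIntegral.integral_const, smul_eq_mul] at h1
    rw [max_eq_left (sub_nonneg.2 h), trunc]
    linarith

lemma sq_ramp_le (k : ℝ) (n : ℕ) (s : ℝ) : ramp k n s ^ 2 ≤ 2 * trunc k n s := by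
  rcases le_total s k with h | h
  · rw [ramp_of_le n h, trunc_of_le n h]; simp
  · have hd : ∀ r, HasDerivAt (fun r => 2 * trunc k n r - ramp k n r ^ 2)
        (2 * ramp k n r * (1 - cutoff k n r)) r := fun r => by
      have := ((hasDerivAt_trunc k n r).const_mul 2).sub ((hasDerivAt_ramp k n r).fun_pow 2)
      refine this.congr_deriv ?_
      push_cast; ring
    have hm : Monotone fun r => 2 * trunc k n r - ramp k n r ^ 2 :=
      monotone_of_deriv_nonneg (fun r => (hd r).differentiableAt) fun r => by
        rw [(hd r).deriv]
        exact mul_nonneg (mul_nonneg two_pos.le (ramp_nonneg k n r))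
          (sub_nonneg.2 (cutoff_le_one k n r))
    have := hm h
    simp only [ramp_of_le n le_rfl, trunc_of_le n le_rfl] at this
    linarith

lemma exists_isTruncation (k : ℝ) (n : ℕ) : ∃ N N', IsTruncation N N' (trunc k n) := by
  obtain ⟨N', hN'⟩ := exists_abs_deriv_cutoff_le k n
  refine ⟨n + 1, N', ?_, ?_, ?_, ?_, ?_, ?_⟩
  · exact contDiff_infty_iff_deriv.2 ⟨fun s => (hasDerivAt_trunc k n s).differentiableAt,
      deriv_trunc k n ▸ contDiff_ramp k n⟩
  · rw [deriv_trunc, deriv_ramp]; exact cutoff_nonneg k n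
  · rw [deriv_trunc, deriv_ramp]; exact cutoff_le_one k n
  · rw [deriv_trunc]
    intro s
    rw [abs_of_nonneg (ramp_nonneg k n s)]; exact ramp_le_bound k n s
  · rw [deriv_trunc, deriv_ramp]; exact hN'
  · rw [deriv_trunc]; exact sq_ramp_le k n

lemma deriv_comp_mul (c : ℝ) (β : ℝ → ℝ) :
    deriv (fun s => β (c * s)) = fun s => c * deriv β (c * s) := by
  ext s
  simpa using deriv_comp_mul_left c β s

lemma deriv_mul_comp_mul (c : ℝ) (β : ℝ → ℝ) :
    deriv (fun s => c * β (c * s)) = fun s => c ^ 2 * deriv β (c * s) := by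
  ext s
  rw [deriv_const_mul_field, deriv_comp_mul]; ring

/-- Truncations may be reflected. -/
lemma IsTruncation.comp_mul {N N' : ℝ} {β : ℝ → ℝ} (hβ : IsTruncation N N' β) {σ : ℝ}
    (hσ : |σ| = 1) : IsTruncation N N' (fun s => β (σ * s)) := by
  have hσ2 : σ ^ 2 = 1 := by rw [← sq_abs, hσ, one_pow]
  have h2 : deriv (deriv fun s => β (σ * s)) = fun s => deriv (deriv β) (σ * s) := by
    rw [deriv_comp_mul, deriv_mul_comp_mul, hσ2]; simp
  refine ⟨hβ.smooth.comp (contDiff_const.mul contDiff_id), ?_, ?_, ?_, ?_, ?_⟩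
  · rw [h2]; exact fun s => hβ.convex _
  · rw [h2]; exact fun s => hβ.le_one _
  · rw [deriv_comp_mul]; intro s; rw [abs_mul, hσ, one_mul]; exact hβ.abs_deriv_le _
  · rw [h2, deriv_comp_mul]; intro s; rw [abs_mul, hσ, one_mul]; exact hβ.abs_third_le _
  · rw [deriv_comp_mul]; intro s; simp only; rw [mul_pow, hσ2, one_mul]; exact hβ.sq_deriv_le _

/-- Fatou's lemma for real integrals. -/
lemma integrable_and_integral_le_of_tendsto {α : Type*} [MeasurableSpace α] {μ : Measure α}
    {G : ℕ → α → ℝ} {g : α → ℝ} {R : ℝ} (hG : ∀ n, Integrable (G n) μ) (hG0 : ∀ n z, 0 ≤ G n z)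
    (hR : ∀ n, ∫ z, G n z ∂μ ≤ R) (hlim : ∀ᵐ z ∂μ, Filter.Tendsto (fun n => G n z) Filter.atTop
      (nhds (g z))) : Integrable g μ ∧ ∫ z, g z ∂μ ≤ R := by
  have hgm : AEStronglyMeasurable g μ :=
    aestronglyMeasurable_of_tendsto_ae Filter.atTop (fun n => (hG n).1) hlim
  have hg0 : ∀ᵐ z ∂μ, 0 ≤ g z := by
    filter_upwards [hlim] with z hz
    exact ge_of_tendsto' hz fun n => hG0 n z
  have h1 : ∫⁻ z, ENNReal.ofReal (g z) ∂μ ≤ ENNReal.ofReal R := by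
    calc ∫⁻ z, ENNReal.ofReal (g z) ∂μ
        = ∫⁻ z, Filter.liminf (fun n => ENNReal.ofReal (G n z)) Filter.atTop ∂μ := by
          refine lintegral_congr_ae ?_
          filter_upwards [hlim] with z hz
          exact ((ENNReal.continuous_ofReal.tendsto _).comp hz).liminf_eq.symm
      _ ≤ Filter.liminf (fun n => ∫⁻ z, ENNReal.ofReal (G n z) ∂μ) Filter.atTop :=
          lintegral_liminf_le' fun n => (hG n).1.aemeasurable.ennreal_ofReal
      _ ≤ ENNReal.ofReal R := by
          refine Filter.liminf_le_of_frequently_le' (.of_forall fun n => ?_)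
          rw [← ofReal_integral_eq_lintegral_ofReal (hG n) (.of_forall (hG0 n))]
          exact ENNReal.ofReal_le_ofReal (hR n)
  have hint : Integrable g μ := by
    refine ⟨hgm, ?_⟩
    rw [hasFiniteIntegral_iff_ofReal hg0]
    exact h1.trans_lt ENNReal.ofReal_lt_top
  refine ⟨hint, ?_⟩
  have hR0 : 0 ≤ R := (integral_nonneg (hG0 0)).trans (hR 0)
  rw [← ofReal_integral_eq_lintegral_ofReal hint hg0] at h1
  exact (ENNReal.ofReal_le_ofReal_iff hR0).1 h1

/-- The indicator of `(k, ∞)` as a real function. -/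
noncomputable def above (k s : ℝ) : ℝ := (Ioi k).indicator (fun _ => (1 : ℝ)) s

lemma above_of_lt {k s : ℝ} (h : k < s) : above k s = 1 := indicator_of_mem (mem_Ioi.2 h) _

lemma above_of_le {k s : ℝ} (h : s ≤ k) : above k s = 0 :=
  indicator_of_notMem (fun h' => not_lt.2 h (mem_Ioi.1 h')) _

lemma above_nonneg (k s : ℝ) : 0 ≤ above k s := by
  rcases le_or_gt s k with h | h
  · rw [above_of_le h]
  · rw [above_of_lt h]; exact zero_le_one

lemma above_le_one (k s : ℝ) : above k s ≤ 1 := by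
  rcases le_or_gt s k with h | h
  · rw [above_of_le h]; exact zero_le_one
  · rw [above_of_lt h]

lemma measurable_above (k : ℝ) : Measurable (above k) := measurable_const.indicator measurableSet_Ioi

lemma cutoff_le_above (k : ℝ) (n : ℕ) (s : ℝ) : cutoff k n s ≤ above k s := by
  rcases le_or_gt s k with h | h
  · rw [above_of_le h, cutoff_of_le n h]
  · rw [above_of_lt h]; exact cutoff_le_one k n s

lemma aesm_above {α : Type*} [MeasurableSpace α] {μ : Measure α} {θ : α → ℝ}
    (hθ : AEStronglyMeasurable θ μ) (k : ℝ) : AEStronglyMeasurable (fun z => above k (θ z)) μ :=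
  ((measurable_above k).comp_aemeasurable hθ.aemeasurable).aestronglyMeasurable

namespace IsFlow

variable {F : ℝ} {u f : ℝ → Fin 2 → T2 → ℝ} {D : ℝ → Fin 2 → Fin 2 → T2 → ℝ}

open IsSobolevDivFree

/-- The pointwise squared length of the force. -/
def sqForce (f : ℝ → Fin 2 → T2 → ℝ) (z : ℝ × T2) : ℝ := ∑ i, f z.1 i z.2 ^ 2

lemma memLp_force_slab (h : IsFlow F u f D) {s t : ℝ} (hs : 0 ≤ s) (hst : s ≤ t) (i : Fin 2) :
    MemLp (fun z : ℝ × T2 => f z.1 i z.2) 8 (slab s t) ∧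
      ∫ z, f z.1 i z.2 ^ 8 ∂(slab s t) ≤ F ^ 8 * (t - s) := by
  have hm := (h.meas_force i).mono_measure (slab_le hs t)
  have hf := ae_Ioc h.force hs t
  have hpt : ∀ᵐ r ∂((volume : Measure ℝ).restrict (Ioc s t)), ‖∫ x, ‖f r i x ^ 8‖‖ ≤ F ^ 8 := by
    filter_upwards [hf] with r hr
    have e : ∀ x, ‖f r i x ^ 8‖ = f r i x ^ 8 := fun x => by
      rw [Real.norm_eq_abs, abs_of_nonneg (by positivity)]
    simp_rw [e]
    rw [Real.norm_eq_abs, abs_of_nonneg (integral_nonneg fun x => by positivity)]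
    exact (hr i).2
  have hint : Integrable (fun z : ℝ × T2 => f z.1 i z.2 ^ 8) (slab s t) := by
    have hm8 : AEStronglyMeasurable (fun z : ℝ × T2 => f z.1 i z.2 ^ 8) (slab s t) := hm.pow 8
    rw [integrable_prod_iff hm8]
    refine ⟨?_, (integrable_const (F ^ 8)).mono' hm8.norm.integral_prod_right' hpt⟩
    filter_upwards [hf] with r hr
    have := (hr i).1.integrable_norm_pow (p := 8) (by norm_num)
    refine this.congr (.of_forall fun x => ?_)
    simp only [Real.norm_eq_abs]
    exact Even.pow_abs (by decide) _
  constructor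
  · have h8 := (integrable_norm_rpow_iff hm (p := 8) (by norm_num) (by norm_num)).1 ?_
    · exact h8
    · refine hint.congr (.of_forall fun z => ?_)
      simp only [Real.norm_eq_abs, ENNReal.toReal_ofNat]
      rw [← Even.pow_abs (by decide : Even 8)]
      exact_mod_cast rfl
  · rw [integral_prod _ hint]
    calc ∫ r in Ioc s t, ∫ x, f r i x ^ 8 ≤ ∫ r in Ioc s t, F ^ 8 := by
          refine integral_mono_ae hint.integral_prod_left (integrable_const _) ?_
          filter_upwards [hf] with r hr using (hr i).2
      _ = F ^ 8 * (t - s) := by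
          rw [setIntegral_const, Real.volume_real_Ioc_of_le hst, smul_eq_mul, mul_comm]

lemma integrable_sqForce (h : IsFlow F u f D) {s t : ℝ} (hs : 0 ≤ s) (hst : s ≤ t) :
    Integrable (sqForce f) (slab s t) :=
  integrable_finsetSum _ fun i _ =>
    ((h.memLp_force_slab hs hst i).1.mono_exponent (by norm_num : (2 : ℝ≥0∞) ≤ 8)).integrable_sq

lemma integrable_above_mul_sqForce (h : IsFlow F u f D) {s t : ℝ} (hs : 0 ≤ s) (hst : s ≤ t)
    {θ : ℝ × T2 → ℝ} (hθ : AEStronglyMeasurable θ (slab s t)) (k : ℝ) :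
    Integrable (fun z => above k (θ z) * sqForce f z) (slab s t) :=
  (h.integrable_sqForce hs hst).bdd_mul (c := 1) (aesm_above hθ k) (.of_forall fun z => by
    rw [Real.norm_eq_abs, abs_of_nonneg (above_nonneg _ _)]; exact above_le_one _ _)

/-- The estimate for the level `k` of the vorticity or of its negative. -/
lemma level_estimate (h : IsFlow F u f D) {σ : ℝ} (hσ : |σ| = 1) (k : ℝ) {s t : ℝ} (hs : 0 ≤ s)
    (hst : s ≤ t) (hv : IsSobolevDivFree (u s) (D s)) (hk : 0 ≤ k) :
    Integrable (fun z : ℝ × T2 => max (σ * vort (D z.1) z.2 - k) 0 ^ 4) (slab s t) ∧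
    ∫ z, max (σ * vort (D z.1) z.2 - k) 0 ^ 4 ∂(slab s t) ≤ 5 * (1 + (t - s)) *
      ((∫ x, max (σ * vort (D s) x - k) 0 ^ 2) +
        ∫ z, above k (σ * vort (D z.1) z.2) * sqForce f z ∂(slab s t)) ^ 2 := by
  choose N N' hβ using exists_isTruncation k
  have hβσ := fun n => (hβ n).comp_mul hσ
  have hd1 : ∀ n s, deriv (fun s => trunc k n (σ * s)) s ^ 4 = ramp k n (σ * s) ^ 4 := fun n s => by
    rw [deriv_comp_mul, deriv_trunc]
    simp only
    rw [mul_pow, ← Even.pow_abs (by decide : Even 4) σ, hσ, one_pow, one_mul]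
  have hd2 : ∀ n s, deriv (deriv fun s => trunc k n (σ * s)) s = cutoff k n (σ * s) := fun n s => by
    rw [deriv_comp_mul, deriv_mul_comp_mul, deriv_trunc, deriv_ramp, ← sq_abs, hσ]; simp
  have hω := h.memLp_vort_slab hs t
  have hθ : AEStronglyMeasurable (fun z : ℝ × T2 => σ * vort (D z.1) z.2) (slab s t) :=
    hω.1.const_mul σ
  have hmain := fun n => h.integral_vort_pow_four_le (hβσ n) hs hst hv
  have isq : Integrable (fun x => max (σ * vort (D s) x - k) 0 ^ 2) volume := by
    have hm : AEStronglyMeasurable (fun x => max (σ * vort (D s) x - k) 0) volume :=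
      ((hv.memLp_vort.1.const_mul σ).sub aestronglyMeasurable_const).sup aestronglyMeasurable_const
    refine hv.memLp_vort.integrable_sq.mono' (hm.pow 2) (.of_forall fun x => ?_)
    rw [Real.norm_eq_abs, abs_of_nonneg (sq_nonneg _), sq_le_sq, abs_of_nonneg (le_max_right _ _)]
    refine max_le ?_ (abs_nonneg _)
    have := le_abs_self (σ * vort (D s) x)
    rw [abs_mul, hσ, one_mul] at this
    linarith
  have hb1 : ∀ n, ∫ x, trunc k n (σ * vort (D s) x) ≤
      (1 / 2) * ∫ x, max (σ * vort (D s) x - k) 0 ^ 2 := by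
    intro n
    rw [← integral_const_mul]
    refine integral_mono_of_nonneg (.of_forall fun x => (hβ n).nonneg _) (isq.const_mul _)
      (.of_forall fun x => ?_)
    have := trunc_le k n (σ * vort (D s) x)
    simp only
    linarith
  have iH := h.integrable_above_mul_sqForce hs hst hθ k
  have hb2 : ∀ n, ∫ r in Ioc s t, forcing (fun s => trunc k n (σ * s)) D f r ≤
      (1 / 2) * ∫ z, above k (σ * vort (D z.1) z.2) * sqForce f z ∂(slab s t) := by
    intro n
    rw [integral_prod _ iH, ← integral_const_mul]
    refine integral_mono_ae (h.integrable_forcing (hβσ n) hs t)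
      (iH.integral_prod_left.const_mul _) ?_
    filter_upwards [ae_Ioc h.nrm_force hs t, ae_Ioc h.sobolev hs t] with r hf hvr
    simp only [forcing, hd2]
    refine mul_le_mul_of_nonneg_left ?_ (by norm_num)
    have iu : ∀ i, Integrable (fun x => above k (σ * vort (D r) x) * f r i x ^ 2) volume := fun i =>
      (hf i).1.integrable_sq.bdd_mul (c := 1) (aesm_above (hvr.memLp_vort.1.const_mul σ) k)
        (.of_forall fun x => by
          rw [Real.norm_eq_abs, abs_of_nonneg (above_nonneg _ _)]; exact above_le_one _ _)
    simp only [sqForce, Finset.mul_sum]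
    rw [integral_finsetSum _ fun i _ => iu i]
    exact Finset.sum_le_sum fun i _ => integral_mono_of_nonneg
      (.of_forall fun x => mul_nonneg (cutoff_nonneg _ _ _) (sq_nonneg _)) (iu i)
      (.of_forall fun x => mul_le_mul_of_nonneg_right (cutoff_le_above _ _ _) (sq_nonneg _))
  have hG : ∀ n, Integrable (fun z : ℝ × T2 => ramp k n (σ * vort (D z.1) z.2) ^ 4)
      (slab s t) := by
    intro n
    have hm := ((continuous_ramp k n).pow 4).comp_aestronglyMeasurable hθ
    refine (integrable_const (((n : ℝ) + 1) ^ 4)).mono' hm (.of_forall fun z => ?_)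
    rw [Real.norm_eq_abs, abs_of_nonneg (pow_nonneg (ramp_nonneg _ _ _) 4)]
    exact pow_le_pow_left₀ (ramp_nonneg _ _ _) (ramp_le_bound _ _ _) 4
  have hlim : ∀ z : ℝ × T2, Filter.Tendsto (fun n => ramp k n (σ * vort (D z.1) z.2) ^ 4)
      Filter.atTop (nhds (max (σ * vort (D z.1) z.2 - k) 0 ^ 4)) := fun z => (tendsto_ramp k _).pow 4
  have hR : ∀ n, ∫ z, ramp k n (σ * vort (D z.1) z.2) ^ 4 ∂(slab s t) ≤ 5 * (1 + (t - s)) *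
      ((∫ x, max (σ * vort (D s) x - k) 0 ^ 2) +
        ∫ z, above k (σ * vort (D z.1) z.2) * sqForce f z ∂(slab s t)) ^ 2 := by
    intro n
    have h1 := hmain n
    simp only [hd1] at h1
    have p1 : 0 ≤ ∫ x, trunc k n (σ * vort (D s) x) := integral_nonneg fun x => (hβ n).nonneg _
    have p2 : 0 ≤ ∫ r in Ioc s t, forcing (fun s => trunc k n (σ * s)) D f r :=
      integral_nonneg (forcing_nonneg (hβσ n))
    have h2 := pow_le_pow_left₀ (add_nonneg p1 p2) (add_le_add (hb1 n) (hb2 n)) 2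
    have h3 := h1.trans (mul_le_mul_of_nonneg_left h2 (by linarith : 0 ≤ 20 * (1 + (t - s))))
    have e : ∀ a b c : ℝ, 20 * c * (1 / 2 * a + 1 / 2 * b) ^ 2 = 5 * c * (a + b) ^ 2 :=
      fun a b c => by ring
    rwa [e] at h3
  exact integrable_and_integral_le_of_tendsto hG
    (fun n z => pow_nonneg (ramp_nonneg _ _ _) 4) hR (.of_forall hlim)

end IsFlow

/-! ### De Giorgi iteration -/

lemma slab_mono {a a' b b' : ℝ} (ha : a ≤ a') (hb : b' ≤ b) : slab a' b' ≤ slab a b :=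
  Measure.prod_mono (Measure.restrict_mono (Ioc_subset_Ioc ha hb) le_rfl) le_rfl

lemma slab_univ_le {a b : ℝ} (hab : a ≤ b) (h1 : b - a ≤ 1) : (slab a b).real univ ≤ 1 := by
  have : (slab a b).real univ = b - a := by
    rw [measureReal_def, ← univ_prod_univ, Measure.prod_prod, Measure.restrict_apply_univ]
    simp [hab]
  rw [this]; exact h1

namespace IsFlow

variable {F : ℝ} {u f : ℝ → Fin 2 → T2 → ℝ} {D : ℝ → Fin 2 → Fin 2 → T2 → ℝ}

open IsSobolevDivFree

/-- The vorticity, up to a factor `σ`, exceeding the level `k`. -/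
noncomputable def excess (σ : ℝ) (D : ℝ → Fin 2 → Fin 2 → T2 → ℝ) (k : ℝ) (z : ℝ × T2) : ℝ :=
  max (σ * vort (D z.1) z.2 - k) 0

lemma excess_nonneg (σ k : ℝ) (z : ℝ × T2) : 0 ≤ excess σ D k z := le_max_right _ _

lemma excess_anti (σ : ℝ) {k l : ℝ} (hkl : k ≤ l) (z : ℝ × T2) : excess σ D l z ≤ excess σ D k z :=
  max_le_max_right 0 (by linarith)

/-- The indicator that the vorticity, up to a factor `σ`, exceeds the level `k`. -/
noncomputable def isOver (σ : ℝ) (D : ℝ → Fin 2 → Fin 2 → T2 → ℝ) (k : ℝ) (z : ℝ × T2) : ℝ :=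
  above k (σ * vort (D z.1) z.2)

lemma excess_sq_mul_le (σ : ℝ) {k l : ℝ} (hkl : k ≤ l) (z : ℝ × T2) :
    excess σ D l z ^ 2 * (l - k) ^ 2 ≤ excess σ D k z ^ 4 := by
  unfold excess
  rcases le_or_gt (σ * vort (D z.1) z.2) l with h | h
  · rw [max_eq_right (sub_nonpos.2 h)]
    simp
  · rw [max_eq_left (by linarith), max_eq_left (by linarith), ← mul_pow,
      show ∀ x : ℝ, x ^ 4 = (x * x) ^ 2 from fun x => by ring]
    exact pow_le_pow_left₀ (mul_nonneg (by linarith) (by linarith))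
      (mul_le_mul (by linarith) (by linarith) (by linarith) (by linarith)) 2

lemma isOver_mul_le (σ : ℝ) {k l : ℝ} (hkl : k ≤ l) (z : ℝ × T2) :
    isOver σ D l z * (l - k) ^ 4 ≤ excess σ D k z ^ 4 := by
  unfold excess isOver
  rcases le_or_gt (σ * vort (D z.1) z.2) l with h | h
  · rw [above_of_le h, zero_mul]
    exact pow_nonneg (le_max_right _ _) 4
  · rw [above_of_lt h, one_mul, max_eq_left (by linarith)]
    exact pow_le_pow_left₀ (by linarith) (by linarith) 4

lemma aesm_excess (h : IsFlow F u f D) (σ k : ℝ) {s : ℝ} (hs : 0 ≤ s) (t : ℝ) :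
    AEStronglyMeasurable (excess σ D k) (slab s t) :=
  (((h.memLp_vort_slab hs t).1.const_mul σ).sub aestronglyMeasurable_const).sup
    aestronglyMeasurable_const

lemma aesm_isOver (h : IsFlow F u f D) (σ k : ℝ) {s : ℝ} (hs : 0 ≤ s) (t : ℝ) :
    AEStronglyMeasurable (isOver σ D k) (slab s t) :=
  aesm_above ((h.memLp_vort_slab hs t).1.const_mul σ) k

lemma integrable_isOver (h : IsFlow F u f D) (σ k : ℝ) {s : ℝ} (hs : 0 ≤ s) (t : ℝ) :
    Integrable (isOver σ D k) (slab s t) :=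
  (integrable_const (1 : ℝ)).mono' (h.aesm_isOver σ k hs t) (.of_forall fun z => by
    rw [Real.norm_eq_abs, isOver, abs_of_nonneg (above_nonneg _ _)]; exact above_le_one _ _)

lemma excess_sq_le {σ : ℝ} (hσ : |σ| = 1) {k : ℝ} (hk : 0 ≤ k) (z : ℝ × T2) :
    excess σ D k z ^ 2 ≤ vort (D z.1) z.2 ^ 2 := by
  rw [sq_le_sq, abs_of_nonneg (excess_nonneg _ _ _)]
  refine max_le ?_ (abs_nonneg _)
  have := le_abs_self (σ * vort (D z.1) z.2)
  rw [abs_mul, hσ, one_mul] at this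
  linarith

lemma integrable_excess_sq (h : IsFlow F u f D) {σ : ℝ} (hσ : |σ| = 1) {k : ℝ} (hk : 0 ≤ k) {s : ℝ}
    (hs : 0 ≤ s) (t : ℝ) : Integrable (fun z => excess σ D k z ^ 2) (slab s t) :=
  (h.memLp_vort_slab hs t).integrable_sq.mono' ((h.aesm_excess σ k hs t).pow 2)
    (.of_forall fun z => by
      rw [Real.norm_eq_abs, abs_of_nonneg (sq_nonneg _)]; exact excess_sq_le hσ hk z)

/-- The force on the set where the vorticity exceeds `k`: the higher integrability of the force
yields a power larger than `1` of the measure `≤ y²` of that set. -/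
lemma sq_integral_isOver_mul_sqForce_le (h : IsFlow F u f D) (σ k : ℝ) {s t : ℝ} (hs : 0 ≤ s)
    (hst : s ≤ t) (h1 : t - s ≤ 1) {y : ℝ} (hy : 0 ≤ y) (hA : ∫ z, isOver σ D k z ∂(slab s t) ≤ y ^ 2) :
    (∫ z, isOver σ D k z * sqForce f z ∂(slab s t)) ^ 2 ≤ 4 * F ^ 4 * y ^ 3 := by
  have mJ : MemLp (isOver σ D k) ∞ (slab s t) :=
    memLp_top_of_bound (h.aesm_isOver σ k hs t) 1 (.of_forall fun z => by
      rw [Real.norm_eq_abs, isOver, abs_of_nonneg (above_nonneg _ _)]; exact above_le_one _ _)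
  have mJ2 : MemLp (isOver σ D k) 2 (slab s t) := mJ.mono_exponent le_top
  have hJ0 : ∀ z, 0 ≤ isOver σ D k z := fun z => above_nonneg _ _
  have hJJ : ∀ z, isOver σ D k z * isOver σ D k z = isOver σ D k z := fun z => by
    unfold isOver
    rcases le_or_gt (σ * vort (D z.1) z.2) k with h | h
    · rw [above_of_le h, mul_zero]
    · rw [above_of_lt h, mul_one]
  have mf := fun i => h.memLp_force_slab hs hst i
  have msq : ∀ {g : ℝ × T2 → ℝ} {p q : ℝ≥0∞}, p = 2 * q → MemLp g p (slab s t) →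
      MemLp (fun x => g x ^ 2) q (slab s t) := by
    intro g p q hpq hg
    have : ENNReal.HolderTriple p p q := ⟨by
      rw [hpq, ENNReal.mul_inv (by simp) (by simp), ← add_mul, ENNReal.inv_two_add_inv_two, one_mul]⟩
    refine (memLp_congr_ae (.of_forall fun x => ?_)).1 (hg.mul hg (r := q))
    simp [sq]
  have mH : MemLp (sqForce f) 4 (slab s t) :=
    memLp_finsetSum Finset.univ fun i _ => msq (by norm_num) (mf i).1
  have mHH : MemLp (fun z => sqForce f z ^ 2) 2 (slab s t) := msq (by norm_num) mH
  have mH2 : MemLp (sqForce f) 2 (slab s t) := mH.mono_exponent (by norm_num)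
  have hH0 : ∀ z, 0 ≤ sqForce f z := fun z => Finset.sum_nonneg fun i _ => sq_nonneg _
  set A := ∫ z, isOver σ D k z ∂(slab s t) with hAdef
  have hA0 : 0 ≤ A := integral_nonneg hJ0
  have hJsq : ∫ z, isOver σ D k z ^ 2 ∂(slab s t) = A := by
    simp_rw [sq, hJJ]; rfl
  have hH4 : ∫ z, (sqForce f z ^ 2) ^ 2 ∂(slab s t) ≤ 16 * F ^ 8 := by
    have i8 : ∀ i, Integrable (fun z : ℝ × T2 => f z.1 i z.2 ^ 8) (slab s t) := fun i => by
      have := (msq (q := 2) (by norm_num) (msq (q := 4) (by norm_num) (mf i).1)).integrable_sq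
      refine this.congr (.of_forall fun z => ?_)
      simp only
      ring
    calc ∫ z, (sqForce f z ^ 2) ^ 2 ∂(slab s t)
        ≤ ∫ z, (8 * f z.1 0 z.2 ^ 8 + 8 * f z.1 1 z.2 ^ 8) ∂(slab s t) := by
          refine integral_mono mHH.integrable_sq (((i8 0).const_mul 8).add ((i8 1).const_mul 8))
            fun z => ?_
          simp only [sqForce, Fin.sum_univ_two]
          set a := f z.1 0 z.2 ^ 2
          set b := f z.1 1 z.2 ^ 2
          have e1 : (a + b) ^ 2 ≤ 2 * (a ^ 2 + b ^ 2) := by nlinarith [sq_nonneg (a - b)]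
          have e2 := pow_le_pow_left₀ (sq_nonneg (a + b)) e1 2
          have e3 : (2 * (a ^ 2 + b ^ 2)) ^ 2 ≤ 8 * (a ^ 4 + b ^ 4) := by
            nlinarith [sq_nonneg (a ^ 2 - b ^ 2)]
          calc ((a + b) ^ 2) ^ 2 ≤ 8 * (a ^ 4 + b ^ 4) := e2.trans e3
            _ = 8 * f z.1 0 z.2 ^ 8 + 8 * f z.1 1 z.2 ^ 8 := by simp only [a, b]; ring
      _ ≤ 16 * F ^ 8 := by
          rw [integral_add ((i8 0).const_mul 8) ((i8 1).const_mul 8), integral_const_mul,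
            integral_const_mul]
          have hF8 : F ^ 8 * (t - s) ≤ F ^ 8 * 1 := mul_le_mul_of_nonneg_left h1 (by positivity)
          linarith [(mf 0).2, (mf 1).2]
  set P := ∫ z, isOver σ D k z * sqForce f z ∂(slab s t) with hP
  set Q := ∫ z, isOver σ D k z * sqForce f z ^ 2 ∂(slab s t) with hQ
  have hP0 : 0 ≤ P := integral_nonneg fun z => mul_nonneg (hJ0 z) (hH0 z)
  have hQ0 : 0 ≤ Q := integral_nonneg fun z => mul_nonneg (hJ0 z) (sq_nonneg _)
  have hPQ : P ^ 2 ≤ A * Q := by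
    have mJH : MemLp (fun z => isOver σ D k z * sqForce f z) 2 (slab s t) := mH2.mul mJ
    have hc := integral_abs_mul_le_sqrt mJ2 mJH
    have e1 : ∫ z, |isOver σ D k z * (isOver σ D k z * sqForce f z)| ∂(slab s t) = P := by
      refine integral_congr_ae (.of_forall fun z => ?_)
      simp only
      rw [← mul_assoc, hJJ, abs_of_nonneg (mul_nonneg (hJ0 z) (hH0 z))]
    have e2 : ∫ z, (isOver σ D k z * sqForce f z) ^ 2 ∂(slab s t) = Q := by
      refine integral_congr_ae (.of_forall fun z => ?_)
      simp only
      rw [mul_pow, sq (isOver σ D k z), hJJ]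
    rw [e1, e2, hJsq, ← Real.sqrt_mul hA0] at hc
    exact (Real.le_sqrt hP0 (mul_nonneg hA0 hQ0)).1 hc
  have hQA : Q ^ 2 ≤ A * (16 * F ^ 8) := by
    have hc := integral_abs_mul_le_sqrt mJ2 mHH
    have e1 : ∫ z, |isOver σ D k z * sqForce f z ^ 2| ∂(slab s t) = Q := by
      refine integral_congr_ae (.of_forall fun z => ?_)
      simp only
      rw [abs_of_nonneg (mul_nonneg (hJ0 z) (sq_nonneg _))]
    rw [e1, hJsq, ← Real.sqrt_mul hA0] at hc
    have hc' := (Real.le_sqrt hQ0 (mul_nonneg hA0 (integral_nonneg fun z => sq_nonneg _))).1 hc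
    exact hc'.trans (mul_le_mul_of_nonneg_left hH4 hA0)
  have hQy : Q ≤ 4 * F ^ 4 * y := by
    refine le_of_pow_le_pow_left₀ two_ne_zero (by positivity) ?_
    calc Q ^ 2 ≤ y ^ 2 * (16 * F ^ 8) := hQA.trans (mul_le_mul_of_nonneg_right hA (by positivity))
      _ = _ := by ring
  calc P ^ 2 ≤ y ^ 2 * (4 * F ^ 4 * y) := hPQ.trans (mul_le_mul hA hQy hQ0 (sq_nonneg y))
    _ = _ := by ring

/-- One step of the iteration: shrinking the time interval costs the starting values, which are
chosen below their average. -/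
lemma integral_excess_pow_four_le (h : IsFlow F u f D) {σ : ℝ} (hσ : |σ| = 1) {a b T l : ℝ}
    (ha : 0 ≤ a) (hab : a < b) (hbT : b ≤ T) (hT : T - a ≤ 1) (hl : 0 ≤ l) :
    Integrable (fun z => excess σ D l z ^ 4) (slab b T) ∧
    ∫ z, excess σ D l z ^ 4 ∂(slab b T) ≤ 10 * ((∫ z, excess σ D l z ^ 2 ∂(slab a T)) / (b - a) +
      ∫ z, isOver σ D l z * sqForce f z ∂(slab a T)) ^ 2 := by
  have i2 := h.integrable_excess_sq hσ hl ha b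
  have hgood : ∀ᵐ s ∂((volume : Measure ℝ).restrict (Ioc a b)),
      IsSobolevDivFree (u s) (D s) ∧ s ∈ Ioc a b := by
    filter_upwards [ae_Ioc h.sobolev ha b, ae_restrict_mem measurableSet_Ioc] with s h1 h2
    exact ⟨h1, h2⟩
  have hne : (volume : Measure ℝ).restrict (Ioc a b) ≠ 0 := by
    rw [Ne, Measure.restrict_eq_zero]; simp [hab]
  obtain ⟨s, hsN, hs⟩ := exists_notMem_null_le_average hne i2.integral_prod_left
    (ae_iff.1 hgood)
  simp only [mem_ofPred_eq, not_not] at hsN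
  obtain ⟨hv, hsab⟩ := hsN
  rw [average_eq, measureReal_restrict_apply_univ, Real.volume_real_Ioc_of_le hab.le,
    ← integral_prod _ i2, smul_eq_mul, inv_mul_eq_div] at hs
  have hs0 : 0 ≤ s := ha.trans hsab.1.le
  have hsT : s ≤ T := hsab.2.trans hbT
  obtain ⟨hi, hle⟩ := h.level_estimate hσ l hs0 hsT hv hl
  have hbs : slab b T ≤ slab s T := slab_mono hsab.2 le_rfl
  refine ⟨hi.mono_measure hbs, ?_⟩
  have hm1 : ∫ z, excess σ D l z ^ 4 ∂(slab b T) ≤ ∫ z, excess σ D l z ^ 4 ∂(slab s T) :=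
    integral_mono_measure hbs (.of_forall fun z => pow_nonneg (excess_nonneg _ _ _) 4) hi
  have hm2 : ∫ z, excess σ D l z ^ 2 ∂(slab a b) ≤ ∫ z, excess σ D l z ^ 2 ∂(slab a T) :=
    integral_mono_measure (slab_mono le_rfl hbT) (.of_forall fun z => sq_nonneg _)
      (h.integrable_excess_sq hσ hl ha T)
  have iH := h.integrable_above_mul_sqForce ha (hab.le.trans hbT)
    ((h.memLp_vort_slab ha T).1.const_mul σ) l
  have hm3 : ∫ z, isOver σ D l z * sqForce f z ∂(slab s T) ≤
      ∫ z, isOver σ D l z * sqForce f z ∂(slab a T) :=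
    integral_mono_measure (slab_mono hsab.1.le le_rfl) (.of_forall fun z =>
      mul_nonneg (above_nonneg _ _) (Finset.sum_nonneg fun i _ => sq_nonneg _)) iH
  have p1 : 0 ≤ ∫ x, max (σ * vort (D s) x - l) 0 ^ 2 := integral_nonneg fun x => sq_nonneg _
  have p2 : 0 ≤ ∫ z, isOver σ D l z * sqForce f z ∂(slab s T) := integral_nonneg fun z =>
    mul_nonneg (above_nonneg _ _) (Finset.sum_nonneg fun i _ => sq_nonneg _)
  have hm4 : ∫ x, max (σ * vort (D s) x - l) 0 ^ 2 ≤
      (∫ z, excess σ D l z ^ 2 ∂(slab a T)) / (b - a) :=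
    hs.trans (div_le_div_of_nonneg_right hm2 (sub_pos.2 hab).le)
  have hsq := pow_le_pow_left₀ (add_nonneg p1 p2) (add_le_add hm4 hm3) 2
  refine hm1.trans (hle.trans (mul_le_mul (by linarith [hsab.1]) hsq (sq_nonneg _) (by norm_num)))

/-- The recursive inequality of the iteration, for a level `l > k`. -/
lemma integral_excess_pow_four_le_of_le (h : IsFlow F u f D) {σ : ℝ} (hσ : |σ| = 1)
    {a b T k l X y : ℝ} (ha : 0 ≤ a) (hab : a < b) (hbT : b ≤ T) (hT : T - a ≤ 1) (hk : 0 ≤ k)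
    (hkl : k < l) (hi : Integrable (fun z => excess σ D k z ^ 4) (slab a T))
    (hX : ∫ z, excess σ D k z ^ 4 ∂(slab a T) ≤ X) (hy : 0 ≤ y) (hXy : X ≤ (l - k) ^ 4 * y ^ 2) :
    Integrable (fun z => excess σ D l z ^ 4) (slab b T) ∧
    ∫ z, excess σ D l z ^ 4 ∂(slab b T) ≤
      20 * ((X / ((l - k) ^ 2 * (b - a))) ^ 2 + 4 * F ^ 4 * y ^ 3) := by
  obtain ⟨h1, h2⟩ := h.integral_excess_pow_four_le hσ ha hab hbT hT (hk.trans hkl.le)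
  refine ⟨h1, h2.trans ?_⟩
  have hd : 0 < l - k := sub_pos.2 hkl
  have hba : 0 < b - a := sub_pos.2 hab
  have b1 : ∫ z, excess σ D l z ^ 2 ∂(slab a T) ≤ X / (l - k) ^ 2 := by
    rw [le_div_iff₀ (by positivity), ← integral_mul_const]
    exact (integral_mono ((h.integrable_excess_sq hσ (hk.trans hkl.le) ha T).mul_const _) hi
      fun z => excess_sq_mul_le σ hkl.le z).trans hX
  have b2 : ∫ z, isOver σ D l z ∂(slab a T) ≤ y ^ 2 := by
    rw [← mul_le_mul_iff_left₀ (by positivity : 0 < (l - k) ^ 4), ← integral_mul_const]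
    refine (integral_mono ((h.integrable_isOver σ l ha T).mul_const _) hi
      fun z => isOver_mul_le σ hkl.le z).trans (hX.trans (hXy.trans (le_of_eq (mul_comm _ _))))
  have b3 := h.sq_integral_isOver_mul_sqForce_le σ l ha (hab.le.trans hbT) hT hy b2
  have b4 : (∫ z, excess σ D l z ^ 2 ∂(slab a T)) / (b - a) ≤ X / ((l - k) ^ 2 * (b - a)) := by
    rw [← div_div]; exact div_le_div_of_nonneg_right b1 hba.le
  have b5 := pow_le_pow_left₀ (div_nonneg (integral_nonneg fun z => sq_nonneg _) hba.le) b4 2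
  nlinarith [sq_nonneg ((∫ z, excess σ D l z ^ 2 ∂(slab a T)) / (b - a) -
    ∫ z, isOver σ D l z * sqForce f z ∂(slab a T))]

/-- The first step of the iteration, at level zero. -/
lemma integral_excess_zero_pow_four_le (h : IsFlow F u f D) {σ : ℝ} (hσ : |σ| = 1)
    {a b T : ℝ} (ha : 0 ≤ a) (hab : a < b) (hbT : b ≤ T) (hT : T - a ≤ 1) :
    Integrable (fun z => excess σ D 0 z ^ 4) (slab b T) ∧
    ∫ z, excess σ D 0 z ^ 4 ∂(slab b T) ≤
      20 * (((∫ z, vort (D z.1) z.2 ^ 2 ∂(slab a T)) / (b - a)) ^ 2 + 4 * F ^ 4) := by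
  obtain ⟨h1, h2⟩ := h.integral_excess_pow_four_le hσ ha hab hbT hT le_rfl
  refine ⟨h1, h2.trans ?_⟩
  have hba : 0 < b - a := sub_pos.2 hab
  have b1 : ∫ z, excess σ D 0 z ^ 2 ∂(slab a T) ≤ ∫ z, vort (D z.1) z.2 ^ 2 ∂(slab a T) :=
    integral_mono (h.integrable_excess_sq hσ le_rfl ha T) (h.memLp_vort_slab ha T).integrable_sq
      fun z => excess_sq_le hσ le_rfl z
  have b2 : ∫ z, isOver σ D 0 z ∂(slab a T) ≤ 1 ^ 2 := by
    refine (integral_mono (h.integrable_isOver σ 0 ha T) (integrable_const 1)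
      fun z => above_le_one _ _).trans ?_
    rw [integral_const, smul_eq_mul, mul_one, one_pow]
    exact slab_univ_le (hab.le.trans hbT) hT
  have b3 := h.sq_integral_isOver_mul_sqForce_le σ 0 ha (hab.le.trans hbT) hT zero_le_one b2
  have b5 := pow_le_pow_left₀ (div_nonneg (integral_nonneg fun z => sq_nonneg _) hba.le)
    (div_le_div_of_nonneg_right b1 hba.le) 2
  nlinarith [sq_nonneg ((∫ z, excess σ D 0 z ^ 2 ∂(slab a T)) / (b - a) -
    ∫ z, isOver σ D 0 z * sqForce f z ∂(slab a T))]

/-- The smallness of the normalized excess that makes the iteration converge: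
`104857600 = 5² · 2²²` absorbs the constants of the step and the factors `2 ^ j` of the gaps between
consecutive levels and times. -/
noncomputable def smallness (τ : ℝ) : ℝ := τ ^ 2 / 104857600

/-- De Giorgi's iteration over the levels `K (1 - 2⁻ʲ)` and the starting times
`s + τ / 2 - 2⁻ʲ τ / 4`: the fourth powers of the excess decay geometrically. -/
lemma iteration (h : IsFlow F u f D) {σ : ℝ} (hσ : |σ| = 1) {s τ K : ℝ} (hs : 0 ≤ s) (hτ : 0 < τ)
    (hτ1 : τ ≤ 1) (hK : 0 < K)
    (hKE : 18 / (τ * smallness τ) * ((∫ z, vort (D z.1) z.2 ^ 2 ∂(slab s (s + τ))) + F ^ 2) ≤ K ^ 2)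
    (j : ℕ) :
    Integrable (fun z => excess σ D (K * (1 - (1 / 2) ^ j)) z ^ 4)
      (slab (s + τ / 2 - τ / 4 * (1 / 2) ^ j) (s + τ)) ∧
    ∫ z, excess σ D (K * (1 - (1 / 2) ^ j)) z ^ 4 ∂(slab (s + τ / 2 - τ / 4 * (1 / 2) ^ j) (s + τ)) ≤
      K ^ 4 * (smallness τ * (1 / 64) ^ j) ^ 2 := by
  set e := smallness τ with he
  have he0 : 0 < e := by rw [he, smallness]; positivity
  have hτ2 : τ ^ 2 ≤ 1 := pow_le_one₀ hτ.le hτ1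
  have he1 : e ≤ 1 := by rw [he, smallness]; linarith
  have heτ : e * 104857600 = τ ^ 2 := by rw [he, smallness]; ring
  set E := ∫ z, vort (D z.1) z.2 ^ 2 ∂(slab s (s + τ)) with hE
  have hE0 : 0 ≤ E := integral_nonneg fun z => sq_nonneg _
  have hF0 := h.nonneg
  have hKE' : 18 * (E + F ^ 2) ≤ K ^ 2 * (τ * e) := by
    rwa [div_mul_eq_mul_div, div_le_iff₀ (mul_pos hτ he0)] at hKE
  have hτe : τ * e ≤ 1 := mul_le_one₀ hτ1 he0.le he1
  have hFK : F ≤ K := by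
    refine le_of_pow_le_pow_left₀ two_ne_zero hK.le ?_
    nlinarith [mul_le_mul_of_nonneg_left hτe (sq_nonneg K), sq_nonneg F]
  have hFK4 : F ^ 4 ≤ K ^ 4 := pow_le_pow_left₀ hF0 hFK 4
  induction j with
  | zero =>
    have h0 := h.integral_excess_zero_pow_four_le hσ hs (b := s + τ / 4) (T := s + τ) (by linarith)
      (by linarith) (by linarith)
    have e1 : s + τ / 2 - τ / 4 * (1 / 2) ^ 0 = s + τ / 4 := by ring
    have e2 : K * (1 - (1 / 2 : ℝ) ^ 0) = 0 := by ring
    rw [e1, e2]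
    refine ⟨h0.1, h0.2.trans ?_⟩
    rw [← hE, add_sub_cancel_left, pow_zero, mul_one]
    have hsq := pow_le_pow_left₀ (by positivity : 0 ≤ 18 * (E + F ^ 2)) hKE' 2
    have e3 : (E / (τ / 4)) ^ 2 = 16 * E ^ 2 / τ ^ 2 := by field_simp; norm_num
    rw [e3, ← mul_le_mul_iff_left₀ (by positivity : 0 < τ ^ 2)]
    have e4 : 20 * (16 * E ^ 2 / τ ^ 2 + 4 * F ^ 4) * τ ^ 2 = 320 * E ^ 2 + 80 * F ^ 4 * τ ^ 2 := by
      field_simp; ring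
    rw [e4]
    have h5 : 80 * F ^ 4 * τ ^ 2 ≤ 80 * F ^ 4 * 1 := mul_le_mul_of_nonneg_left hτ2 (by positivity)
    have h6 : 0 ≤ E * F ^ 2 := by positivity
    have h7 : 0 ≤ F ^ 4 := by positivity
    nlinarith [sq_nonneg E]
  | succ j ih =>
    set p : ℝ := (1 / 2) ^ j with hp
    have hp0 : 0 < p := by positivity
    have hp1 : p ≤ 1 := pow_le_one₀ (by norm_num) (by norm_num)
    have hp64 : ((1 : ℝ) / 64) ^ j = p ^ 6 := by
      rw [hp, ← pow_mul, mul_comm, pow_mul]; norm_num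
    have hp64' : ((1 : ℝ) / 64) ^ (j + 1) = p ^ 6 / 64 := by rw [pow_succ, hp64]; ring
    have hp2 : ((1 : ℝ) / 2) ^ (j + 1) = p / 2 := by rw [pow_succ, ← hp]; ring
    rw [hp64] at ih
    rw [hp64', hp2]
    have hτp : τ / 4 * p ≤ τ / 4 * 1 := mul_le_mul_of_nonneg_left hp1 (by linarith)
    have hτp0 : 0 < τ * p := mul_pos hτ hp0
    have hKp : 0 ≤ K * (1 - p) := mul_nonneg hK.le (by linarith)
    have hd : K * (1 - p / 2) - K * (1 - p) = K * p / 2 := by ring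
    have hba : s + τ / 2 - τ / 4 * (p / 2) - (s + τ / 2 - τ / 4 * p) = τ * p / 8 := by ring
    have hstep := h.integral_excess_pow_four_le_of_le hσ (a := s + τ / 2 - τ / 4 * p)
      (b := s + τ / 2 - τ / 4 * (p / 2)) (T := s + τ) (k := K * (1 - p)) (l := K * (1 - p / 2))
      (X := K ^ 4 * (e * p ^ 6) ^ 2) (y := 4 * e * p ^ 4) (by linarith) (by linarith) (by linarith)
      (by linarith) hKp (by nlinarith) ih.1 ih.2 (by positivity) (by rw [hd]; apply le_of_eq; ring)
    rw [hd, hba] at hstep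
    refine ⟨hstep.1, hstep.2.trans ?_⟩
    have e1 : (K ^ 4 * (e * p ^ 6) ^ 2 / ((K * p / 2) ^ 2 * (τ * p / 8))) ^ 2 =
        1024 * K ^ 4 * e ^ 4 * p ^ 18 / τ ^ 2 := by
      field_simp; ring
    rw [e1]
    have e2 : 1024 * K ^ 4 * e ^ 4 * p ^ 18 / τ ^ 2 =
        1024 * K ^ 4 * e ^ 3 * p ^ 12 * (p ^ 6 / 104857600) := by
      rw [← heτ]; field_simp
    rw [e2]
    have hp6 : p ^ 6 ≤ 1 := pow_le_one₀ hp0.le hp1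
    have hq : 0 < K ^ 4 * e ^ 2 * p ^ 12 := by positivity
    have b1 : 1024 * K ^ 4 * e ^ 3 * p ^ 12 * (p ^ 6 / 104857600) ≤
        1024 * K ^ 4 * e ^ 3 * p ^ 12 * (1 / 104857600) :=
      mul_le_mul_of_nonneg_left (by linarith) (by positivity)
    have b2 : 4 * F ^ 4 * (4 * e * p ^ 4) ^ 3 ≤ 4 * K ^ 4 * (4 * e * p ^ 4) ^ 3 :=
      mul_le_mul_of_nonneg_right (by linarith) (by positivity)
    have he2 : e ≤ 1 / 104857600 := by linarith
    have b3 : (K ^ 4 * e ^ 2 * p ^ 12) * e ≤ (K ^ 4 * e ^ 2 * p ^ 12) * (1 / 104857600) :=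
      mul_le_mul_of_nonneg_left he2 hq.le
    nlinarith

/-- The local maximum principle for the vorticity: the `L²` norm over a time interval of length `τ`
and the force control the supremum over the second half. The limit of `iteration` says that the
excess over the level `K` vanishes there. -/
lemma vort_le (h : IsFlow F u f D) {σ : ℝ} (hσ : |σ| = 1) {s τ K : ℝ} (hs : 0 ≤ s) (hτ : 0 < τ)
    (hτ1 : τ ≤ 1) (hK : 0 < K)
    (hKE : 18 / (τ * smallness τ) * ((∫ z, vort (D z.1) z.2 ^ 2 ∂(slab s (s + τ))) + F ^ 2) ≤
      K ^ 2) :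
    ∀ᵐ z ∂(slab (s + τ / 2) (s + τ)), σ * vort (D z.1) z.2 ≤ K := by
  have hit := h.iteration hσ hs hτ hτ1 hK hKE
  have hsl : ∀ j : ℕ, slab (s + τ / 2) (s + τ) ≤
      slab (s + τ / 2 - τ / 4 * (1 / 2) ^ j) (s + τ) := fun j =>
    slab_mono (by have : 0 ≤ τ / 4 * (1 / 2) ^ j := by positivity
                  linarith) le_rfl
  have hk : ∀ (j : ℕ) z, excess σ D K z ^ 4 ≤ excess σ D (K * (1 - (1 / 2) ^ j)) z ^ 4 := fun j z =>
    pow_le_pow_left₀ (excess_nonneg _ _ _) (excess_anti σ (by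
      have : 0 ≤ K * (1 / 2) ^ j := by positivity
      linarith) z) 4
  have hs2 : 0 ≤ s + τ / 2 := by linarith
  have hint : Integrable (fun z => excess σ D K z ^ 4) (slab (s + τ / 2) (s + τ)) :=
    ((hit 0).1.mono_measure (hsl 0)).mono' ((h.aesm_excess σ K hs2 _).pow 4) (.of_forall fun z => by
      rw [Real.norm_eq_abs, abs_of_nonneg (pow_nonneg (excess_nonneg _ _ _) 4)]; exact hk 0 z)
  have hle : ∀ j : ℕ, ∫ z, excess σ D K z ^ 4 ∂(slab (s + τ / 2) (s + τ)) ≤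
      K ^ 4 * (smallness τ * (1 / 64) ^ j) ^ 2 := fun j =>
    (integral_mono hint ((hit j).1.mono_measure (hsl j)) (hk j)).trans
      ((integral_mono_measure (hsl j) (.of_forall fun z => pow_nonneg (excess_nonneg _ _ _) 4)
        (hit j).1).trans (hit j).2)
  have hlim : Filter.Tendsto (fun j : ℕ => K ^ 4 * (smallness τ * (1 / 64) ^ j) ^ 2) Filter.atTop
      (nhds 0) := by
    have := (((tendsto_pow_atTop_nhds_zero_of_lt_one (r := (1 : ℝ) / 64) (by norm_num)
      (by norm_num)).const_mul (smallness τ)).pow 2).const_mul (K ^ 4)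
    simpa using this
  have h0 : ∫ z, excess σ D K z ^ 4 ∂(slab (s + τ / 2) (s + τ)) = 0 :=
    le_antisymm (ge_of_tendsto' hlim hle)
      (integral_nonneg fun z => pow_nonneg (excess_nonneg _ _ _) 4)
  have hae := (integral_eq_zero_iff_of_nonneg
    (fun z => pow_nonneg (excess_nonneg (D := D) σ K z) 4) hint).1 h0
  filter_upwards [hae] with z hz
  have h1 : excess σ D K z = 0 := by simpa using hz
  have h2 := le_max_left (σ * vort (D z.1) z.2 - K) 0
  rw [show max (σ * vort (D z.1) z.2 - K) 0 = excess σ D K z from rfl, h1] at h2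
  linarith

end IsFlow

/-! ### From almost every time to every time -/

namespace IsFlow

variable {F : ℝ} {u f : ℝ → Fin 2 → T2 → ℝ} {D : ℝ → Fin 2 → Fin 2 → T2 → ℝ}

open IsSobolevDivFree

/-- The bound on the vorticity, in its weak form, extends to the final time by weak continuity. -/
lemma abs_pair_curl_le (h : IsFlow F u f D) {s τ K : ℝ} (hs : 0 ≤ s) (hτ : 0 < τ)
    (hτ1 : τ ≤ 1) (hK : 0 < K)
    (hKE : 18 / (τ * smallness τ) * ((∫ z, vort (D z.1) z.2 ^ 2 ∂(slab s (s + τ))) + F ^ 2) ≤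
      K ^ 2) {ψ : T2 → ℝ} (hψ : SmoothScalar ψ) :
    |pair (u (s + τ)) (curl ψ)| ≤ K * ∫ x, |ψ x| := by
  have h1 := h.vort_le (σ := 1) (by simp) hs hτ hτ1 hK hKE
  have h2 := h.vort_le (σ := -1) (by simp) hs hτ hτ1 hK hKE
  have h3 : ∀ᵐ z ∂(slab (s + τ / 2) (s + τ)), |vort (D z.1) z.2| ≤ K := by
    filter_upwards [h1, h2] with z hz1 hz2
    exact abs_le.2 ⟨by linarith, by linarith⟩
  have hs2 : 0 ≤ s + τ / 2 := by linarith
  have h4 : ∀ᵐ r ∂((volume : Measure ℝ).restrict (Ioc (s + τ / 2) (s + τ))),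
      |pair (u r) (curl ψ)| ≤ K * ∫ x, |ψ x| := by
    filter_upwards [Measure.ae_ae_of_ae_prod h3, ae_Ioc h.sobolev hs2 (s + τ)] with r hr hv
    rw [pair_curl_eq hv hψ, ← integral_const_mul]
    refine abs_integral_le_integral_abs.trans (integral_mono_of_nonneg
      (.of_forall fun _ => abs_nonneg _) (hψ.integrable.abs.const_mul K) ?_)
    filter_upwards [hr] with x hx
    simp only [abs_mul]
    exact mul_le_mul_of_nonneg_right hx (abs_nonneg _)
  by_contra hcon
  rw [not_le] at hcon
  have hc := (h.continuousOn_pair (s + τ) (smooth_curl hψ) (curl_div_free hψ)).abs (s + τ)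
    ⟨by linarith, le_rfl⟩
  have hev := hc.eventually (lt_mem_nhds hcon)
  obtain ⟨δ, hδ, hball⟩ := Metric.mem_nhdsWithin_iff.1 hev
  set a := max (s + τ / 2) (s + τ - δ) with ha
  have hab : a < s + τ := max_lt (by linarith) (by linarith)
  have hsub : Ioo a (s + τ) ⊆ Ioc (s + τ / 2) (s + τ) := fun r hr =>
    ⟨(le_max_left _ _).trans_lt hr.1, hr.2.le⟩
  have h5 := ae_mono (Measure.restrict_mono hsub le_rfl) h4
  have h6 : ∀ᵐ r ∂((volume : Measure ℝ).restrict (Ioo a (s + τ))), False := by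
    filter_upwards [h5, ae_restrict_mem measurableSet_Ioo] with r hr hmem
    have hlt : s + τ - δ < r := (le_max_right _ _).trans_lt hmem.1
    have hr0 : s + τ / 2 < r := (le_max_left _ _).trans_lt hmem.1
    have := hball (a := r) ⟨by
      rw [Metric.mem_ball, Real.dist_eq, abs_lt]; constructor <;> linarith [hmem.2],
      by linarith, hmem.2.le⟩
    exact absurd hr (not_le.2 this)
  rw [Filter.eventually_false_iff_eq_bot, ae_eq_bot, Measure.restrict_eq_zero] at h6
  simp only [Real.volume_Ioo, ENNReal.ofReal_eq_zero] at h6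
  linarith

end IsFlow

/-! ### Bounded vorticity from a bound on the pairings with rotated gradients -/

section Representation

variable {v : Fin 2 → T2 → ℝ} {K : ℝ}

lemma pair_sum_mul {ι : Type*} (S : Finset ι) (c : ι → ℝ) {Φ : ι → Fin 2 → T2 → ℝ}
    (hv : ∀ i, MemLp (v i) 2 volume) (hΦ : ∀ a i, SmoothScalar (Φ a i)) :
    pair v (fun i x => ∑ a ∈ S, c a * Φ a i x) = ∑ a ∈ S, c a * pair v (Φ a) := by
  have ii : ∀ a, Integrable (fun x => ∑ i, v i x * Φ a i x) volume := fun a =>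
    integrable_finsetSum _ fun i _ => integrable_mul_smooth (hΦ a i) (hv i).integrable_two
  unfold pair
  simp_rw [← integral_const_mul]
  rw [← integral_finsetSum _ fun a _ => (ii a).const_mul (c a)]
  congr 1; ext x
  simp_rw [Finset.mul_sum]
  rw [Finset.sum_comm]
  refine Finset.sum_congr rfl fun a _ => Finset.sum_congr rfl fun i _ => ?_
  ring

lemma pair_curl_sub (hv : ∀ i, MemLp (v i) 2 volume) {ψ φ : T2 → ℝ} (hψ : SmoothScalar ψ)
    (hφ : SmoothScalar φ) :
    pair v (curl fun x => ψ x - φ x) = pair v (curl ψ) - pair v (curl φ) := by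
  have ii : ∀ {ψ : T2 → ℝ}, SmoothScalar ψ → Integrable (fun x => ∑ i, v i x * curl ψ i x) volume :=
    fun hψ => integrable_finsetSum _ fun i _ =>
      integrable_mul_smooth (smooth_curl hψ i) (hv i).integrable_two
  unfold pair
  rw [← integral_sub (ii hψ) (ii hφ)]
  congr 1; ext x
  simp only [Fin.sum_univ_two, curl_zero, curl_one, pd_sub hψ hφ]
  ring

lemma molVort_eq_pair (hv : ∀ i, MemLp (v i) 2 volume) (m : ℕ) (x : T2) :
    IsFlow.molVort m v x = pair v (curl fun y => ker m (x - y)) := by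
  simp_rw [ker_sub_eq]
  rw [curl_sum_mul _ _ smooth_md, pair_sum_mul _ _ hv fun a => smooth_curl (smooth_md a)]
  refine Finset.sum_congr rfl fun a _ => ?_
  ring

lemma abs_molVort_le (hv : ∀ i, MemLp (v i) 2 volume)
    (hK : ∀ ψ, SmoothScalar ψ → |pair v (curl ψ)| ≤ K * ∫ x, |ψ x|) (m : ℕ) (x : T2) :
    |IsFlow.molVort m v x| ≤ K := by
  rw [molVort_eq_pair hv]
  refine (hK _ (smooth_ker_sub m x)).trans (le_of_eq ?_)
  simp_rw [abs_of_nonneg (ker_nonneg m _)]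
  rw [integral_sub_left_eq_self (fun y => ker m y) (volume : Measure T2) x, integral_ker, mul_one]

lemma integral_molVort_mul (hv : ∀ i, MemLp (v i) 2 volume) (m : ℕ) {ψ : T2 → ℝ}
    (hψ : SmoothScalar ψ) : ∫ x, IsFlow.molVort m v x * ψ x = pair v (curl (mol m ψ)) := by
  rw [show mol m ψ = _ from funext (mol_eq_sum m hψ.integrable), curl_sum_mul _ _ smooth_md,
    pair_sum_mul _ _ hv fun a => smooth_curl (smooth_md a)]
  unfold IsFlow.molVort
  simp_rw [Finset.sum_mul]
  rw [integral_finsetSum _ fun a _ => (((SmoothScalar.const _).mul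
    ((SmoothScalar.const _).mul (smooth_md a))).mul hψ).integrable]
  refine Finset.sum_congr rfl fun a _ => ?_
  rw [mul_right_comm, mul_comm (fcoef m a), mul_assoc, ← integral_const_mul, ← integral_const_mul]
  congr 1; ext x; ring

lemma tendsto_integral_molVort_mul (hv : ∀ i, MemLp (v i) 2 volume) (hK0 : 0 ≤ K)
    (hK : ∀ ψ, SmoothScalar ψ → |pair v (curl ψ)| ≤ K * ∫ x, |ψ x|) {ψ : T2 → ℝ}
    (hψ : SmoothScalar ψ) :
    Filter.Tendsto (fun m => ∫ x, IsFlow.molVort m v x * ψ x) Filter.atTop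
      (nhds (pair v (curl ψ))) := by
  simp_rw [integral_molVort_mul hv _ hψ]
  have h0 := (tendsto_nrm_mol_sub (hψ.memLp 2)).const_mul K
  rw [mul_zero] at h0
  refine tendsto_iff_dist_tendsto_zero.2 (squeeze_zero (fun _ => dist_nonneg) (fun m => ?_) h0)
  have sm := smooth_mol m hψ.integrable
  rw [Real.dist_eq, ← pair_curl_sub hv sm hψ]
  exact (hK _ (sm.sub hψ)).trans
    (mul_le_mul_of_nonneg_left (integral_abs_le_nrm ((sm.sub hψ).memLp 2)) hK0)

lemma exists_tendsto_integral_molVort_mul (hv : ∀ i, MemLp (v i) 2 volume) (hK0 : 0 ≤ K)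
    (hK : ∀ ψ, SmoothScalar ψ → |pair v (curl ψ)| ≤ K * ∫ x, |ψ x|) {g : T2 → ℝ}
    (hg : MemLp g 2 volume) :
    ∃ l, Filter.Tendsto (fun m => ∫ x, IsFlow.molVort m v x * g x) Filter.atTop (nhds l) := by
  have mW := fun m => (IsFlow.smooth_molVort m v).memLp 2
  have hW : ∀ m, nrm (IsFlow.molVort m v) ≤ K := fun m =>
    nrm_le_of_bound hK0 (abs_molVort_le hv hK m)
  refine cauchySeq_tendsto_of_complete (Metric.cauchySeq_iff'.2 fun ε hε => ?_)
  obtain ⟨k, hk⟩ := ((Metric.tendsto_nhds.1 (tendsto_nrm_mol_sub hg)) (ε / (4 * (K + 1)))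
    (by positivity)).exists
  rw [Real.dist_eq, sub_zero, abs_of_nonneg (nrm_nonneg _)] at hk
  have sk := smooth_mol k hg.integrable_two
  obtain ⟨N, hN⟩ := Metric.cauchySeq_iff'.1
    (tendsto_integral_molVort_mul hv hK0 hK sk).cauchySeq (ε / 2) (by positivity)
  have happ : ∀ m, |(∫ x, IsFlow.molVort m v x * mol k g x) - ∫ x, IsFlow.molVort m v x * g x| ≤
      ε / 4 := by
    intro m
    rw [← integral_sub (integrable_mul_two (mW m) (sk.memLp 2)) (integrable_mul_two (mW m) hg)]
    simp_rw [← mul_sub]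
    refine (abs_integral_mul_le (mW m) ((sk.memLp 2).sub hg)).trans
      ((mul_le_mul (hW m) hk.le (nrm_nonneg _) hK0).trans ?_)
    rw [← mul_div_assoc, div_le_div_iff₀ (by positivity) (by norm_num)]
    nlinarith
  refine ⟨N, fun n hn => ?_⟩
  have h1 := hN n hn
  have h2 := abs_le.1 (happ n)
  have h3 := abs_le.1 (happ N)
  rw [Real.dist_eq, abs_lt] at h1 ⊢
  constructor <;> linarith [h1.1, h1.2, h2.1, h2.2, h3.1, h3.2]

/-- A distribution with `|⟨ω, ψ⟩| ≤ K ‖ψ‖_1` is a function bounded by `K`.  The mollifications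
converge weakly in `L²`, and the limit is represented by a function by Riesz's theorem. -/
lemma exists_bounded_vorticity (hv : ∀ i, MemLp (v i) 2 volume) (hK0 : 0 ≤ K)
    (hK : ∀ ψ, SmoothScalar ψ → |pair v (curl ψ)| ≤ K * ∫ x, |ψ x|) :
    ∃ w : T2 → ℝ, MemLp w 2 volume ∧ (∀ᵐ x, |w x| ≤ K) ∧
      ∀ ψ, SmoothScalar ψ → ∫ x, w x * ψ x = pair v (curl ψ) := by
  have mW := fun m => (IsFlow.smooth_molVort m v).memLp 2
  let G : ℕ → (Lp ℝ 2 (volume : Measure T2) →L[ℝ] ℝ) := fun m => innerSL ℝ ((mW m).toLp _)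
  have hG : ∀ m (g : Lp ℝ 2 (volume : Measure T2)),
      G m g = ∫ x, IsFlow.molVort m v x * g x := by
    intro m g
    simp only [G, innerSL_apply_apply, L2.inner_def]
    refine integral_congr_ae ?_
    filter_upwards [(mW m).coeFn_toLp] with x hx
    rw [hx]
    simp [mul_comm]
  choose l hl using fun g : Lp ℝ 2 (volume : Measure T2) =>
    exists_tendsto_integral_molVort_mul hv hK0 hK (Lp.memLp g)
  have hlim : Filter.Tendsto (fun m g => G m g) Filter.atTop (nhds l) := by
    refine tendsto_pi_nhds.2 fun g => ?_
    simp_rw [hG]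
    exact hl g
  let L := continuousLinearMapOfTendsto G hlim
  let w := (InnerProductSpace.toDual ℝ (Lp ℝ 2 (volume : Measure T2))).symm L
  have hw : ∀ ψ, SmoothScalar ψ → ∫ x, w x * ψ x = pair v (curl ψ) := by
    intro ψ hψ
    have h1 : inner ℝ w ((hψ.memLp 2).toLp ψ) = L ((hψ.memLp 2).toLp ψ) :=
      InnerProductSpace.toDual_symm_apply
    have h2 : L ((hψ.memLp 2).toLp ψ) = l ((hψ.memLp 2).toLp ψ) := rfl
    have h3 : inner ℝ w ((hψ.memLp 2).toLp ψ) = ∫ x, w x * ψ x := by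
      rw [L2.inner_def]
      refine integral_congr_ae ?_
      filter_upwards [(hψ.memLp 2).coeFn_toLp] with x hx
      rw [hx]
      simp [mul_comm]
    rw [← h3, h1, h2]
    refine tendsto_nhds_unique (hl _) ((tendsto_integral_molVort_mul hv hK0 hK hψ).congr fun m => ?_)
    refine integral_congr_ae ?_
    filter_upwards [(hψ.memLp 2).coeFn_toLp] with x hx
    rw [hx]
  have mw : MemLp w 2 volume := Lp.memLp w
  refine ⟨w, mw, ?_, hw⟩
  have hb : ∀ m x, |mol m w x| ≤ K := by
    intro m x
    have e : mol m w x = pair v (curl fun y => ker m (x - y)) := by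
      rw [← hw _ (smooth_ker_sub m x)]
      unfold mol
      simp_rw [mul_comm]
    rw [e, ← molVort_eq_pair hv]
    exact abs_molVort_le hv hK m x
  have hm : AEStronglyMeasurable (fun x => max (|w x| - K) 0) volume :=
    (mw.1.norm.sub aestronglyMeasurable_const).sup aestronglyMeasurable_const
  have hle : ∀ m x, |max (|w x| - K) 0| ≤ |mol m w x - w x| := by
    intro m x
    rw [abs_of_nonneg (le_max_right _ _)]
    refine max_le ?_ (abs_nonneg _)
    have h1 := hb m x
    have h2 := abs_sub_abs_le_abs_sub (w x) (mol m w x)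
    rw [abs_sub_comm] at h2
    linarith
  have hd : ∀ m, MemLp (fun x => mol m w x - w x) 2 volume := fun m =>
    ((smooth_mol m mw.integrable_two).memLp 2).sub mw
  have h0 : nrm (fun x => max (|w x| - K) 0) = 0 :=
    le_antisymm (ge_of_tendsto' (tendsto_nrm_mol_sub mw) fun m =>
      nrm_mono (hd m) (.of_forall fun x => hle m x)) (nrm_nonneg _)
  have hint : Integrable (fun x => max (|w x| - K) 0 ^ 2) volume :=
    ((hd 0).of_le hm (.of_forall fun x => hle 0 x)).integrable_sq
  have h1 : ∫ x, max (|w x| - K) 0 ^ 2 = 0 := by rw [← sq_nrm, h0]; simp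
  filter_upwards [(integral_eq_zero_iff_of_nonneg (fun x => sq_nonneg _) hint).1 h1] with x hx
  have h2 : max (|w x| - K) 0 = 0 := by simpa using hx
  have h3 := le_max_left (|w x| - K) 0
  linarith

end Representation

/-! ### Weak solutions and their components -/

section Components

lemma continuous_coord (i : Fin 2) : Continuous fun y : V2 => y i :=
  (EuclideanSpace.proj (𝕜 := ℝ) i).continuous

lemma abs_coord_le (y : V2) (i : Fin 2) : ‖y i‖ ≤ ‖y‖ := PiLp.norm_apply_le y i

lemma memLp_coord {v : T2 → V2} {p : ℝ≥0∞} (hv : MemLp v p volume) (i : Fin 2) :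
    MemLp (fun x => v x i) p volume :=
  hv.of_le ((continuous_coord i).comp_aestronglyMeasurable hv.1)
    (.of_forall fun _ => abs_coord_le _ _)

lemma eLpNorm_coord_le (v : T2 → V2) (p : ℝ≥0∞) (i : Fin 2) :
    eLpNorm (fun x => v x i) p volume ≤ eLpNorm v p volume :=
  eLpNorm_mono fun _ => abs_coord_le _ _

lemma integral_coord {v : T2 → V2} (hv : Integrable v volume) (h0 : ∫ x, v x = 0) (i : Fin 2) :
    ∫ x, v x i = 0 := by
  have h := (EuclideanSpace.proj (𝕜 := ℝ) i).integral_comp_comm hv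
  rw [h0, map_zero] at h
  exact h

lemma integral_norm_pow_eq {E : Type*} [NormedAddCommGroup E] {g : T2 → E} (n : ℕ) (hn : n ≠ 0)
    (hg : MemLp g n volume) : ∫ x, ‖g x‖ ^ n = (eLpNorm g n volume).toReal ^ n := by
  have h := hg.eLpNorm_eq_integral_rpow_norm (by exact_mod_cast hn) (by simp)
  have h0 : 0 ≤ ∫ x, ‖g x‖ ^ n := integral_nonneg fun x => by positivity
  simp only [ENNReal.toReal_natCast, Real.rpow_natCast] at h
  rw [h, ENNReal.toReal_ofReal (by positivity), Real.rpow_inv_natCast_pow h0 hn]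

lemma nrm_eq_toReal {g : T2 → ℝ} (hg : MemLp g 2 volume) : nrm g = (eLpNorm g 2 volume).toReal := by
  have h := integral_norm_pow_eq 2 two_ne_zero hg
  simp only [Real.norm_eq_abs, sq_abs, Nat.cast_ofNat] at h
  rw [nrm, h, Real.sqrt_sq ENNReal.toReal_nonneg]

lemma energy_eq_toReal {v : T2 → V2} (hv : MemLp v 2 volume) :
    energy (fun i x => v x i) = (eLpNorm v 2 volume).toReal ^ 2 := by
  have h := integral_norm_pow_eq 2 two_ne_zero hv
  simp only [Nat.cast_ofNat] at h
  rw [← h, energy]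
  simp_rw [sq_nrm]
  rw [← integral_finsetSum _ fun i _ => (memLp_coord hv i).integrable_sq]
  simp_rw [EuclideanSpace.real_norm_sq_eq]

end Components

/-- An upper bound for the force in `L^∞(L^8)`; the estimates use no other exponent. -/
noncomputable def forceSize (lam M : ℝ) : ℝ := 8 ^ lam * M

lemma IsForce.ae_bound {lam M : ℝ} {f : ℝ → T2 → V2} (hf : IsForce lam M f) :
    ∀ᵐ t ∂(volume.restrict (Ici (0 : ℝ))), MemLp (f t) 8 volume ∧
      eLpNorm (f t) 8 volume ≤ ENNReal.ofReal (forceSize lam M) := by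
  have h1 := ae_le_essSup (μ := (volume : Measure ℝ).restrict (Ici 0))
    (f := fun t => eLpNorm (f t) (ENNReal.ofReal 8) volume)
  have h2 := hf.bound 8 (by norm_num)
  filter_upwards [h1, hf.measurable.prodMk_left] with t ht hm
  have h3 := ht.trans h2
  rw [show ENNReal.ofReal 8 = 8 by simp] at h3
  exact ⟨⟨hm, h3.trans_lt ENNReal.ofReal_lt_top⟩, h3⟩

lemma pair_const (v : Fin 2 → T2 → ℝ) (i : Fin 2) :
    pair v (fun l _ => if l = i then 1 else 0) = ∫ x, v i x := by
  unfold pair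
  congr 1; ext x
  simp

lemma gen_const (v f : Fin 2 → T2 → ℝ) (i : Fin 2) :
    gen v f (fun l _ => if l = i then 1 else 0) = ∫ x, f i x := by
  have hpd : ∀ (j l : Fin 2) (x : T2), pd j (fun _ => if l = i then (1 : ℝ) else 0) x = 0 :=
    fun j l x => pd_const j _ x
  have hlap : ∀ (l : Fin 2) (x : T2), lap (fun _ => if l = i then (1 : ℝ) else 0) x = 0 := by
    intro l x
    unfold lap
    refine Finset.sum_eq_zero fun j _ => ?_
    rw [show pd j (fun _ : T2 => if l = i then (1 : ℝ) else 0) = fun _ => 0 from funext (hpd j l),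
      pd_const]
  unfold gen
  simp only [hpd, hlap, mul_zero, Finset.sum_const_zero, zero_add]
  congr 1; ext x
  simp

namespace IsWeakSolution

variable {u₀ : T2 → V2} {f u : ℝ → T2 → V2}

lemma pair_eq_add (hu : IsWeakSolution u₀ f u) {φ : Fin 2 → T2 → ℝ}
    (hφ : ∀ i, SmoothScalar (φ i)) (hdiv : ∀ x, ∑ i, pd i (φ i) x = 0) {t : ℝ} (ht : 0 ≤ t) :
    pair (fun i x => u t x i) φ = pair (fun i x => u₀ x i) φ +
      ∫ r in (0 : ℝ)..t, gen (fun i x => u r x i) (fun i x => f r x i) φ :=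
  hu.momentum (fun x => WithLp.toLp 2 fun i => φ i x) ⟨hφ, hdiv⟩ t ht

lemma pair_zero_eq (hu : IsWeakSolution u₀ f u) {φ : Fin 2 → T2 → ℝ}
    (hφ : ∀ i, SmoothScalar (φ i)) (hdiv : ∀ x, ∑ i, pd i (φ i) x = 0) :
    pair (fun i x => u 0 x i) φ = pair (fun i x => u₀ x i) φ := by
  rw [hu.pair_eq_add hφ hdiv le_rfl, intervalIntegral.integral_same, add_zero]

/-- The initial value is attained: divergence-free fields are determined by their pairings with
divergence-free modes. -/
lemma energy_zero (hu : IsWeakSolution u₀ f u) (h0 : IsInitialDatum u₀) :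
    energy (fun i x => u 0 x i) = (eLpNorm u₀ 2 volume).toReal ^ 2 := by
  rw [← energy_eq_toReal h0.memLp]
  unfold energy
  refine Finset.sum_congr rfl fun i _ => ?_
  have m1 := fun i => memLp_coord (hu.memLp 0 le_rfl) i
  have m0 := fun i => memLp_coord h0.memLp i
  have hmol : ∀ m, mol m (fun x => u 0 x i) = mol m (fun x => u₀ x i) := by
    intro m
    ext x
    rw [mol_eq_sum m (m1 i).integrable_two, mol_eq_sum m (m0 i).integrable_two]
    refine Finset.sum_congr rfl fun a _ => ?_
    have h1 := pair_solenoidal m1 (hu.div_free 0 le_rfl) a i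
    have h2 := pair_solenoidal m0 h0.div_free a i
    rw [← h1, ← h2, hu.pair_zero_eq (smooth_solenoidal a i) (solenoidal_div_free a i)]
  have h1 := tendsto_nrm_mol (m1 i)
  simp_rw [hmol] at h1
  rw [tendsto_nhds_unique h1 (tendsto_nrm_mol (m0 i))]

/-- A weak solution in components. -/
lemma exists_isFlow (hu : IsWeakSolution u₀ f u) {lam M : ℝ} (hM : 0 ≤ M) (h0 : IsInitialDatum u₀)
    (hf : IsForce lam M f) :
    ∃ D, IsFlow (forceSize lam M) (fun t i x => u t x i) (fun t i x => f t x i) D := by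
  obtain ⟨D, hD1, hD2⟩ := hu.sobolev
  have hF0 : 0 ≤ forceSize lam M := mul_nonneg (Real.rpow_nonneg (by norm_num) _) hM
  have hcoord : ∀ {g : ℝ → T2 → V2} {μ : Measure (ℝ × T2)},
      AEStronglyMeasurable (fun z : ℝ × T2 => g z.1 z.2) μ → ∀ i : Fin 2,
      AEStronglyMeasurable (fun z : ℝ × T2 => g z.1 z.2 i) μ := fun hg i =>
    (continuous_coord i).comp_aestronglyMeasurable hg
  have hforce : ∀ᵐ t ∂(volume.restrict (Ici (0 : ℝ))), ∀ i : Fin 2,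
      MemLp (fun x => f t x i) 8 volume ∧ ∫ x, f t x i ^ 8 ≤ forceSize lam M ^ 8 := by
    filter_upwards [hf.ae_bound] with t ht i
    have hm := memLp_coord ht.1 i
    refine ⟨hm, ?_⟩
    have h1 := integral_norm_pow_eq 8 (by norm_num) hm
    have h2 : ∀ x, ‖f t x i‖ ^ 8 = f t x i ^ 8 := fun x => by
      rw [Real.norm_eq_abs]; exact Even.pow_abs (by decide) _
    simp_rw [h2] at h1
    rw [h1]
    refine pow_le_pow_left₀ ENNReal.toReal_nonneg ?_ 8
    exact ENNReal.toReal_le_of_le_ofReal hF0 ((eLpNorm_coord_le (f t) 8 i).trans ht.2)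
  have hgrad : ∀ i j, ∀ᵐ t ∂(volume.restrict (Ici (0 : ℝ))), MemLp (D i j t) 2 volume := by
    intro i j
    have hT : ∀ n : ℕ, ∀ᵐ t ∂(volume.restrict (Icc (0 : ℝ) n)), MemLp (D i j t) 2 volume := by
      intro n
      have hm := hD1 i j n
      filter_upwards [hm.1.prodMk_left, hm.integrable_sq.prod_right_ae] with t h1 h2
      exact (memLp_two_iff_integrable_sq h1).2 h2
    have hU : Ici (0 : ℝ) = ⋃ n : ℕ, Icc (0 : ℝ) n := by
      ext t
      simp only [mem_Ici, mem_iUnion, mem_Icc]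
      exact ⟨fun h => (exists_nat_ge t).imp fun n hn => ⟨h, hn⟩, fun ⟨n, h⟩ => h.1⟩
    rw [hU, ae_restrict_iUnion_iff]
    exact hT
  have hmean : ∀ t, 0 ≤ t → ∀ i : Fin 2, ∫ x, u t x i = 0 := by
    intro t ht i
    have hφ : ∀ l : Fin 2, SmoothScalar fun _ => if l = i then (1 : ℝ) else 0 := fun l =>
      SmoothScalar.const _
    have h1 := hu.pair_eq_add (φ := fun l _ => if l = i then (1 : ℝ) else 0) hφ
      (fun x => Finset.sum_eq_zero fun l _ => pd_const _ _ _) ht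
    rw [pair_const, pair_const, integral_coord (h0.memLp.integrable (by norm_num)) h0.mean_zero, zero_add] at h1
    rw [h1]
    simp_rw [gen_const]
    rw [intervalIntegral.integral_of_le ht]
    refine integral_eq_zero_of_ae ?_
    filter_upwards [IsFlow.ae_Ioc hf.mean_zero le_rfl t, IsFlow.ae_Ioc hf.ae_bound le_rfl t]
      with r h2 h3
    exact integral_coord (h3.1.integrable (by norm_num)) h2 i
  refine ⟨fun t i j => D i j t, ?_⟩
  exact
    { meas := fun i => hcoord hu.measurable i
      meas_force := fun i => hcoord hf.measurable i
      memLp_grad := fun i j T => hD1 i j T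
      memLp := fun t ht i => memLp_coord (hu.memLp t ht) i
      bounded := fun T => by
        obtain ⟨K, hK⟩ := hu.bounded T
        refine ⟨K, fun t ht i => ?_⟩
        rw [nrm_eq_toReal (memLp_coord (hu.memLp t ht.1) i)]
        exact ENNReal.toReal_le_coe_of_le_coe ((eLpNorm_coord_le (u t) 2 i).trans (hK t ht))
      sobolev := by
        have hw : ∀ᵐ t ∂(volume.restrict (Ici (0 : ℝ))), ∀ i j,
            IsWeakPartial j (fun x => u t x i) (D i j t) ∧ MemLp (D i j t) 2 volume :=
          ae_all_iff.2 fun i => ae_all_iff.2 fun j => (hD2 i j).and (hgrad i j)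
        filter_upwards [hw, ae_restrict_mem measurableSet_Ici] with t h1 ht
        exact ⟨fun i => memLp_coord (hu.memLp t ht) i, fun i j => (h1 i j).2,
          fun i j => (h1 i j).1, hu.div_free t ht⟩
      div_free := fun t ht => hu.div_free t ht
      mean_zero := hmean
      nonneg := hF0
      force := hforce
      momentum := fun φ hφ hdiv t ht => by
        rw [hu.pair_eq_add hφ hdiv ht, hu.pair_zero_eq hφ hdiv] }

end IsWeakSolution

/-! ### The bound on the vorticity -/

/-- The constant in the bound for the vorticity at the time `s + τ`, when the decayed initial energy
at the time `s` is at most `b`. -/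
noncomputable def vortConst (τ b : ℝ) : ℝ := √(18 / (τ * IsFlow.smallness τ) * (2 * b + 353))

lemma vortConst_pos {τ b : ℝ} (hτ : 0 < τ) (hb : 0 ≤ b) : 0 < vortConst τ b := by
  unfold vortConst IsFlow.smallness; positivity

open IsSobolevDivFree in
lemma IsFlow.integral_vort_sq_le {F : ℝ} {u f : ℝ → Fin 2 → T2 → ℝ}
    {D : ℝ → Fin 2 → Fin 2 → T2 → ℝ} (h : IsFlow F u f D) {s t : ℝ} (hs : 0 ≤ s) (hst : s ≤ t) :
    ∫ z, vort (D z.1) z.2 ^ 2 ∂(slab s t) ≤ 2 * (energy (u s) + 16 * F ^ 2 * (t - s)) := by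
  have h1 := h.energy_add_integral_le hs hst
  have iω := (h.memLp_vort_slab hs t).integrable_sq
  rw [integral_prod _ iω]
  have h2 : ∫ r in Ioc s t, ∫ x, vort (D r) x ^ 2 ≤ ∫ r in Ioc s t, 2 * gradEnergy (D r) := by
    refine integral_mono_ae iω.integral_prod_left ((h.integrable_gradEnergy hs t).const_mul 2) ?_
    filter_upwards [ae_Ioc h.sobolev hs t] with r hv
    rw [← sq_nrm]
    have n := fun i j => nrm_nonneg (D r i j)
    have h3 := pow_le_pow_left₀ (nrm_nonneg _)
      (nrm_sub_le (hv.memLp_grad 1 0) (hv.memLp_grad 0 1)) 2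
    simp only [gradEnergy, Fin.sum_univ_two]
    calc nrm (vort (D r)) ^ 2 ≤ (nrm (D r 1 0) + nrm (D r 0 1)) ^ 2 := h3
      _ ≤ _ := by
        nlinarith [sq_nonneg (nrm (D r 1 0) - nrm (D r 0 1)), sq_nonneg (nrm (D r 0 0)),
          sq_nonneg (nrm (D r 1 1))]
  rw [integral_const_mul] at h2
  linarith [energy_nonneg (u t)]

/-- The bound at the time `s + τ`, in terms of the decayed initial energy at the time `s`. -/
lemma vorticityBound_of_energy {lam M : ℝ} {u₀ : T2 → V2} {f u : ℝ → T2 → V2} (hlam : 0 ≤ lam)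
    (hM : 1 ≤ M) (h0 : IsInitialDatum u₀) (hf : IsForce lam M f) (hu : IsWeakSolution u₀ f u)
    {s τ b : ℝ} (hs : 0 ≤ s) (hτ : 0 < τ) (hτ1 : τ ≤ 1) (hb : 0 ≤ b)
    (hdecay : (8 / 9) ^ ⌊s⌋₊ * (eLpNorm u₀ 2 volume).toReal ^ 2 ≤ b) :
    VorticityBound (u (s + τ)) (vortConst τ b * 8 ^ lam * M) := by
  obtain ⟨D, h⟩ := hu.exists_isFlow (by linarith) h0 hf
  have hF1 : 1 ≤ forceSize lam M :=
    one_le_mul_of_one_le_of_one_le (Real.one_le_rpow (by norm_num) hlam) hM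
  set F := forceSize lam M with hF
  set K := vortConst τ b * F with hKdef
  have hK : 0 < K := mul_pos (vortConst_pos hτ hb) (by linarith)
  have hC0 : 0 ≤ 18 / (τ * IsFlow.smallness τ) := by unfold IsFlow.smallness; positivity
  have hF2 : 1 ≤ F ^ 2 := one_le_pow₀ hF1
  have hE : (∫ z, IsSobolevDivFree.vort (D z.1) z.2 ^ 2 ∂(slab s (s + τ))) + F ^ 2 ≤
      (2 * b + 353) * F ^ 2 := by
    have h1 := h.integral_vort_sq_le hs (t := s + τ) (by linarith)
    have h2 := h.energy_le hs
    rw [hu.energy_zero h0] at h2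
    have h3 : 16 * F ^ 2 * (s + τ - s) ≤ 16 * F ^ 2 * 1 :=
      mul_le_mul_of_nonneg_left (by linarith) (by positivity)
    nlinarith
  have hKE : 18 / (τ * IsFlow.smallness τ) *
      ((∫ z, IsSobolevDivFree.vort (D z.1) z.2 ^ 2 ∂(slab s (s + τ))) + F ^ 2) ≤ K ^ 2 := by
    rw [hKdef, mul_pow, vortConst, Real.sq_sqrt (by positivity), mul_assoc]
    exact mul_le_mul_of_nonneg_left hE hC0
  have hst : 0 ≤ s + τ := by linarith
  obtain ⟨w, mw, hwK, hw⟩ := exists_bounded_vorticity (h.memLp (s + τ) hst) hK.le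
    fun ψ hψ => h.abs_pair_curl_le hs hτ hτ1 hK hKE hψ
  refine ⟨w, ⟨mw.integrable_two, fun ψ hψ => ?_⟩, fun p _ => ?_⟩
  · rw [hw ψ hψ]
    unfold pair
    congr 1; ext x
    simp only [Fin.sum_univ_two, curl_zero, curl_one]
    ring
  · refine (eLpNorm_le_of_ae_bound (C := K) (by simpa using hwK)).trans ?_
    rw [measure_univ, ENNReal.one_rpow, one_mul, hKdef, hF, forceSize, mul_assoc]

lemma exists_pow_mul_sq_le_one (r : ℝ) : ∃ n : ℕ, ∀ k, n ≤ k → (8 / 9 : ℝ) ^ k * r ^ 2 ≤ 1 := by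
  have h := (tendsto_pow_atTop_nhds_zero_of_lt_one (r := (8 : ℝ) / 9) (by norm_num)
    (by norm_num)).mul_const (r ^ 2)
  rw [zero_mul] at h
  exact Filter.eventually_atTop.1 (h.eventually_le_const zero_lt_one)

end NSTorus

theorem lemma2p2 :
    (∃ t₀ : ℝ → ℝ, (∀ r : ℝ, 0 < t₀ r) ∧
      ∀ lam : ℝ, 0 ≤ lam → ∃ C : ℝ, 0 < C ∧
        ∀ (M : ℝ) (u₀ : NSTorus.T2 → NSTorus.V2) (f u : ℝ → NSTorus.T2 → NSTorus.V2),
          1 ≤ M → NSTorus.IsInitialDatum u₀ → NSTorus.IsForce lam M f →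
          NSTorus.IsWeakSolution u₀ f u →
          ∀ t : ℝ, t₀ (eLpNorm u₀ 2 volume).toReal ≤ t →
            NSTorus.VorticityBound (u t) (C * M)) ∧
    (∀ lam : ℝ, 0 ≤ lam → ∀ r : ℝ, 0 ≤ r → ∀ t₀ : ℝ, 0 < t₀ → ∃ C : ℝ, 0 < C ∧
        ∀ (M : ℝ) (u₀ : NSTorus.T2 → NSTorus.V2) (f u : ℝ → NSTorus.T2 → NSTorus.V2),
          1 ≤ M → NSTorus.IsInitialDatum u₀ → (eLpNorm u₀ 2 volume).toReal = r →
          NSTorus.IsForce lam M f → NSTorus.IsWeakSolution u₀ f u →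
          ∀ t : ℝ, t₀ ≤ t → NSTorus.VorticityBound (u t) (C * M)) := by
  constructor
  · choose n hn using NSTorus.exists_pow_mul_sq_le_one
    refine ⟨fun r => n r + 1, fun r => by positivity, fun lam hlam =>
      ⟨NSTorus.vortConst 1 1 * 8 ^ lam, mul_pos (NSTorus.vortConst_pos one_pos zero_le_one)
        (Real.rpow_pos_of_pos (by norm_num) _), fun M u₀ f u hM h0 hf hu t ht => ?_⟩⟩
    have ht' : (n (eLpNorm u₀ 2 volume).toReal : ℝ) ≤ t - 1 := by linarith
    have h := NSTorus.vorticityBound_of_energy hlam hM h0 hf hu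
      ((Nat.cast_nonneg _).trans ht') one_pos le_rfl zero_le_one (hn _ _ (Nat.le_floor ht'))
    rwa [sub_add_cancel] at h
  · intro lam hlam r hr t₀ ht₀
    have hτ : 0 < min 1 t₀ := lt_min one_pos ht₀
    refine ⟨NSTorus.vortConst (min 1 t₀) (r ^ 2) * 8 ^ lam,
      mul_pos (NSTorus.vortConst_pos hτ (sq_nonneg r)) (Real.rpow_pos_of_pos (by norm_num) _),
      fun M u₀ f u hM h0 hr' hf hu t ht => ?_⟩
    have hs : 0 ≤ t - min 1 t₀ := by linarith [min_le_right 1 t₀]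
    have h := NSTorus.vorticityBound_of_energy hlam hM h0 hf hu hs hτ (min_le_left _ _)
      (sq_nonneg r) (by
        rw [hr']
        exact mul_le_of_le_one_left (sq_nonneg r) (pow_le_one₀ (by norm_num) (by norm_num)))
    rwa [sub_add_cancel] at h
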